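/- Notation: $(x,y)\in\mathbb R^2$, $\langle\delta\tilde y\rangle=(1+\delta^2(x^2+y^2))^{1/2}$, and $\|u\|_{H^4}^2=\sum_{|\alpha|\le4}\|\partial^\alpha u\|_{L^2(\mathbb R^2)}^2$; all functions are real valued. For $\delta>0$, $T>0$, $g\in L^\infty(0,T;H^4(\mathbb R^2))$ and $v_0\in H^4(\mathbb R^2)$ consider the Cauchy problem $$\partial_t v+A_\delta v=0\ \text{ on }(0,T)\times\mathbb R^2,\qquad v|_{t=0}=\langle\delta\tilde y\rangle^{-1}v_0,$$ $$A_\delta v=\langle\delta\tilde y\rangle^{-1}y\,\partial_x\big(\langle\delta\tilde y\rangle^{-1}v\big)-\langle\delta\tilde y\rangle^{-1}(1+g)^2\,\partial_y^2\big(\langle\delta\tilde y\rangle^{-1}v\big).$$ A weak solution is a function $v\in L^\infty(0,T;H^4(\mathbb R^2))$ such that for all $\varphi\in C_c^\infty([0,T)\times\mathbb R^2)$ $$\int_0^T\!\!\int_{\mathbb R^2}\big(-v\,\partial_t\varphi+(A_\delta v)\,\varphi\big)\,dx\,dy\,dt=\int_{\mathbb R^2}\langle\delta\tilde y\rangle^{-1}v_0\,\varphi(0,\cdot)\,dx\,dy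 .$$ Proposition 2.1. There are constants $\varepsilon_0>0$ and $\delta_0>0$ such that for every $T>0$ there is a constant $B_0>0$, depending on $T$ but not on $\delta$, $g$, $v_0$, with the following property. Let $0<\delta<\delta_0$, and let $g\in L^\infty(0,T;H^4(\mathbb R^2))$ and $v_0\in H^4(\mathbb R^2)$ satisfy $$\|g\|_{L^\infty(0,T;H^4(\mathbb R^2))}\le\varepsilon_0,\qquad \|v_0\|_{H^4(\mathbb R^2)}\le\varepsilon_0 .$$ Then the Cauchy problem has a weak solution $v_\delta$, and it is unique: every weak solution equals $v_\delta(t)$ for almost every $t\in(0,T)$. Moreover $v_\delta$ has a weakly continuous representative $[0,T]\to H^4(\mathbb R^2)$, $\partial_y(\langle\delta\tilde y\rangle^{-1}v_\delta)\in L^2(0,T;H^4(\mathbb R^2))$, and for this representative $$\|v_\delta(t)\|_{H^4}^2+\frac14\int_0^t\big\|\partial_y\big(\langle\delta\tilde y\rangle^{-1}v_\delta\big)(s)\big\|_{H^4}^2\,ds\le B_0\|v_0\|_{H^4}^2,\qquad 0<t\le T .$$ -/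

import Mathlib

open MeasureTheory Set
open scoped ENNReal ContDiff

noncomputable section

namespace KP

/-- The partial derivative `∂ₓ` of a function of `(x, y)`. -/
def dx (φ : ℝ × ℝ → ℝ) : ℝ × ℝ → ℝ := fun p => deriv (fun s => φ (s, p.2)) p.1

/-- The partial derivative `∂_y` of a function of `(x, y)`. -/
def dy (φ : ℝ × ℝ → ℝ) : ℝ × ℝ → ℝ := fun p => deriv (fun s => φ (p.1, s)) p.2

/-- Test functions, `φ ∈ C_c^∞(ℝ²)`. -/
def IsTest (φ : ℝ × ℝ → ℝ) : Prop := ContDiff ℝ ∞ φ ∧ HasCompactSupport φ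

/-- `h = ∂ₓ^a ∂_y^b f` in the sense of distributions on `ℝ²`, for locally integrable `f`, `h`. -/
def HasWeakDeriv (a b : ℕ) (f h : ℝ × ℝ → ℝ) : Prop :=
  LocallyIntegrable f ∧ LocallyIntegrable h ∧
    ∀ φ, IsTest φ → ∫ p, h p * φ p = (-1) ^ (a + b) * ∫ p, f p * dx^[a] (dy^[b] φ) p

open Classical in
/-- The weak derivative `∂ₓ^a ∂_y^b f` (unique up to null sets if it exists; `0` otherwise). -/
def weakDeriv (a b : ℕ) (f : ℝ × ℝ → ℝ) : ℝ × ℝ → ℝ :=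
  if h : ∃ u, HasWeakDeriv a b f u then h.choose else 0

/-- The multi-indices `α ∈ ℕ²` with `|α| ≤ k`. -/
abbrev MultiIndex (k : ℕ) : Type :=
  {α : Fin (k + 1) × Fin (k + 1) // (α.1 : ℕ) + (α.2 : ℕ) ≤ k}

/-- The multi-index `0`. -/
def MultiIndex.zero (k : ℕ) : MultiIndex k := ⟨(0, 0), by simp⟩

/-- The space `L²(ℝ²)` of real functions. -/
abbrev L2 : Type := Lp ℝ 2 (volume : Measure (ℝ × ℝ))

theorem L2.locallyIntegrable (f : L2) : LocallyIntegrable (f : ℝ × ℝ → ℝ) :=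
  (Lp.memLp f).locallyIntegrable (by norm_num)

theorem IsTest.integrable_mul {φ : ℝ × ℝ → ℝ} (hφ : IsTest φ) {f : ℝ × ℝ → ℝ}
    (hf : LocallyIntegrable f) : Integrable fun p => f p * φ p :=
  hf.integrable_smul_right_of_hasCompactSupport hφ.1.continuous hφ.2

theorem dx_eq {φ : ℝ × ℝ → ℝ} (hφ : ContDiff ℝ ∞ φ) : dx φ = fun p => fderiv ℝ φ p (1, 0) := by
  funext p
  have h1 : HasFDerivAt φ (fderiv ℝ φ p) (p.1, p.2) :=
    (hφ.differentiable (by simp) p).hasFDerivAt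
  have h2 : HasDerivAt (fun s : ℝ => (s, p.2)) (1, 0) p.1 :=
    (hasDerivAt_id p.1).prodMk (hasDerivAt_const _ _)
  exact (h1.comp_hasDerivAt p.1 h2).deriv

theorem dy_eq {φ : ℝ × ℝ → ℝ} (hφ : ContDiff ℝ ∞ φ) : dy φ = fun p => fderiv ℝ φ p (0, 1) := by
  funext p
  have h1 : HasFDerivAt φ (fderiv ℝ φ p) (p.1, p.2) :=
    (hφ.differentiable (by simp) p).hasFDerivAt
  have h2 : HasDerivAt (fun s : ℝ => (p.1, s)) (0, 1) p.2 :=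
    (hasDerivAt_const _ _).prodMk (hasDerivAt_id p.2)
  exact (h1.comp_hasDerivAt p.2 h2).deriv

theorem IsTest.dx {φ : ℝ × ℝ → ℝ} (hφ : IsTest φ) : IsTest (dx φ) := by
  rw [dx_eq hφ.1]
  exact ⟨(hφ.1.fderiv_right (m := ∞) (by simp)).clm_apply contDiff_const,
    hφ.2.fderiv_apply (𝕜 := ℝ) _⟩

theorem IsTest.dy {φ : ℝ × ℝ → ℝ} (hφ : IsTest φ) : IsTest (dy φ) := by
  rw [dy_eq hφ.1]
  exact ⟨(hφ.1.fderiv_right (m := ∞) (by simp)).clm_apply contDiff_const,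
    hφ.2.fderiv_apply (𝕜 := ℝ) _⟩

theorem IsTest.iterate {φ : ℝ × ℝ → ℝ} (hφ : IsTest φ) (a b : ℕ) :
    IsTest (KP.dx^[a] (KP.dy^[b] φ)) := by
  have hb : IsTest (KP.dy^[b] φ) := by
    induction b with
    | zero => exact hφ
    | succ n ih => rw [Function.iterate_succ_apply']; exact ih.dy
  induction a with
  | zero => exact hb
  | succ n ih => rw [Function.iterate_succ_apply']; exact ih.dx

theorem HasWeakDeriv.congr {a b : ℕ} {f h f' h' : ℝ × ℝ → ℝ} (H : HasWeakDeriv a b f h)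
    (hf : f =ᵐ[volume] f') (hh : h =ᵐ[volume] h') : HasWeakDeriv a b f' h' := by
  refine ⟨H.1.congr hf, H.2.1.congr hh, fun φ hφ => ?_⟩
  have e1 : ∫ p, h p * φ p = ∫ p, h' p * φ p :=
    integral_congr_ae (hh.mono fun p hp => congrArg (· * φ p) hp)
  have e2 : ∫ p, f p * KP.dx^[a] (KP.dy^[b] φ) p = ∫ p, f' p * KP.dx^[a] (KP.dy^[b] φ) p :=
    integral_congr_ae (hf.mono fun p hp => congrArg (· * KP.dx^[a] (KP.dy^[b] φ) p) hp)
  rw [← e1, ← e2]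
  exact H.2.2 φ hφ

theorem HasWeakDeriv.add {a b : ℕ} {f h f' h' : ℝ × ℝ → ℝ} (H : HasWeakDeriv a b f h)
    (H' : HasWeakDeriv a b f' h') : HasWeakDeriv a b (f + f') (h + h') := by
  refine ⟨H.1.add H'.1, H.2.1.add H'.2.1, fun φ hφ => ?_⟩
  simp only [Pi.add_apply, add_mul]
  rw [integral_add (hφ.integrable_mul H.2.1) (hφ.integrable_mul H'.2.1),
    integral_add ((hφ.iterate a b).integrable_mul H.1) ((hφ.iterate a b).integrable_mul H'.1),
    H.2.2 φ hφ, H'.2.2 φ hφ, mul_add]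

theorem HasWeakDeriv.smul {a b : ℕ} {f h : ℝ × ℝ → ℝ} (c : ℝ) (H : HasWeakDeriv a b f h) :
    HasWeakDeriv a b (c • f) (c • h) := by
  refine ⟨H.1.smul c, H.2.1.smul c, fun φ hφ => ?_⟩
  simp only [Pi.smul_apply, smul_eq_mul, mul_assoc, integral_const_mul, H.2.2 φ hφ]
  ring

theorem HasWeakDeriv.zero (a b : ℕ) : HasWeakDeriv a b 0 0 :=
  ⟨locallyIntegrable_zero, locallyIntegrable_zero, fun φ _ => by simp⟩

/-- The Sobolev space `H^k(ℝ²)`: an element is the family `(∂^α u)_{|α| ≤ k}` of the weak derivatives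
in `L²(ℝ²)` of a function `u`. With the `ℓ²` norm of such families, the inner product is
`(u, w) = ∑_{|α| ≤ k} (∂^α u, ∂^α w)_{L²}` and `‖u‖² = ∑_{|α| ≤ k} ‖∂^α u‖²_{L²}`. -/
def sobolev (k : ℕ) : Submodule ℝ (PiLp 2 fun _ : MultiIndex k => L2) where
  carrier := {F | ∀ α : MultiIndex k, HasWeakDeriv α.1.1 α.1.2 (F (MultiIndex.zero k)) (F α)}
  add_mem' hF hG α :=
    ((hF α).add (hG α)).congr (Lp.coeFn_add _ _).symm (Lp.coeFn_add _ _).symm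
  zero_mem' _ :=
    (HasWeakDeriv.zero _ _).congr (Lp.coeFn_zero ℝ 2 volume).symm (Lp.coeFn_zero ℝ 2 volume).symm
  smul_mem' c _ hF α :=
    ((hF α).smul c).congr (Lp.coeFn_smul c _).symm (Lp.coeFn_smul c _).symm

/-- The Hilbert space `H⁴(ℝ²)`. -/
abbrev H4 : Type := sobolev 4

/-- The function underlying an element of `H⁴(ℝ²)`. -/
def H4.fn (u : H4) : ℝ × ℝ → ℝ := (u : PiLp 2 fun _ : MultiIndex 4 => L2) (MultiIndex.zero 4)

/-- The weight `⟨δ(x, y)⟩⁻¹ = (1 + δ²(x² + y²))^{-1/2}`. -/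
def weight (δ : ℝ) (p : ℝ × ℝ) : ℝ := (Real.sqrt (1 + δ ^ 2 * (p.1 ^ 2 + p.2 ^ 2)))⁻¹

/-- Lebesgue measure on the time interval `(0, T)`. -/
abbrev timeMeasure (T : ℝ) : Measure ℝ := volume.restrict (Ioo 0 T)

/-- The spatial operator
`A u = ⟨δ(x,y)⟩⁻¹ y ∂ₓ(⟨δ(x,y)⟩⁻¹ u) - ⟨δ(x,y)⟩⁻¹ (1 + g)² ∂_y²(⟨δ(x,y)⟩⁻¹ u)`. -/
def spatialOp (δ : ℝ) (g u : ℝ × ℝ → ℝ) : ℝ × ℝ → ℝ := fun p =>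
  weight δ p * p.2 * weakDeriv 1 0 (fun q => weight δ q * u q) p
    - weight δ p * (1 + g p) ^ 2 * weakDeriv 0 2 (fun q => weight δ q * u q) p

/-- `v ∈ L^∞(0,T; H⁴(ℝ²))` is a weak solution of `∂ₜ v + A v = 0` on `(0,T) × ℝ²` with
`v = ⟨δ(x,y)⟩⁻¹ v₀` at `t = 0`: the equation and the initial condition hold when tested against
every `φ ∈ C_c^∞([0,T) × ℝ²)`. -/
structure IsWeakSolution (T δ : ℝ) (g : ℝ → H4) (v₀ : H4) (v : ℝ → H4) : Prop where
  memLp : MemLp v ∞ (timeMeasure T)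
  eqn : ∀ φ : ℝ × (ℝ × ℝ) → ℝ, ContDiff ℝ ∞ φ → HasCompactSupport φ →
    tsupport φ ⊆ Iio T ×ˢ univ →
    ∫ t in Ioo 0 T, ∫ p : ℝ × ℝ,
        (-((v t).fn p * deriv (fun s => φ (s, p)) t)
          + spatialOp δ (g t).fn (v t).fn p * φ (t, p))
      = ∫ p : ℝ × ℝ, weight δ p * v₀.fn p * φ (0, p)

end KP

end

noncomputable section

namespace KP

/-! The problem is linear once `g` is given, so everything rests on an energy estimate in `H⁴` whose
constants do not depend on `δ`, and on an approximation scheme that preserves it.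

The estimate pairs `∂^α A u` with `∂^α u` in `L²` for `|α| ≤ 4`. The drift coefficient `⟨δỹ⟩⁻² y` is
of size `δ⁻¹`, but a first order operator is skew-adjoint up to a derivative of its coefficient, and
commutators with `∂^α` also differentiate the coefficient at least once; these derivatives are
bounded uniformly for `0 ≤ δ ≤ 1` (`exists_coeffBound`). Write `(1 + g)² = 1 + m` and `F =
∂_y(⟨δỹ⟩⁻¹ u)`. Integrating the diffusion by parts in `y` produces `∫ (1 + m)|∂^α F|²`, which is
coercive because `m` is small in `H⁴` and hence small pointwise. All the commutators are bounded by
a constant times `‖F‖ ‖u‖` in `H⁴`, by the Leibniz rule and the Sobolev inequality, and are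
absorbed. This is `sum_ip_energyOp_ge`; `ip_energyOp_self_ge` is its `L²` version.

For existence, let `L = ∑ (-1)^{|α|} ∂^{2α}`. The `H⁴` product of `u` with a test function `φ` is
the `L²` product of `u` with `Lφ` (`inner_incl_LTest`). Hence `A` only has to be bounded from `H⁴`
to `L²` for a Galerkin scheme in the `H⁴` inner product to make sense. The approximations live in
spans of finitely many test functions, solve a linear ODE and inherit the estimate
(`exists_galerkin`); a weak limit solves the equation integrated in time (`exists_evolution`).
Density of the range of `L` in `L²` (`ae_eq_zero_of_Lop`) identifies the limit equation, and also
makes test functions dense in `H⁴`, so that estimates proved for smooth `g` hold for all small `g`.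

The bound on `∂_y(⟨δỹ⟩⁻¹ v)` follows from Fatou's lemma applied to the dissipation of the
approximations and from weak limits at almost every time (`exists_memLp_weight_deriv`). For
uniqueness, the weak formulation is shown to imply the integrated equation almost everywhere
(`IsWeakSolution.integral_eq`), and Grönwall's inequality is applied to the `L²` norm of a
difference. -/

/-- Smooth functions on the plane. -/
abbrev Smooth (f : ℝ × ℝ → ℝ) : Prop := ContDiff ℝ ∞ f

/-- The classical partial derivative `∂ₓ^a ∂_y^b`. -/
def D (a b : ℕ) (f : ℝ × ℝ → ℝ) : ℝ × ℝ → ℝ := dx^[a] (dy^[b] f)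

/-! ### Calculus of mixed partial derivatives of smooth functions. -/

section Smooth

variable {f g : ℝ × ℝ → ℝ}

theorem smooth_dx (hf : Smooth f) : Smooth (dx f) := by
  rw [dx_eq hf]
  exact (hf.fderiv_right (m := ∞) (by simp)).clm_apply contDiff_const

theorem smooth_dy (hf : Smooth f) : Smooth (dy f) := by
  rw [dy_eq hf]
  exact (hf.fderiv_right (m := ∞) (by simp)).clm_apply contDiff_const

theorem smooth_iterate_dx (hf : Smooth f) (n : ℕ) : Smooth (dx^[n] f) := by
  induction n with
  | zero => exact hf
  | succ n ih => rw [Function.iterate_succ_apply']; exact smooth_dx ih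

theorem smooth_iterate_dy (hf : Smooth f) (n : ℕ) : Smooth (dy^[n] f) := by
  induction n with
  | zero => exact hf
  | succ n ih => rw [Function.iterate_succ_apply']; exact smooth_dy ih

theorem smooth_D (hf : Smooth f) (a b : ℕ) : Smooth (D a b f) :=
  smooth_iterate_dx (smooth_iterate_dy hf b) a

theorem Smooth.differentiableAt (hf : Smooth f) (p : ℝ × ℝ) : DifferentiableAt ℝ f p :=
  hf.differentiable (by simp) p

theorem dx_add (hf : Smooth f) (hg : Smooth g) : dx (f + g) = dx f + dx g := by
  have h : Smooth (f + g) := hf.add hg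
  rw [dx_eq h, dx_eq hf, dx_eq hg]
  funext p
  simp [fderiv_add (hf.differentiableAt p) (hg.differentiableAt p)]

theorem dy_add (hf : Smooth f) (hg : Smooth g) : dy (f + g) = dy f + dy g := by
  have h : Smooth (f + g) := hf.add hg
  rw [dy_eq h, dy_eq hf, dy_eq hg]
  funext p
  simp [fderiv_add (hf.differentiableAt p) (hg.differentiableAt p)]

theorem dx_smul (c : ℝ) (hf : Smooth f) : dx (c • f) = c • dx f := by
  have h : Smooth (c • f) := hf.const_smul c
  rw [dx_eq h, dx_eq hf]
  funext p
  simp [fderiv_const_smul (hf.differentiableAt p)]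

theorem dy_smul (c : ℝ) (hf : Smooth f) : dy (c • f) = c • dy f := by
  have h : Smooth (c • f) := hf.const_smul c
  rw [dy_eq h, dy_eq hf]
  funext p
  simp [fderiv_const_smul (hf.differentiableAt p)]

theorem dx_mul (hf : Smooth f) (hg : Smooth g) : dx (f * g) = dx f * g + f * dx g := by
  have h : Smooth (f * g) := hf.mul hg
  rw [dx_eq h, dx_eq hf, dx_eq hg]
  funext p
  simp [fderiv_mul (hf.differentiableAt p) (hg.differentiableAt p)]
  ring

theorem dy_mul (hf : Smooth f) (hg : Smooth g) : dy (f * g) = dy f * g + f * dy g := by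
  have h : Smooth (f * g) := hf.mul hg
  rw [dy_eq h, dy_eq hf, dy_eq hg]
  funext p
  simp [fderiv_mul (hf.differentiableAt p) (hg.differentiableAt p)]
  ring

theorem dx_dy_comm (hf : Smooth f) : dx (dy f) = dy (dx f) := by
  rw [dx_eq (smooth_dy hf), dy_eq (smooth_dx hf), dx_eq hf, dy_eq hf]
  funext p
  have hd : DifferentiableAt ℝ (fderiv ℝ f) p :=
    (hf.fderiv_right (m := ∞) (by simp)).differentiable (by simp) p
  have hs : IsSymmSndFDerivAt ℝ f p :=
    hf.contDiffAt.isSymmSndFDerivAt (by simpa using (WithTop.coe_le_coe.2 (le_top : (2 : ℕ∞) ≤ ⊤)))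
  rw [fderiv_clm_apply hd (by fun_prop), fderiv_clm_apply hd (by fun_prop)]
  simpa using hs.eq (1, 0) (0, 1)

theorem iterate_dx_dy_comm (hf : Smooth f) (n : ℕ) : dx^[n] (dy f) = dy (dx^[n] f) := by
  induction n with
  | zero => rfl
  | succ n ih =>
    rw [Function.iterate_succ_apply', ih, dx_dy_comm (smooth_iterate_dx hf n),
      Function.iterate_succ_apply']

theorem D_dy (a b : ℕ) : D a b (dy f) = D a (b + 1) f := rfl

theorem dx_D (a b : ℕ) : dx (D a b f) = D (a + 1) b f := by
  simp only [D]
  rw [Function.iterate_succ_apply']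

theorem dy_D (hf : Smooth f) (a b : ℕ) : dy (D a b f) = D a (b + 1) f := by
  simp only [D]
  rw [← iterate_dx_dy_comm (smooth_iterate_dy hf b), ← Function.iterate_succ_apply' dy]

theorem D_dx (hf : Smooth f) (a b : ℕ) : D a b (dx f) = D (a + 1) b f := by
  induction b with
  | zero => rfl
  | succ b ih =>
    rw [← dy_D (smooth_dx hf), ih, dy_D hf]

theorem D_D (hf : Smooth f) (a b c d : ℕ) : D a b (D c d f) = D (a + c) (b + d) f := by
  induction a with
  | zero =>
    induction b with
    | zero => simp [D]
    | succ b ih =>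
      rw [← dy_D (smooth_D hf c d), ih, dy_D hf]
      congr 1
      omega
  | succ a ih =>
    rw [← dx_D, ih, dx_D]
    congr 1
    omega

theorem iterate_dx_add (hf : Smooth f) (hg : Smooth g) (n : ℕ) :
    dx^[n] (f + g) = dx^[n] f + dx^[n] g := by
  induction n with
  | zero => rfl
  | succ n ih =>
    simp only [Function.iterate_succ_apply']
    rw [ih, dx_add (smooth_iterate_dx hf n) (smooth_iterate_dx hg n)]

theorem iterate_dy_add (hf : Smooth f) (hg : Smooth g) (n : ℕ) :
    dy^[n] (f + g) = dy^[n] f + dy^[n] g := by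
  induction n with
  | zero => rfl
  | succ n ih =>
    simp only [Function.iterate_succ_apply']
    rw [ih, dy_add (smooth_iterate_dy hf n) (smooth_iterate_dy hg n)]

theorem D_add (hf : Smooth f) (hg : Smooth g) (a b : ℕ) : D a b (f + g) = D a b f + D a b g := by
  simp only [D]
  rw [iterate_dy_add hf hg, iterate_dx_add (smooth_iterate_dy hf b) (smooth_iterate_dy hg b)]

theorem iterate_dx_smul (c : ℝ) (hf : Smooth f) (n : ℕ) : dx^[n] (c • f) = c • dx^[n] f := by
  induction n with
  | zero => rfl
  | succ n ih =>
    simp only [Function.iterate_succ_apply']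
    rw [ih, dx_smul c (smooth_iterate_dx hf n)]

theorem iterate_dy_smul (c : ℝ) (hf : Smooth f) (n : ℕ) : dy^[n] (c • f) = c • dy^[n] f := by
  induction n with
  | zero => rfl
  | succ n ih =>
    simp only [Function.iterate_succ_apply']
    rw [ih, dy_smul c (smooth_iterate_dy hf n)]

theorem D_smul (c : ℝ) (hf : Smooth f) (a b : ℕ) : D a b (c • f) = c • D a b f := by
  simp only [D]
  rw [iterate_dy_smul c hf, iterate_dx_smul c (smooth_iterate_dy hf b)]

theorem smooth_sum {ι : Type*} {s : Finset ι} {F : ι → ℝ × ℝ → ℝ} (h : ∀ i ∈ s, Smooth (F i)) :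
    Smooth (∑ i ∈ s, F i) := by
  classical
  induction s using Finset.induction_on with
  | empty => exact contDiff_const (c := (0 : ℝ))
  | insert i s hi ih =>
    rw [Finset.sum_insert hi]
    exact (h i (Finset.mem_insert_self i s)).add
      (ih fun j hj => h j (Finset.mem_insert_of_mem hj))

theorem D_zero (a b : ℕ) : D a b 0 = 0 := by
  have h := D_smul (f := 0) 0 (contDiff_const (c := (0 : ℝ))) a b
  simpa using h

theorem D_sum {ι : Type*} {s : Finset ι} {F : ι → ℝ × ℝ → ℝ} (h : ∀ i ∈ s, Smooth (F i))
    (a b : ℕ) : D a b (∑ i ∈ s, F i) = ∑ i ∈ s, D a b (F i) := by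
  classical
  induction s using Finset.induction_on with
  | empty => simp [D_zero]
  | insert i s hi ih =>
    have h1 := fun j hj => h j (Finset.mem_insert_of_mem hj)
    rw [Finset.sum_insert hi, Finset.sum_insert hi,
      D_add (h i (Finset.mem_insert_self i s)) (smooth_sum h1), ih h1]

theorem smooth_smul (c : ℝ) (hf : Smooth f) : Smooth (c • f) := hf.const_smul c

theorem smooth_mul (hf : Smooth f) (hg : Smooth g) : Smooth (f * g) := hf.mul hg

theorem smooth_add (hf : Smooth f) (hg : Smooth g) : Smooth (f + g) := hf.add hg

theorem iterate_dx_mul (hf : Smooth f) (hg : Smooth g) (n : ℕ) :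
    dx^[n] (f * g) = ∑ i ∈ Finset.HasAntidiagonal.antidiagonal n,
      (n.choose i.1 : ℝ) • (dx^[i.1] f * dx^[i.2] g) := by
  have key : ∀ i j : ℕ, Smooth (dx^[i] f * dx^[j] g) := fun i j =>
    (smooth_iterate_dx hf i).mul (smooth_iterate_dx hg j)
  induction n with
  | zero => simp
  | succ n ih =>
    -- Pascal's rule: the two sums it produces are those where the new derivative falls on one or
    -- the other factor.
    have h1 := Finset.sum_antidiagonal_choose_succ_nsmul
      (fun i j => dx^[i] f * dx^[j] g) n
    simp only [← Nat.cast_smul_eq_nsmul ℝ] at h1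
    rw [Function.iterate_succ_apply', ih, h1]
    have h2 := D_sum (s := Finset.HasAntidiagonal.antidiagonal n)
      (F := fun i => (n.choose i.1 : ℝ) • (dx^[i.1] f * dx^[i.2] g))
      (fun i _ => smooth_smul _ (key i.1 i.2)) 1 0
    have h3 : ∀ φ : ℝ × ℝ → ℝ, D 1 0 φ = dx φ := fun _ => rfl
    simp only [h3] at h2
    rw [h2, ← Finset.sum_add_distrib]
    refine Finset.sum_congr rfl fun i hi => ?_
    rw [dx_smul _ (key i.1 i.2), dx_mul (smooth_iterate_dx hf i.1) (smooth_iterate_dx hg i.2),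
      ← Function.iterate_succ_apply' dx, ← Function.iterate_succ_apply' dx,
      Nat.choose_symm_of_eq_add (Finset.HasAntidiagonal.mem_antidiagonal.1 hi).symm, smul_add,
      add_comm]

theorem iterate_dy_mul (hf : Smooth f) (hg : Smooth g) (n : ℕ) :
    dy^[n] (f * g) = ∑ i ∈ Finset.HasAntidiagonal.antidiagonal n,
      (n.choose i.1 : ℝ) • (dy^[i.1] f * dy^[i.2] g) := by
  have key : ∀ i j : ℕ, Smooth (dy^[i] f * dy^[j] g) := fun i j =>
    (smooth_iterate_dy hf i).mul (smooth_iterate_dy hg j)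
  induction n with
  | zero => simp
  | succ n ih =>
    have h1 := Finset.sum_antidiagonal_choose_succ_nsmul
      (fun i j => dy^[i] f * dy^[j] g) n
    simp only [← Nat.cast_smul_eq_nsmul ℝ] at h1
    rw [Function.iterate_succ_apply', ih, h1]
    have h2 := D_sum (s := Finset.HasAntidiagonal.antidiagonal n)
      (F := fun i => (n.choose i.1 : ℝ) • (dy^[i.1] f * dy^[i.2] g))
      (fun i _ => smooth_smul _ (key i.1 i.2)) 0 1
    have h3 : ∀ φ : ℝ × ℝ → ℝ, D 0 1 φ = dy φ := fun _ => rfl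
    simp only [h3] at h2
    rw [h2, ← Finset.sum_add_distrib]
    refine Finset.sum_congr rfl fun i hi => ?_
    rw [dy_smul _ (key i.1 i.2), dy_mul (smooth_iterate_dy hf i.1) (smooth_iterate_dy hg i.2),
      ← Function.iterate_succ_apply' dy, ← Function.iterate_succ_apply' dy,
      Nat.choose_symm_of_eq_add (Finset.HasAntidiagonal.mem_antidiagonal.1 hi).symm, smul_add,
      add_comm]

/-- The Leibniz rule for mixed partial derivatives. -/
theorem D_mul (hf : Smooth f) (hg : Smooth g) (a b : ℕ) :
    D a b (f * g) = ∑ q ∈ Finset.HasAntidiagonal.antidiagonal a ×ˢ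
      Finset.HasAntidiagonal.antidiagonal b,
      ((a.choose q.1.1 : ℝ) * (b.choose q.2.1 : ℝ)) •
        (D q.1.1 q.2.1 f * D q.1.2 q.2.2 g) := by
  have key : ∀ i j : ℕ, Smooth (dy^[i] f * dy^[j] g) := fun i j =>
    (smooth_iterate_dy hf i).mul (smooth_iterate_dy hg j)
  have h0 : D a b (f * g) = D a 0 (dy^[b] (f * g)) := rfl
  rw [h0, iterate_dy_mul hf hg, D_sum fun i _ => smooth_smul _ (key i.1 i.2),
    Finset.sum_product_right]
  refine Finset.sum_congr rfl fun i _ => ?_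
  rw [D_smul _ (key i.1 i.2)]
  have h1 : D a 0 (dy^[i.1] f * dy^[i.2] g) = dx^[a] (dy^[i.1] f * dy^[i.2] g) := rfl
  rw [h1, iterate_dx_mul (smooth_iterate_dy hf _) (smooth_iterate_dy hg _), Finset.smul_sum]
  refine Finset.sum_congr rfl fun j _ => ?_
  rw [smul_smul, mul_comm]
  rfl

end Smooth

/-! ### Test functions, integration by parts, the norms of `L²` and `H⁴`, and the Sobolev
inequality. -/

/-- Smooth functions all of whose partial derivatives are square integrable. -/
structure Hinf (f : ℝ × ℝ → ℝ) : Prop where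
  smooth : Smooth f
  memLp : ∀ a b, MemLp (D a b f) 2 volume

section Test

variable {f g c : ℝ × ℝ → ℝ}

theorem IsTest.D (hf : IsTest f) (a b : ℕ) : IsTest (D a b f) := hf.iterate a b

theorem IsTest.memLp (hf : IsTest f) : MemLp f 2 volume :=
  hf.1.continuous.memLp_of_hasCompactSupport hf.2

theorem IsTest.hinf (hf : IsTest f) : Hinf f := ⟨hf.1, fun a b => (hf.D a b).memLp⟩

theorem IsTest.add (hf : IsTest f) (hg : IsTest g) : IsTest (f + g) :=
  ⟨hf.1.add hg.1, hf.2.add hg.2⟩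

theorem IsTest.const_smul (r : ℝ) (hf : IsTest f) : IsTest (r • f) :=
  ⟨smooth_smul r hf.1, hf.2.smul_left (f := fun _ => r)⟩

theorem IsTest.neg (hf : IsTest f) : IsTest (-f) := by
  simpa using hf.const_smul (-1)

theorem IsTest.sub (hf : IsTest f) (hg : IsTest g) : IsTest (f - g) := by
  simpa [sub_eq_add_neg] using hf.add hg.neg

theorem IsTest.smooth_mul (hc : Smooth c) (hf : IsTest f) : IsTest (c * f) :=
  ⟨hc.mul hf.1, hf.2.mul_left⟩

theorem IsTest.mul (hf : IsTest f) (hg : IsTest g) : IsTest (f * g) := hg.smooth_mul hf.1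

theorem IsTest.zero : IsTest 0 := ⟨contDiff_const (c := (0 : ℝ)), HasCompactSupport.zero⟩

theorem Hinf.mem (hf : Hinf f) : MemLp f 2 volume := hf.memLp 0 0

theorem Hinf.D (hf : Hinf f) (a b : ℕ) : Hinf (D a b f) :=
  ⟨smooth_D hf.smooth a b, fun c d => by rw [D_D hf.smooth]; exact hf.memLp _ _⟩

theorem Hinf.dx (hf : Hinf f) : Hinf (dx f) := hf.D 1 0

theorem Hinf.dy (hf : Hinf f) : Hinf (dy f) := hf.D 0 1

theorem integrable_mul_of_memLp (hf : MemLp f 2 volume) (hg : MemLp g 2 volume) :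
    Integrable (fun p => f p * g p) := hf.integrable_mul hg

/-- Integrability of the three products replaces compact support; convolutions of `L²` functions
with test functions need this generality. -/
theorem integral_mul_dx (hf : Hinf f) (hg : Hinf g) :
    ∫ p, f p * KP.dx g p = -∫ p, KP.dx f p * g p := by
  have h1 := integrable_mul_of_memLp hf.dx.mem hg.mem
  have h2 := integrable_mul_of_memLp hf.mem hg.dx.mem
  have h3 := integrable_mul_of_memLp hf.mem hg.mem
  rw [dx_eq hf.smooth] at h1 ⊢
  rw [dx_eq hg.smooth] at h2 ⊢
  exact integral_mul_fderiv_eq_neg_fderiv_mul_of_integrable h1 h2 h3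
    (fun p _ => hf.smooth.differentiableAt p) (fun p _ => hg.smooth.differentiableAt p)

theorem integral_mul_dy (hf : Hinf f) (hg : Hinf g) :
    ∫ p, f p * KP.dy g p = -∫ p, KP.dy f p * g p := by
  have h1 := integrable_mul_of_memLp hf.dy.mem hg.mem
  have h2 := integrable_mul_of_memLp hf.mem hg.dy.mem
  have h3 := integrable_mul_of_memLp hf.mem hg.mem
  rw [dy_eq hf.smooth] at h1 ⊢
  rw [dy_eq hg.smooth] at h2 ⊢
  exact integral_mul_fderiv_eq_neg_fderiv_mul_of_integrable h1 h2 h3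
    (fun p _ => hf.smooth.differentiableAt p) (fun p _ => hg.smooth.differentiableAt p)

/-- Integration by parts for square integrable functions. -/
theorem integral_D_mul (hf : Hinf f) (hg : Hinf g) (a b : ℕ) :
    ∫ p, KP.D a b f p * g p = (-1) ^ (a + b) * ∫ p, f p * KP.D a b g p := by
  induction a generalizing g with
  | zero =>
    induction b generalizing g with
    | zero => simp [KP.D]
    | succ b ih =>
      have h1 := integral_mul_dy (hf.D 0 b) hg
      rw [dy_D hf.smooth] at h1
      rw [← neg_eq_iff_eq_neg.2 h1, ih hg.dy, D_dy]
      ring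
  | succ a ih =>
    have h1 := integral_mul_dx (hf.D a b) hg
    rw [dx_D] at h1
    rw [← neg_eq_iff_eq_neg.2 h1, ih hg.dx, D_dx hg.smooth]
    ring

/-- The `L²` norm of a function on the plane. -/
def n2 (f : ℝ × ℝ → ℝ) : ℝ := (eLpNorm f 2 volume).toReal

theorem n2_nonneg (f : ℝ × ℝ → ℝ) : 0 ≤ n2 f := ENNReal.toReal_nonneg

theorem n2_eq_norm_toLp (hf : MemLp f 2 volume) : n2 f = ‖hf.toLp f‖ :=
  (Lp.norm_toLp f hf).symm

theorem n2_add_le (hf : MemLp f 2 volume) (hg : MemLp g 2 volume) :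
    n2 (f + g) ≤ n2 f + n2 g := by
  rw [n2_eq_norm_toLp hf, n2_eq_norm_toLp hg, n2_eq_norm_toLp (hf.add hg), MemLp.toLp_add]
  exact norm_add_le _ _

theorem n2_smul (r : ℝ) (f : ℝ × ℝ → ℝ) : n2 (r • f) = |r| * n2 f := by
  simp [n2, eLpNorm_const_smul]

theorem n2_neg (f : ℝ × ℝ → ℝ) : n2 (-f) = n2 f := by simp [n2]

theorem n2_sub_le (hf : MemLp f 2 volume) (hg : MemLp g 2 volume) :
    n2 (f - g) ≤ n2 f + n2 g := by
  rw [sub_eq_add_neg, ← n2_neg g]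
  exact n2_add_le hf hg.neg

theorem n2_sum_le {ι : Type*} {s : Finset ι} {F : ι → ℝ × ℝ → ℝ}
    (h : ∀ i ∈ s, MemLp (F i) 2 volume) : n2 (∑ i ∈ s, F i) ≤ ∑ i ∈ s, n2 (F i) := by
  classical
  induction s using Finset.induction_on with
  | empty => simp [n2]
  | insert i s hi ih =>
    have h1 := fun j hj => h j (Finset.mem_insert_of_mem hj)
    rw [Finset.sum_insert hi, Finset.sum_insert hi]
    exact (n2_add_le (h i (Finset.mem_insert_self i s)) (memLp_finsetSum' _ h1)).trans
      (by gcongr; exact ih h1)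

theorem n2_sq (hf : MemLp f 2 volume) : n2 f ^ 2 = ∫ p, f p ^ 2 := by
  rw [n2_eq_norm_toLp hf, ← real_inner_self_eq_norm_sq, L2.inner_def]
  refine integral_congr_ae (hf.coeFn_toLp.mono fun p hp => ?_)
  simp only [hp]
  simp [pow_two]

theorem abs_integral_mul_le (hf : MemLp f 2 volume) (hg : MemLp g 2 volume) :
    |∫ p, f p * g p| ≤ n2 f * n2 g := by
  have h : ∫ p, f p * g p = inner ℝ (hf.toLp f) (hg.toLp g) := by
    rw [L2.inner_def]
    refine integral_congr_ae ?_
    filter_upwards [hf.coeFn_toLp, hg.coeFn_toLp] with p h1 h2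
    simp [h1, h2, mul_comm]
  rw [h, n2_eq_norm_toLp hf, n2_eq_norm_toLp hg]
  exact abs_real_inner_le_norm _ _

theorem n2_mul_le {K : ℝ} (hc : ∀ p, |c p| ≤ K) (hf : MemLp f 2 volume) :
    n2 (c * f) ≤ K * n2 f := by
  have hK : 0 ≤ K := (abs_nonneg _).trans (hc 0)
  have h := eLpNorm_le_mul_eLpNorm_of_ae_le_mul (μ := volume) (f := c * f) (g := f) (c := K)
    (Filter.Eventually.of_forall fun p => by
      simp only [Pi.mul_apply, norm_mul, Real.norm_eq_abs]
      exact mul_le_mul_of_nonneg_right (hc p) (abs_nonneg _)) 2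
  have h2 := ENNReal.toReal_mono (ENNReal.mul_ne_top ENNReal.ofReal_ne_top hf.eLpNorm_ne_top) h
  rwa [ENNReal.toReal_mul, ENNReal.toReal_ofReal hK] at h2

/-- The `H⁴` norm of a smooth function. -/
def N (f : ℝ × ℝ → ℝ) : ℝ := √(∑ α : MultiIndex 4, n2 (KP.D α.1.1 α.1.2 f) ^ 2)

theorem N_nonneg (f : ℝ × ℝ → ℝ) : 0 ≤ N f := Real.sqrt_nonneg _

theorem N_sq (f : ℝ × ℝ → ℝ) : N f ^ 2 = ∑ α : MultiIndex 4, n2 (KP.D α.1.1 α.1.2 f) ^ 2 :=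
  Real.sq_sqrt (Finset.sum_nonneg fun _ _ => sq_nonneg _)

/-- The multi-index `(a, b)`. -/
def mi {k : ℕ} (a b : ℕ) (h : a + b ≤ k) : MultiIndex k :=
  ⟨(⟨a, by omega⟩, ⟨b, by omega⟩), h⟩

theorem n2_D_le_N (f : ℝ × ℝ → ℝ) {a b : ℕ} (h : a + b ≤ 4) : n2 (KP.D a b f) ≤ N f := by
  refine Real.le_sqrt_of_sq_le ?_
  have key := Finset.single_le_sum (f := fun α : MultiIndex 4 => n2 (KP.D α.1.1 α.1.2 f) ^ 2)
    (s := Finset.univ) (fun _ _ => sq_nonneg _) (Finset.mem_univ (mi a b h))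
  exact key

/-- There are fifteen multi-indices of order at most four, and `√15 ≤ 5`. -/
theorem N_le_of_forall {f : ℝ × ℝ → ℝ} {M : ℝ} (hM : 0 ≤ M)
    (h : ∀ a b : ℕ, a + b ≤ 4 → n2 (KP.D a b f) ≤ M) : N f ≤ 5 * M := by
  refine Real.sqrt_le_iff.2 ⟨by positivity, ?_⟩
  calc ∑ α : MultiIndex 4, n2 (KP.D α.1.1 α.1.2 f) ^ 2
      ≤ ∑ _α : MultiIndex 4, M ^ 2 := Finset.sum_le_sum fun α _ =>
        pow_le_pow_left₀ (n2_nonneg _) (h _ _ α.2) 2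
    _ = 15 * M ^ 2 := by
        rw [Finset.sum_const, nsmul_eq_mul]
        congr 1
    _ ≤ (5 * M) ^ 2 := by nlinarith [sq_nonneg M]

/-- The fundamental theorem of calculus, applied in `x` to `f` and then in `y` to `∂ₓ f`, writes the
value at a point as an integral of the mixed derivative over a quadrant. -/
theorem enorm_le_lintegral_dy_dx (hf : IsTest f) (p : ℝ × ℝ) :
    ‖f p‖ₑ ≤ ∫⁻ q, ‖KP.dy (KP.dx f) q‖ₑ := by
  have slice1 : ∀ {φ : ℝ × ℝ → ℝ}, IsTest φ → ∀ y : ℝ,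
      ContDiff ℝ 1 (fun s => φ (s, y)) ∧ HasCompactSupport (fun s => φ (s, y)) := by
    intro φ hφ y
    refine ⟨(hφ.1.of_le (by simp)).comp (contDiff_id.prodMk contDiff_const), ?_⟩
    refine HasCompactSupport.intro (hφ.2.isCompact.image continuous_fst) fun s hs => ?_
    by_contra hne
    exact hs ⟨(s, y), subset_tsupport _ hne, rfl⟩
  have slice2 : ∀ {φ : ℝ × ℝ → ℝ}, IsTest φ → ∀ x : ℝ,
      ContDiff ℝ 1 (fun s => φ (x, s)) ∧ HasCompactSupport (fun s => φ (x, s)) := by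
    intro φ hφ x
    refine ⟨(hφ.1.of_le (by simp)).comp (contDiff_const.prodMk contDiff_id), ?_⟩
    refine HasCompactSupport.intro (hφ.2.isCompact.image continuous_snd) fun s hs => ?_
    by_contra hne
    exact hs ⟨(x, s), subset_tsupport _ hne, rfl⟩
  have hm : Measurable fun q => ‖KP.dy (KP.dx f) q‖ₑ :=
    hf.dx.dy.1.continuous.enorm.measurable
  rw [Measure.volume_eq_prod, lintegral_prod _ hm.aemeasurable]
  calc ‖f p‖ₑ ≤ ∫⁻ s in Iic p.1, ‖deriv (fun s => f (s, p.2)) s‖ₑ :=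
        HasCompactSupport.enorm_le_lintegral_Ici_deriv (slice1 hf p.2).1 (slice1 hf p.2).2 p.1
    _ ≤ ∫⁻ s, ‖deriv (fun s => f (s, p.2)) s‖ₑ := setLIntegral_le_lintegral _ _
    _ ≤ ∫⁻ s, ∫⁻ r, ‖KP.dy (KP.dx f) (s, r)‖ₑ := by
        refine lintegral_mono fun s => ?_
        exact (HasCompactSupport.enorm_le_lintegral_Ici_deriv (slice2 hf.dx s).1
          (slice2 hf.dx s).2 p.2).trans (setLIntegral_le_lintegral _ _)

theorem abs_le_integral_dy_dx (hf : IsTest f) (p : ℝ × ℝ) :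
    |f p| ≤ ∫ q, |KP.dy (KP.dx f) q| := by
  have h1 := enorm_le_lintegral_dy_dx hf p
  have hi : Integrable (KP.dy (KP.dx f)) :=
    hf.dx.dy.1.continuous.integrable_of_hasCompactSupport hf.dx.dy.2
  have h2 := ENNReal.toReal_mono hi.2.ne h1
  rw [toReal_enorm] at h2
  refine h2.trans_eq ?_
  rw [← integral_norm_eq_lintegral_enorm hi.1]
  rfl

/-- The Sobolev inequality in the plane. -/
theorem sq_le_sobolev (hf : IsTest f) (p : ℝ × ℝ) :
    f p ^ 2 ≤ n2 f ^ 2 + n2 (KP.D 1 0 f) ^ 2 + n2 (KP.D 0 1 f) ^ 2 + n2 (KP.D 1 1 f) ^ 2 := by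
  -- The pointwise bound is applied to `f²`, whose mixed derivative `2 (∂ₓf ∂_yf + f ∂ₓ∂_yf)` is at
  -- most the sum of the four squares.
  have h := abs_le_integral_dy_dx (hf.mul hf) p
  have hS := hf.1
  have e : KP.dy (KP.dx (f * f)) =
      (2 : ℝ) • (KP.D 1 0 f * KP.D 0 1 f + f * KP.D 1 1 f) := by
    rw [dx_mul hS hS, dy_add (smooth_mul (smooth_dx hS) hS) (smooth_mul hS (smooth_dx hS)),
      dy_mul (smooth_dx hS) hS, dy_mul hS (smooth_dx hS), ← dx_dy_comm hS]
    funext q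
    simp [KP.D]
    ring
  have hi : ∀ a b, Integrable fun q => KP.D a b f q ^ 2 := fun a b =>
    (hf.D a b).memLp.integrable_sq
  have hi0 : Integrable fun q => f q ^ 2 := hi 0 0
  have hA : Integrable fun q => f q ^ 2 + KP.D 1 0 f q ^ 2 := hi0.add (hi 1 0)
  have hB : Integrable fun q => f q ^ 2 + KP.D 1 0 f q ^ 2 + KP.D 0 1 f q ^ 2 := hA.add (hi 0 1)
  rw [n2_sq hf.memLp, n2_sq (hf.D 1 0).memLp, n2_sq (hf.D 0 1).memLp, n2_sq (hf.D 1 1).memLp,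
    ← integral_add hi0 (hi 1 0), ← integral_add hA (hi 0 1), ← integral_add hB (hi 1 1)]
  have h0 : f p ^ 2 ≤ |(f * f) p| := by
    rw [Pi.mul_apply, ← pow_two]
    exact le_abs_self _
  refine h0.trans (h.trans (integral_mono ?_ ?_ fun q => ?_))
  · exact ((hf.mul hf).dx.dy.1.continuous.integrable_of_hasCompactSupport
      (hf.mul hf).dx.dy.2).abs
  · exact hB.add (hi 1 1)
  · simp only [e, Pi.smul_apply, Pi.add_apply, Pi.mul_apply, smul_eq_mul]
    rw [abs_le]
    constructor <;>
    nlinarith [sq_nonneg (KP.D 1 0 f q + KP.D 0 1 f q), sq_nonneg (KP.D 1 0 f q - KP.D 0 1 f q),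
      sq_nonneg (f q + KP.D 1 1 f q), sq_nonneg (f q - KP.D 1 1 f q)]

/-- The Sobolev inequality costs two derivatives out of four; its four terms give the factor `√4 =
2`. -/
theorem abs_D_le_N (hf : IsTest f) {a b : ℕ} (h : a + b ≤ 2) (p : ℝ × ℝ) :
    |KP.D a b f p| ≤ 2 * N f := by
  refine abs_le_of_sq_le_sq ?_ (by linarith [N_nonneg f])
  have h1 := sq_le_sobolev (hf.D a b) p
  have hk : ∀ c d : ℕ, c + d ≤ 2 → n2 (KP.D c d (KP.D a b f)) ^ 2 ≤ N f ^ 2 := fun c d hcd => by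
    rw [D_D hf.1]
    exact pow_le_pow_left₀ (n2_nonneg _) (n2_D_le_N f (by omega)) 2
  have h00 : n2 (KP.D a b f) ^ 2 ≤ N f ^ 2 := hk 0 0 (by norm_num)
  have := hk 1 0 (by norm_num)
  have := hk 0 1 (by norm_num)
  have := hk 1 1 (by norm_num)
  nlinarith

end Test

/-! ### Product and commutator estimates from the Leibniz rule. -/

open Finset.HasAntidiagonal in
theorem sum_choose_mul_choose (a b : ℕ) :
    ∑ q ∈ antidiagonal a ×ˢ antidiagonal b, ((a.choose q.1.1 : ℝ) * (b.choose q.2.1 : ℝ)) =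
      2 ^ (a + b) := by
  have h : ∀ n : ℕ, ∑ q ∈ antidiagonal n, (n.choose q.1 : ℝ) = 2 ^ n := fun n => by
    rw [Finset.Nat.sum_antidiagonal_eq_sum_range_succ_mk]
    exact_mod_cast Nat.sum_range_choose n
  rw [Finset.sum_product, pow_add, ← h a, ← h b, Finset.sum_mul_sum]

section Leibniz

variable {f g c : ℝ × ℝ → ℝ} {a b : ℕ} {M : ℝ}

/-- The binomial weights in the Leibniz rule add up to `2 ^ (a + b)`. -/
theorem n2_D_mul_le (hc : Smooth c) (hf : IsTest f)
    (h : ∀ i j k l : ℕ, i + k = a → j + l = b → n2 (D i j c * D k l f) ≤ M) :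
    n2 (D a b (c * f)) ≤ 2 ^ (a + b) * M := by
  rw [D_mul hc hf.1, ← sum_choose_mul_choose, Finset.sum_mul]
  refine (n2_sum_le fun q _ => ?_).trans (Finset.sum_le_sum fun q hq => ?_)
  · exact (((hf.D _ _).smooth_mul (smooth_D hc _ _)).const_smul _).memLp
  · rw [n2_smul, abs_of_nonneg (by positivity)]
    obtain ⟨h1, h2⟩ := Finset.mem_product.1 hq
    exact mul_le_mul_of_nonneg_left (h _ _ _ _ (Finset.HasAntidiagonal.mem_antidiagonal.1 h1)
      (Finset.HasAntidiagonal.mem_antidiagonal.1 h2)) (by positivity)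

/-- Subtracting `c * D a b f` removes the Leibniz term without derivatives on `c`, so bounds are
needed only for `1 ≤ i + j`: a coefficient may be large as long as its derivatives are not. -/
theorem n2_commutator_le (hc : Smooth c) (hf : IsTest f) (hM : 0 ≤ M)
    (h : ∀ i j k l : ℕ, i + k = a → j + l = b → 1 ≤ i + j → n2 (D i j c * D k l f) ≤ M) :
    n2 (D a b (c * f) - c * D a b f) ≤ 2 ^ (a + b) * M := by
  have hmem : ((0, a), (0, b)) ∈ Finset.HasAntidiagonal.antidiagonal a ×ˢ
      Finset.HasAntidiagonal.antidiagonal b := by simp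
  rw [D_mul hc hf.1, ← Finset.sum_erase_add _ _ hmem]
  have e : ((a.choose 0 : ℝ) * (b.choose 0 : ℝ)) • (D 0 0 c * D a b f) = c * D a b f := by
    simp [D]
  rw [e, add_sub_cancel_right, ← sum_choose_mul_choose, Finset.sum_mul,
    ← Finset.sum_erase_add _ _ hmem]
  refine (n2_sum_le fun q _ => ?_).trans
    ((Finset.sum_le_sum fun q hq => ?_).trans (le_add_of_nonneg_right (by positivity)))
  · exact (((hf.D _ _).smooth_mul (smooth_D hc _ _)).const_smul _).memLp
  · rw [n2_smul, abs_of_nonneg (by positivity)]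
    obtain ⟨hne, hq⟩ := Finset.mem_erase.1 hq
    obtain ⟨h1, h2⟩ := Finset.mem_product.1 hq
    have h1 := Finset.HasAntidiagonal.mem_antidiagonal.1 h1
    have h2 := Finset.HasAntidiagonal.mem_antidiagonal.1 h2
    refine mul_le_mul_of_nonneg_left (h _ _ _ _ h1 h2 ?_) (by positivity)
    by_contra hlt
    refine hne ?_
    ext <;> simp <;> omega

/-- A product of two derivatives is square integrable if one of them has order at most two. -/
theorem n2_D_mul_D_le (hf : IsTest f) (hg : IsTest g) {i j k l : ℕ} (h1 : i + j ≤ 4)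
    (h2 : k + l ≤ 4) (h3 : i + j ≤ 2 ∨ k + l ≤ 2) :
    n2 (D i j f * D k l g) ≤ 2 * N f * N g := by
  rcases h3 with h3 | h3
  · exact (n2_mul_le (abs_D_le_N hf h3) (hg.D k l).memLp).trans
      (mul_le_mul_of_nonneg_left (n2_D_le_N g h2) (by linarith [N_nonneg f]))
  · rw [mul_comm (D i j f), mul_right_comm]
    exact (n2_mul_le (abs_D_le_N hg h3) (hf.D i j).memLp).trans
      (mul_le_mul_of_nonneg_left (n2_D_le_N f h1) (by linarith [N_nonneg g]))
      |>.trans_eq (by ring)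

/-- At most four derivatives are shared between the factors, so one of them carries at most two and
is bounded pointwise. The constant is `5 · 2⁴ · 2`. -/
theorem N_mul_le (hf : IsTest f) (hg : IsTest g) : N (f * g) ≤ 160 * (N f * N g) := by
  have hn : 0 ≤ N f * N g := mul_nonneg (N_nonneg f) (N_nonneg g)
  refine (N_le_of_forall (M := 16 * (2 * N f * N g)) (by nlinarith) fun a b hab => ?_).trans_eq
    (by ring)
  refine (n2_D_mul_le hf.1 hg (M := 2 * N f * N g) fun i j k l h1 h2 =>
    n2_D_mul_D_le hf hg (by omega) (by omega) (by omega)).trans ?_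
  refine mul_le_mul_of_nonneg_right ?_ (by nlinarith)
  calc (2 : ℝ) ^ (a + b) ≤ 2 ^ 4 := pow_le_pow_right₀ (by norm_num) hab
    _ = 16 := by norm_num

theorem N_smooth_mul_le {K : ℝ} (hc : Smooth c) (hK : ∀ i j : ℕ, i + j ≤ 4 → ∀ p, |D i j c p| ≤ K)
    (hf : IsTest f) : N (c * f) ≤ 80 * K * N f := by
  have hK0 : 0 ≤ K := (abs_nonneg _).trans (hK 0 0 (by norm_num) 0)
  have hn : 0 ≤ K * N f := mul_nonneg hK0 (N_nonneg f)
  refine (N_le_of_forall (M := 16 * (K * N f)) (by positivity) fun a b hab => ?_).trans_eq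
    (by ring)
  refine (n2_D_mul_le hc hf fun i j k l h1 h2 =>
    (n2_mul_le (hK i j (by omega)) (hf.D k l).memLp).trans
      (mul_le_mul_of_nonneg_left (n2_D_le_N f (by omega)) hK0)).trans ?_
  refine mul_le_mul_of_nonneg_right ?_ hn
  calc (2 : ℝ) ^ (a + b) ≤ 2 ^ 4 := pow_le_pow_right₀ (by norm_num) hab
    _ = 16 := by norm_num

end Leibniz

/-! ### The weight and the coefficients of the operator, uniformly in `δ`. -/

/-- The functions `δ x ⟨δ(x,y)⟩⁻¹`. -/
def wx (δ : ℝ) (p : ℝ × ℝ) : ℝ := δ * p.1 * weight δ p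

/-- The functions `δ y ⟨δ(x,y)⟩⁻¹`. -/
def wy (δ : ℝ) (p : ℝ × ℝ) : ℝ := δ * p.2 * weight δ p

theorem one_le_radicand (δ : ℝ) (p : ℝ × ℝ) : 1 ≤ 1 + δ ^ 2 * (p.1 ^ 2 + p.2 ^ 2) := by
  nlinarith [mul_nonneg (sq_nonneg δ) (add_nonneg (sq_nonneg p.1) (sq_nonneg p.2))]

theorem smooth_fst : Smooth Prod.fst := contDiff_fst

theorem smooth_snd : Smooth Prod.snd := contDiff_snd

theorem smooth_weight (δ : ℝ) : Smooth (weight δ) := by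
  have h : Smooth fun p => 1 + δ ^ 2 * (p.1 ^ 2 + p.2 ^ 2) := by
    show ContDiff ℝ ∞ _
    fun_prop
  have h1 : Smooth fun p => √(1 + δ ^ 2 * (p.1 ^ 2 + p.2 ^ 2)) :=
    h.sqrt fun p => by linarith [one_le_radicand δ p]
  exact h1.inv fun p => (Real.sqrt_pos.2 (by linarith [one_le_radicand δ p])).ne'

theorem weight_pos (δ : ℝ) (p : ℝ × ℝ) : 0 < weight δ p :=
  inv_pos.2 (Real.sqrt_pos.2 (by linarith [one_le_radicand δ p]))

theorem weight_sq (δ : ℝ) (p : ℝ × ℝ) :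
    weight δ p ^ 2 * (1 + δ ^ 2 * (p.1 ^ 2 + p.2 ^ 2)) = 1 := by
  have h := one_le_radicand δ p
  rw [weight, inv_pow, Real.sq_sqrt (by linarith)]
  exact inv_mul_cancel₀ (by linarith)

theorem weight_le_one (δ : ℝ) (p : ℝ × ℝ) : weight δ p ≤ 1 :=
  inv_le_one_of_one_le₀ (Real.one_le_sqrt.2 (one_le_radicand δ p))

theorem abs_weight_le_one (δ : ℝ) (p : ℝ × ℝ) : |weight δ p| ≤ 1 := by
  rw [abs_of_pos (weight_pos δ p)]
  exact weight_le_one δ p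

theorem abs_wx_le_one (δ : ℝ) (p : ℝ × ℝ) : |wx δ p| ≤ 1 := by
  refine abs_le_one_iff_mul_self_le_one.2 ?_
  have := weight_sq δ p
  have h1 : 0 ≤ weight δ p ^ 2 * (1 + δ ^ 2 * p.2 ^ 2) := by positivity
  simp only [wx]
  nlinarith

theorem abs_wy_le_one (δ : ℝ) (p : ℝ × ℝ) : |wy δ p| ≤ 1 := by
  refine abs_le_one_iff_mul_self_le_one.2 ?_
  have := weight_sq δ p
  have h1 : 0 ≤ weight δ p ^ 2 * (1 + δ ^ 2 * p.1 ^ 2) := by positivity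
  simp only [wy]
  nlinarith

theorem dx_weight (δ : ℝ) : dx (weight δ) = fun p => -(δ * wx δ p * weight δ p ^ 2) := by
  funext p
  have h := one_le_radicand δ p
  have h1 : HasDerivAt (fun s : ℝ => 1 + δ ^ 2 * (s ^ 2 + p.2 ^ 2)) (δ ^ 2 * (2 * p.1)) p.1 := by
    simpa using (((hasDerivAt_pow 2 p.1).add_const (p.2 ^ 2)).const_mul (δ ^ 2)).const_add 1
  have hs : √(1 + δ ^ 2 * (p.1 ^ 2 + p.2 ^ 2)) ≠ 0 := (Real.sqrt_pos.2 (by linarith)).ne'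
  have h2 := (h1.sqrt (by linarith)).inv hs
  refine h2.deriv.trans ?_
  simp only [wx, weight]
  field_simp

theorem dy_weight (δ : ℝ) : dy (weight δ) = fun p => -(δ * wy δ p * weight δ p ^ 2) := by
  funext p
  have h := one_le_radicand δ p
  have h1 : HasDerivAt (fun s : ℝ => 1 + δ ^ 2 * (p.1 ^ 2 + s ^ 2)) (δ ^ 2 * (2 * p.2)) p.2 := by
    simpa using (((hasDerivAt_pow 2 p.2).const_add (p.1 ^ 2)).const_mul (δ ^ 2)).const_add 1
  have hs : √(1 + δ ^ 2 * (p.1 ^ 2 + p.2 ^ 2)) ≠ 0 := (Real.sqrt_pos.2 (by linarith)).ne'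
  have h2 := (h1.sqrt (by linarith)).inv hs
  refine h2.deriv.trans ?_
  simp only [wy, weight]
  field_simp

theorem wx_eq (δ : ℝ) : wx δ = δ • (Prod.fst * weight δ) := by
  funext p; simp [wx, mul_assoc]

theorem wy_eq (δ : ℝ) : wy δ = δ • (Prod.snd * weight δ) := by
  funext p; simp [wy, mul_assoc]

theorem smooth_wx (δ : ℝ) : Smooth (wx δ) := by
  rw [wx_eq]; exact smooth_smul _ (smooth_mul smooth_fst (smooth_weight δ))

theorem smooth_wy (δ : ℝ) : Smooth (wy δ) := by
  rw [wy_eq]; exact smooth_smul _ (smooth_mul smooth_snd (smooth_weight δ))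

theorem dx_fst : dx Prod.fst = 1 := by funext p; simp [dx]

theorem dy_fst : dy Prod.fst = 0 := by funext p; simp [dy]

theorem dx_snd : dx Prod.snd = 0 := by funext p; simp [dx]

theorem dy_snd : dy Prod.snd = 1 := by funext p; simp [dy]

theorem dx_wx (δ : ℝ) :
    dx (wx δ) = fun p => δ * (weight δ p + -1 * (wx δ p * wx δ p * weight δ p)) := by
  rw [wx_eq, dx_smul _ (smooth_mul smooth_fst (smooth_weight δ)),
    dx_mul smooth_fst (smooth_weight δ), dx_fst, dx_weight]
  funext p
  simp only [Pi.smul_apply, Pi.add_apply, Pi.mul_apply, Pi.one_apply, smul_eq_mul, wx]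
  ring

theorem dy_wx (δ : ℝ) :
    dy (wx δ) = fun p => δ * (-1 * (wx δ p * wy δ p * weight δ p)) := by
  rw [wx_eq, dy_smul _ (smooth_mul smooth_fst (smooth_weight δ)),
    dy_mul smooth_fst (smooth_weight δ), dy_fst, dy_weight]
  funext p
  simp only [Pi.smul_apply, Pi.add_apply, Pi.mul_apply, Pi.zero_apply, smul_eq_mul]
  ring

theorem dx_wy (δ : ℝ) :
    dx (wy δ) = fun p => δ * (-1 * (wx δ p * wy δ p * weight δ p)) := by
  rw [wy_eq, dx_smul _ (smooth_mul smooth_snd (smooth_weight δ)),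
    dx_mul smooth_snd (smooth_weight δ), dx_snd, dx_weight]
  funext p
  simp only [Pi.smul_apply, Pi.add_apply, Pi.mul_apply, Pi.zero_apply, smul_eq_mul]
  ring

theorem dy_wy (δ : ℝ) :
    dy (wy δ) = fun p => δ * (weight δ p + -1 * (wy δ p * wy δ p * weight δ p)) := by
  rw [wy_eq, dy_smul _ (smooth_mul smooth_snd (smooth_weight δ)),
    dy_mul smooth_snd (smooth_weight δ), dy_snd, dy_weight]
  funext p
  simp only [Pi.smul_apply, Pi.add_apply, Pi.mul_apply, Pi.one_apply, smul_eq_mul, wy]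
  ring

/-- Polynomials in `δ` and the functions `⟨δ(x,y)⟩⁻¹`, `δ x ⟨δ(x,y)⟩⁻¹`, `δ y ⟨δ(x,y)⟩⁻¹`. -/
inductive IsSymbol : (ℝ → ℝ × ℝ → ℝ) → Prop
  | const (c : ℝ) : IsSymbol fun _ _ => c
  | param : IsSymbol fun δ _ => δ
  | weight : IsSymbol weight
  | wx : IsSymbol wx
  | wy : IsSymbol wy
  | add {F G : ℝ → ℝ × ℝ → ℝ} : IsSymbol F → IsSymbol G → IsSymbol fun δ p => F δ p + G δ p
  | mul {F G : ℝ → ℝ × ℝ → ℝ} : IsSymbol F → IsSymbol G → IsSymbol fun δ p => F δ p * G δ p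

namespace IsSymbol

variable {F : ℝ → ℝ × ℝ → ℝ}

theorem smooth (h : IsSymbol F) (δ : ℝ) : Smooth (F δ) := by
  induction h with
  | const c => exact contDiff_const
  | param => exact contDiff_const
  | weight => exact smooth_weight δ
  | wx => exact smooth_wx δ
  | wy => exact smooth_wy δ
  | add _ _ h1 h2 => exact h1.add h2
  | mul _ _ h1 h2 => exact h1.mul h2

theorem bounded (h : IsSymbol F) : ∃ C, ∀ δ : ℝ, 0 ≤ δ → δ ≤ 1 → ∀ p, |F δ p| ≤ C := by
  induction h with
  | const c => exact ⟨|c|, fun _ _ _ _ => le_rfl⟩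
  | param => exact ⟨1, fun δ h0 h1 _ => by rwa [abs_of_nonneg h0]⟩
  | weight => exact ⟨1, fun δ _ _ p => abs_weight_le_one δ p⟩
  | wx => exact ⟨1, fun δ _ _ p => abs_wx_le_one δ p⟩
  | wy => exact ⟨1, fun δ _ _ p => abs_wy_le_one δ p⟩
  | add _ _ h1 h2 =>
    obtain ⟨C1, h1⟩ := h1
    obtain ⟨C2, h2⟩ := h2
    exact ⟨C1 + C2, fun δ h0 h1' p =>
      (abs_add_le _ _).trans (add_le_add (h1 δ h0 h1' p) (h2 δ h0 h1' p))⟩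
  | mul _ _ h1 h2 =>
    obtain ⟨C1, h1⟩ := h1
    obtain ⟨C2, h2⟩ := h2
    refine ⟨C1 * C2, fun δ h0 h1' p => ?_⟩
    rw [abs_mul]
    exact mul_le_mul (h1 δ h0 h1' p) (h2 δ h0 h1' p) (abs_nonneg _)
      ((abs_nonneg _).trans (h1 δ h0 h1' p))

theorem neg (h : IsSymbol F) : IsSymbol fun δ p => -F δ p := by
  simpa using (IsSymbol.const (-1)).mul h

/-- Derivatives of the generators are polynomials in the generators. Taking `wx` and `wy` as
generators instead of the coordinates keeps the algebra both bounded and closed under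
differentiation. -/
theorem dx (h : IsSymbol F) : IsSymbol fun δ => KP.dx (F δ) := by
  induction h with
  | const c =>
    have : (fun _ : ℝ => KP.dx fun _ => c) = fun _ _ => (0 : ℝ) := by
      funext δ p; simp [KP.dx]
    rw [this]; exact const 0
  | param =>
    have : (fun δ : ℝ => KP.dx fun _ => δ) = fun _ _ => (0 : ℝ) := by
      funext δ p; simp [KP.dx]
    rw [this]; exact const 0
  | weight =>
    simp only [dx_weight, pow_two]
    exact ((param.mul wx).mul (weight.mul weight)).neg
  | wx =>
    simp only [dx_wx]
    exact param.mul (weight.add ((const _).mul ((wx.mul wx).mul weight)))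
  | wy =>
    simp only [dx_wy]
    exact param.mul ((const _).mul ((wx.mul wy).mul weight))
  | @add F G hF hG h1 h2 =>
    have : (fun δ => KP.dx fun p => F δ p + G δ p) = fun δ p => KP.dx (F δ) p + KP.dx (G δ) p :=
      funext fun δ => dx_add (hF.smooth δ) (hG.smooth δ)
    rw [this]; exact h1.add h2
  | @mul F G hF hG h1 h2 =>
    have : (fun δ => KP.dx fun p => F δ p * G δ p) =
        fun δ p => KP.dx (F δ) p * G δ p + F δ p * KP.dx (G δ) p :=
      funext fun δ => dx_mul (hF.smooth δ) (hG.smooth δ)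
    rw [this]; exact (h1.mul hG).add (hF.mul h2)

theorem dy (h : IsSymbol F) : IsSymbol fun δ => KP.dy (F δ) := by
  induction h with
  | const c =>
    have : (fun _ : ℝ => KP.dy fun _ => c) = fun _ _ => (0 : ℝ) := by
      funext δ p; simp [KP.dy]
    rw [this]; exact const 0
  | param =>
    have : (fun δ : ℝ => KP.dy fun _ => δ) = fun _ _ => (0 : ℝ) := by
      funext δ p; simp [KP.dy]
    rw [this]; exact const 0
  | weight =>
    simp only [dy_weight, pow_two]
    exact ((param.mul wy).mul (weight.mul weight)).neg
  | wx =>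
    simp only [dy_wx]
    exact param.mul ((const _).mul ((wx.mul wy).mul weight))
  | wy =>
    simp only [dy_wy]
    exact param.mul (weight.add ((const _).mul ((wy.mul wy).mul weight)))
  | @add F G hF hG h1 h2 =>
    have : (fun δ => KP.dy fun p => F δ p + G δ p) = fun δ p => KP.dy (F δ) p + KP.dy (G δ) p :=
      funext fun δ => dy_add (hF.smooth δ) (hG.smooth δ)
    rw [this]; exact h1.add h2
  | @mul F G hF hG h1 h2 =>
    have : (fun δ => KP.dy fun p => F δ p * G δ p) =
        fun δ p => KP.dy (F δ) p * G δ p + F δ p * KP.dy (G δ) p :=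
      funext fun δ => dy_mul (hF.smooth δ) (hG.smooth δ)
    rw [this]; exact (h1.mul hG).add (hF.mul h2)

theorem D (h : IsSymbol F) (a b : ℕ) : IsSymbol fun δ => KP.D a b (F δ) := by
  have hb : IsSymbol fun δ => KP.dy^[b] (F δ) := by
    induction b with
    | zero => exact h
    | succ b ih => simp only [Function.iterate_succ_apply']; exact ih.dy
  simp only [KP.D]
  induction a with
  | zero => exact hb
  | succ a ih => simp only [Function.iterate_succ_apply']; exact ih.dx

theorem exists_bound (h : IsSymbol F) (n : ℕ) :
    ∃ K, 0 ≤ K ∧ ∀ δ : ℝ, 0 ≤ δ → δ ≤ 1 → ∀ a b, a + b ≤ n → ∀ p, |KP.D a b (F δ) p| ≤ K := by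
  choose C hC using fun a b => (h.D a b).bounded
  refine ⟨∑ q ∈ Finset.range (n + 1) ×ˢ Finset.range (n + 1), |C q.1 q.2|,
    Finset.sum_nonneg fun _ _ => abs_nonneg _, fun δ h0 h1 a b hab p => ?_⟩
  refine (hC a b δ h0 h1 p).trans ((le_abs_self _).trans ?_)
  exact Finset.single_le_sum (f := fun q : ℕ × ℕ => |C q.1 q.2|) (fun _ _ => abs_nonneg _)
    (Finset.mem_product.2 ⟨Finset.mem_range.2 (by omega : (a, b).1 < n + 1),
      Finset.mem_range.2 (by omega : (a, b).2 < n + 1)⟩)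

end IsSymbol

/-- The coefficient `⟨δ(x,y)⟩⁻² y` of the transport term. -/
def driftCoeff (δ : ℝ) : ℝ × ℝ → ℝ := weight δ * weight δ * Prod.snd

/-- The zeroth order coefficient of the transport term. -/
def zerothCoeff (δ : ℝ) (p : ℝ × ℝ) : ℝ := -(wx δ p * wy δ p * (weight δ p * weight δ p))

theorem isSymbol_zerothCoeff : IsSymbol zerothCoeff :=
  ((IsSymbol.wx.mul IsSymbol.wy).mul (IsSymbol.weight.mul IsSymbol.weight)).neg

theorem smooth_driftCoeff (δ : ℝ) : Smooth (driftCoeff δ) :=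
  smooth_mul (smooth_mul (smooth_weight δ) (smooth_weight δ)) smooth_snd

/-- The drift coefficient is of size `δ⁻¹` and is not uniformly bounded, but its first derivatives
are symbols: each remaining `y` comes with a factor `δ ⟨δ(x,y)⟩⁻¹` and becomes `wy`. -/
theorem isSymbol_dx_driftCoeff : IsSymbol fun δ => dx (driftCoeff δ) := by
  have : (fun δ => dx (driftCoeff δ)) =
      fun δ p => -2 * ((wx δ p * wy δ p) * (weight δ p * weight δ p)) := by
    funext δ p
    simp only [driftCoeff]
    rw [dx_mul (smooth_mul (smooth_weight δ) (smooth_weight δ)) smooth_snd,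
      dx_mul (smooth_weight δ) (smooth_weight δ), dx_snd, dx_weight]
    simp [wy]
    ring
  rw [this]
  exact (IsSymbol.const _).mul
    ((IsSymbol.wx.mul IsSymbol.wy).mul (IsSymbol.weight.mul IsSymbol.weight))

theorem isSymbol_dy_driftCoeff : IsSymbol fun δ => dy (driftCoeff δ) := by
  have : (fun δ => dy (driftCoeff δ)) =
      fun δ p => weight δ p * weight δ p +
        -2 * ((wy δ p * wy δ p) * (weight δ p * weight δ p)) := by
    funext δ p
    simp only [driftCoeff]
    rw [dy_mul (smooth_mul (smooth_weight δ) (smooth_weight δ)) smooth_snd,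
      dy_mul (smooth_weight δ) (smooth_weight δ), dy_snd, dy_weight]
    simp [wy]
    ring
  rw [this]
  exact (IsSymbol.weight.mul IsSymbol.weight).add ((IsSymbol.const _).mul
    ((IsSymbol.wy.mul IsSymbol.wy).mul (IsSymbol.weight.mul IsSymbol.weight)))

/-- The zeroth order term arises when `∂ₓ` falls on the weight; the `δ` gained there turns `y` into
the bounded function `wy`. -/
theorem transport_eq (δ : ℝ) {u : ℝ × ℝ → ℝ} (hu : Smooth u) :
    weight δ * Prod.snd * dx (weight δ * u) = driftCoeff δ * dx u + zerothCoeff δ * u := by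
  rw [dx_mul (smooth_weight δ) hu, dx_weight]
  funext p
  simp [driftCoeff, zerothCoeff, wy]
  ring

/-- The bounds on the coefficients that the energy estimates use. -/
structure CoeffBound (K δ : ℝ) : Prop where
  -- Order five is needed because the weight is commuted with `∂^α ∂_y` for `|α| = 4`.
  weight : ∀ a b, a + b ≤ 5 → ∀ p, |D a b (weight δ) p| ≤ K
  zeroth : ∀ a b, a + b ≤ 4 → ∀ p, |D a b (zerothCoeff δ) p| ≤ K
  -- Order zero is left out: the coefficient itself has no bound uniform in `δ`.
  drift : ∀ a b, 1 ≤ a + b → a + b ≤ 4 → ∀ p, |D a b (driftCoeff δ) p| ≤ K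

theorem exists_coeffBound : ∃ K, 1 ≤ K ∧ ∀ δ : ℝ, 0 ≤ δ → δ ≤ 1 → CoeffBound K δ := by
  obtain ⟨K1, p1, h1⟩ := IsSymbol.weight.exists_bound 5
  obtain ⟨K2, p2, h2⟩ := isSymbol_zerothCoeff.exists_bound 4
  obtain ⟨K3, p3, h3⟩ := isSymbol_dx_driftCoeff.exists_bound 4
  obtain ⟨K4, p4, h4⟩ := isSymbol_dy_driftCoeff.exists_bound 4
  refine ⟨1 + K1 + K2 + K3 + K4, by linarith, fun δ h0 h1' => ⟨fun a b hab p => ?_,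
    fun a b hab p => ?_, fun a b hab1 hab p => ?_⟩⟩
  · linarith [h1 δ h0 h1' a b hab p]
  · linarith [h2 δ h0 h1' a b hab p]
  · rcases Nat.eq_zero_or_pos a with ha | ha
    · obtain ⟨b', rfl⟩ : ∃ b', b = b' + 1 := ⟨b - 1, by omega⟩
      have := h4 δ h0 h1' a b' (by omega) p
      rw [D_dy] at this
      linarith
    · obtain ⟨a', rfl⟩ : ∃ a', a = a' + 1 := ⟨a - 1, by omega⟩
      have := h3 δ h0 h1' a' b (by omega) p
      rw [D_dx (smooth_driftCoeff δ)] at this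
      linarith

/-! ### The energy estimates for test functions. -/

/-- The `L²` pairing of functions on the plane. -/
def ip (f g : ℝ × ℝ → ℝ) : ℝ := ∫ p, f p * g p

section Pairing

variable {f f' g c : ℝ × ℝ → ℝ}

theorem ip_add_left (hf : MemLp f 2 volume) (hf' : MemLp f' 2 volume) (hg : MemLp g 2 volume) :
    ip (f + f') g = ip f g + ip f' g := by
  simp only [ip, Pi.add_apply, add_mul]
  exact integral_add (integrable_mul_of_memLp hf hg) (integrable_mul_of_memLp hf' hg)

theorem ip_sub_left (hf : MemLp f 2 volume) (hf' : MemLp f' 2 volume) (hg : MemLp g 2 volume) :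
    ip (f - f') g = ip f g - ip f' g := by
  simp only [ip, Pi.sub_apply, sub_mul]
  exact integral_sub (integrable_mul_of_memLp hf hg) (integrable_mul_of_memLp hf' hg)

theorem ip_comm (f g : ℝ × ℝ → ℝ) : ip f g = ip g f := by
  simp only [ip, mul_comm]

theorem ip_mul_left (c f g : ℝ × ℝ → ℝ) : ip (c * f) g = ip f (c * g) := by
  simp only [ip, Pi.mul_apply]
  congr 1
  funext p
  ring

theorem abs_ip_le (hf : MemLp f 2 volume) (hg : MemLp g 2 volume) : |ip f g| ≤ n2 f * n2 g :=
  abs_integral_mul_le hf hg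

theorem ip_self (hf : MemLp f 2 volume) : ip f f = n2 f ^ 2 := by
  rw [n2_sq hf]
  simp only [ip, pow_two]

theorem ip_dx (hf : Hinf f) (hg : Hinf g) : ip f (dx g) = -ip (dx f) g := integral_mul_dx hf hg

theorem ip_dy (hf : Hinf f) (hg : Hinf g) : ip f (dy g) = -ip (dy f) g := integral_mul_dy hf hg

/-- A multiple of a first order derivation is skew-adjoint up to order zero. -/
theorem ip_mul_dx_self (hc : Smooth c) (hf : IsTest f) :
    2 * ip (c * dx f) f = -ip (dx c * f) f := by
  have h := ip_dx (hf.smooth_mul hc).hinf hf.hinf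
  rw [dx_mul hc hf.1, ip_add_left (hf.smooth_mul (smooth_dx hc)).memLp
    (hf.dx.smooth_mul hc).memLp hf.memLp, ip_mul_left, ip_comm] at h
  linarith

end Pairing

/-- The spatial operator with `(1 + g)²` replaced by `1 + m`. -/
def energyOp (δ : ℝ) (m u : ℝ × ℝ → ℝ) : ℝ × ℝ → ℝ :=
  weight δ * Prod.snd * dx (weight δ * u) -
    (weight δ + weight δ * m) * dy (dy (weight δ * u))

section Energy

variable {K δ : ℝ} {u m : ℝ × ℝ → ℝ} {a b : ℕ}

theorem IsTest.weight_mul (hu : IsTest u) (δ : ℝ) : IsTest (weight δ * u) :=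
  hu.smooth_mul (smooth_weight δ)

theorem IsTest.energyOp (hu : IsTest u) (hm : IsTest m) : IsTest (energyOp δ m u) :=
  ((hu.weight_mul δ).dx.smooth_mul (KP.smooth_mul (smooth_weight δ) smooth_snd)).sub
    ((hu.weight_mul δ).dy.dy.smooth_mul
      (smooth_add (smooth_weight δ) (KP.smooth_mul (smooth_weight δ) hm.1)))

theorem two_pow_le_sixteen (h : a + b ≤ 4) : (2 : ℝ) ^ (a + b) ≤ 16 :=
  (pow_le_pow_right₀ (by norm_num) h).trans_eq (by norm_num)

/-- Skew-adjointness removes the top order part of the drift up to a derivative of its coefficient,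
and the commutator differentiates the coefficient at least once, so `δ⁻¹` never enters. The three
contributions are `1/2`, `16` and `16` times `K * N u ^ 2`. -/
theorem abs_ip_transport_le (hK : 1 ≤ K) (hC : CoeffBound K δ) (hu : IsTest u) (hab : a + b ≤ 4) :
    |ip (D a b (weight δ * Prod.snd * dx (weight δ * u))) (D a b u)| ≤ 33 * K * N u ^ 2 := by
  have hN := N_nonneg u
  have hk := smooth_driftCoeff δ
  have hl : Smooth (zerothCoeff δ) := isSymbol_zerothCoeff.smooth δ
  set ψ := D a b u
  have hψ : IsTest ψ := hu.D a b
  have hψN : n2 ψ ≤ N u := n2_D_le_N u hab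
  have hψ0 := n2_nonneg ψ
  set E := D a b (driftCoeff δ * dx u) - driftCoeff δ * D a b (dx u) with hE
  have t1 : IsTest (driftCoeff δ * D a b (dx u)) := (hu.dx.D a b).smooth_mul hk
  have t2 : IsTest E := ((hu.dx.smooth_mul hk).D a b).sub t1
  have t3 : IsTest (D a b (zerothCoeff δ * u)) := (hu.smooth_mul hl).D a b
  have nE : n2 E ≤ 16 * (K * N u) := by
    refine (n2_commutator_le hk hu.dx (by positivity) fun i j k l h1 h2 h3 => ?_).trans
      (mul_le_mul_of_nonneg_right (two_pow_le_sixteen hab) (by positivity))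
    rw [D_dx hu.1]
    exact (n2_mul_le (hC.drift i j h3 (by omega)) (hu.D _ _).memLp).trans
      (mul_le_mul_of_nonneg_left (n2_D_le_N u (by omega)) (by linarith))
  have nl : n2 (D a b (zerothCoeff δ * u)) ≤ 16 * (K * N u) := by
    refine (n2_D_mul_le hl hu (M := K * N u) fun i j k l h1 h2 => ?_).trans
      (mul_le_mul_of_nonneg_right (two_pow_le_sixteen hab) (by positivity))
    exact (n2_mul_le (hC.zeroth i j (by omega)) (hu.D _ _).memLp).trans
      (mul_le_mul_of_nonneg_left (n2_D_le_N u (by omega)) (by linarith))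
  have e : D a b (weight δ * Prod.snd * dx (weight δ * u)) =
      driftCoeff δ * dx ψ + E + D a b (zerothCoeff δ * u) := by
    rw [transport_eq δ hu.1, D_add (smooth_mul hk hu.dx.1) (smooth_mul hl hu.1), hE, dx_D,
      ← D_dx hu.1]
    ring
  have t1' : IsTest (driftCoeff δ * dx ψ) := hψ.dx.smooth_mul hk
  rw [e, ip_add_left (t1'.add t2).memLp t3.memLp hψ.memLp,
    ip_add_left t1'.memLp t2.memLp hψ.memLp]
  have i1 := ip_mul_dx_self hk hψ
  have i2 : |ip (dx (driftCoeff δ) * ψ) ψ| ≤ K * N u ^ 2 := by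
    refine (abs_ip_le (hψ.smooth_mul (smooth_dx hk)).memLp hψ.memLp).trans ?_
    have := n2_mul_le (hC.drift 1 0 (by norm_num) (by norm_num)) hψ.memLp
    calc n2 (dx (driftCoeff δ) * ψ) * n2 ψ ≤ (K * n2 ψ) * n2 ψ :=
          mul_le_mul_of_nonneg_right this hψ0
      _ ≤ (K * N u) * N u := by gcongr
      _ = K * N u ^ 2 := by ring
  have i3 : |ip E ψ| ≤ 16 * (K * N u) * N u :=
    (abs_ip_le t2.memLp hψ.memLp).trans (mul_le_mul nE hψN hψ0 (by positivity))
  have i4 : |ip (D a b (zerothCoeff δ * u)) ψ| ≤ 16 * (K * N u) * N u :=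
    (abs_ip_le t3.memLp hψ.memLp).trans (mul_le_mul nl hψN hψ0 (by positivity))
  have hp : 0 ≤ K * N u ^ 2 := by positivity
  rw [abs_le] at i2 i3 i4 ⊢
  constructor <;> nlinarith

/-- Coercivity of the diffusion term after commutation with derivatives. -/
theorem ip_diffusion_ge (hm : IsTest m) (hmN : N m ≤ 1 / 4) {Φ ψ E : ℝ × ℝ → ℝ}
    (hΦ : IsTest Φ) (hψ : IsTest ψ) (hE : IsTest E) (he : dy (weight δ * ψ) = Φ - E) :
    1 / 2 * n2 Φ ^ 2 - 3 / 2 * (n2 Φ * n2 E) - 1 / 2 * (n2 Φ * n2 ψ) ≤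
      -ip ((weight δ + weight δ * m) * dy Φ) ψ := by
  have hw := smooth_weight δ
  have hwm : Smooth (weight δ + weight δ * m) := smooth_add hw (smooth_mul hw hm.1)
  -- The intended choice is `Φ = ∂^α ∂_y(weight u)`, `ψ = ∂^α u` and `E` the commutator. After
  -- integration by parts the derivative of `weight * ψ` rebuilds `Φ` up to `E`, leaving the
  -- quadratic form `∫ (1 + m) Φ²`.
  have h1 := ip_dy (hψ.smooth_mul hwm).hinf hΦ.hinf
  have e1 : ip ((weight δ + weight δ * m) * ψ) (dy Φ) =
      ip ((weight δ + weight δ * m) * dy Φ) ψ := by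
    rw [ip_comm, ← ip_mul_left]
  have e2 : dy ((weight δ + weight δ * m) * ψ) =
      (Φ + m * Φ) - (1 + m) * E + dy m * (weight δ * ψ) := by
    have : (weight δ + weight δ * m) * ψ = weight δ * ψ + m * (weight δ * ψ) := by ring
    rw [this, dy_add (hψ.weight_mul δ).1 (hm.mul (hψ.weight_mul δ)).1,
      dy_mul hm.1 (hψ.weight_mul δ).1, he]
    ring
  -- The Sobolev bound turns `N m ≤ 1 / 4` into `|m| ≤ 1 / 2`, so at least half of `n2 Φ ^ 2`
  -- survives.
  have hm0 : ∀ p, |m p| ≤ 1 / 2 := fun p =>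
    (abs_D_le_N (a := 0) (b := 0) hm (by norm_num) p).trans (by linarith)
  have hm1 : ∀ p, |dy m p| ≤ 1 / 2 := fun p =>
    (abs_D_le_N (a := 0) (b := 1) hm (by norm_num) p).trans (by linarith)
  have hm2 : ∀ p, |(1 + m) p| ≤ 3 / 2 := fun p => by
    have := abs_le.1 (hm0 p)
    rw [Pi.add_apply, Pi.one_apply, abs_le]
    constructor <;> linarith
  have h1m : Smooth (1 + m) := contDiff_const.add hm.1
  have tE : IsTest ((1 + m) * E) := hE.smooth_mul h1m
  have tψ : IsTest (dy m * (weight δ * ψ)) := hm.dy.mul (hψ.weight_mul δ)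
  rw [e1, e2, ip_add_left ((hΦ.add (hm.mul hΦ)).sub tE).memLp tψ.memLp hΦ.memLp,
    ip_sub_left (hΦ.add (hm.mul hΦ)).memLp tE.memLp hΦ.memLp,
    ip_add_left hΦ.memLp (hm.mul hΦ).memLp hΦ.memLp, ip_self hΦ.memLp] at h1
  rw [h1]
  have i1 := abs_le.1 (abs_ip_le (hm.mul hΦ).memLp hΦ.memLp)
  have i2 := abs_le.1 (abs_ip_le tE.memLp hΦ.memLp)
  have i3 := abs_le.1 (abs_ip_le tψ.memLp hΦ.memLp)
  have j1 := n2_mul_le hm0 hΦ.memLp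
  have j2 := n2_mul_le hm2 hE.memLp
  have j3 := n2_mul_le hm1 (hψ.weight_mul δ).memLp
  have j4 := n2_mul_le (abs_weight_le_one δ) hψ.memLp
  have hΦ0 := n2_nonneg Φ
  have k1 := mul_le_mul_of_nonneg_right j1 hΦ0
  have k2 := mul_le_mul_of_nonneg_right j2 hΦ0
  have k3 := mul_le_mul_of_nonneg_right (j3.trans (by linarith : _ ≤ 1 / 2 * n2 ψ)) hΦ0
  nlinarith

/-- Each error is at most a multiple of `K * N F * N u` with `F = ∂_y(weight u)`: no term is
quadratic in `F`, so none competes with the dissipation. The multiples add up to less than `800`. -/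
theorem ip_diffusion_commuted_ge (hK : 1 ≤ K) (hC : CoeffBound K δ) (hu : IsTest u)
    (hm : IsTest m) (hmN : N m ≤ 1 / 4) (hab : a + b ≤ 4) :
    1 / 2 * n2 (D a b (dy (weight δ * u))) ^ 2 - 800 * K * N (dy (weight δ * u)) * N u ≤
      -ip (D a b ((weight δ + weight δ * m) * dy (dy (weight δ * u)))) (D a b u) := by
  have hw := smooth_weight δ
  have hNu := N_nonneg u
  have hwu := hu.weight_mul δ
  set F := dy (weight δ * u) with hF
  have tF : IsTest F := hwu.dy
  have hNF := N_nonneg F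
  set ψ := D a b u with hψd
  set Φ := D a b F with hΦd
  have hψ : IsTest ψ := hu.D a b
  have hΦ : IsTest Φ := tF.D a b
  have hψN : n2 ψ ≤ N u := n2_D_le_N u hab
  have hΦN : n2 Φ ≤ N F := n2_D_le_N F hab
  have hψ0 := n2_nonneg ψ
  have hΦ0 := n2_nonneg Φ
  -- the error in commuting the weight with `∂^α ∂_y`
  set G := D a (b + 1) (weight δ * u) - weight δ * D a (b + 1) u with hG
  set E := G - dy (weight δ) * ψ with hE
  have tG : IsTest G := (hwu.D _ _).sub ((hu.D _ _).weight_mul δ)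
  have tE : IsTest E := tG.sub (hψ.smooth_mul (smooth_dy hw))
  have he : dy (weight δ * ψ) = Φ - E := by
    rw [dy_mul hw hψ.1, hE, hG, hΦd, hF, D_dy, hψd, dy_D hu.1]
    ring
  have nG : n2 G ≤ 32 * (K * N u) := by
    refine (n2_commutator_le hw hu (by positivity) fun i j k l h1 h2 h3 =>
      (n2_mul_le (hC.weight i j (by omega)) (hu.D k l).memLp).trans
      (mul_le_mul_of_nonneg_left (n2_D_le_N u (by omega)) (by linarith))).trans
      (mul_le_mul_of_nonneg_right ?_ (by positivity))
    exact (pow_le_pow_right₀ (by norm_num) (by omega : a + (b + 1) ≤ 5)).trans_eq (by norm_num)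
  have nE : n2 E ≤ 33 * (K * N u) := by
    have h1 := n2_mul_le (hC.weight 0 1 (by norm_num)) hψ.memLp
    have h2 := n2_sub_le tG.memLp (hψ.smooth_mul (smooth_dy hw)).memLp
    have h3 : K * n2 ψ ≤ K * N u := mul_le_mul_of_nonneg_left hψN (by linarith)
    have e : D 0 1 (weight δ) = dy (weight δ) := rfl
    rw [e] at h1
    linarith
  -- the commutators of `∂^α` with the coefficients of `∂_y F`
  have twm : IsTest (weight δ * m) := hm.weight_mul δ
  set E2 := D a b (weight δ * dy F) - weight δ * D a b (dy F) with hE2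
  set E3 := D a b ((weight δ * m) * dy F) - (weight δ * m) * D a b (dy F) with hE3
  have tE2 : IsTest E2 := ((tF.dy.weight_mul δ).D a b).sub ((tF.dy.D a b).weight_mul δ)
  have tE3 : IsTest E3 := ((twm.mul tF.dy).D a b).sub (twm.mul (tF.dy.D a b))
  have nE2 : n2 E2 ≤ 16 * (K * N F) := by
    refine (n2_commutator_le hw tF.dy (by positivity) fun i j k l h1 h2 h3 => ?_).trans
      (mul_le_mul_of_nonneg_right (two_pow_le_sixteen hab) (by positivity))
    rw [D_dy]
    exact (n2_mul_le (hC.weight i j (by omega)) (tF.D _ _).memLp).trans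
      (mul_le_mul_of_nonneg_left (n2_D_le_N F (by omega)) (by linarith))
  have hNwm : N (weight δ * m) ≤ 20 * K := by
    have h1 := N_smooth_mul_le hw (fun i j hij => hC.weight i j (by omega)) hm
    nlinarith
  -- In the commutator at least one derivative falls on `weight * m`, so at most four, including the
  -- extra `∂_y`, fall on `F`.
  have nE3 : n2 E3 ≤ 16 * (40 * K * N F) := by
    refine (n2_commutator_le twm.1 tF.dy (by positivity) fun i j k l h1 h2 h3 => ?_).trans
      (mul_le_mul_of_nonneg_right (two_pow_le_sixteen hab) (by positivity))
    rw [D_dy]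
    refine (n2_D_mul_D_le twm tF (by omega) (by omega) (by omega)).trans ?_
    nlinarith
  have main := ip_diffusion_ge hm hmN hΦ hψ tE he
  have e : D a b ((weight δ + weight δ * m) * dy F) =
      (weight δ + weight δ * m) * dy Φ + E2 + E3 := by
    have hd : dy Φ = D a b (dy F) := dy_D tF.1 a b
    rw [add_mul, D_add (tF.dy.weight_mul δ).1 (twm.mul tF.dy).1, hE2, hE3, hd]
    ring
  have tmain : IsTest ((weight δ + weight δ * m) * dy Φ) :=
    hΦ.dy.smooth_mul (smooth_add hw twm.1)
  rw [e, ip_add_left (tmain.add tE2).memLp tE3.memLp hψ.memLp,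
    ip_add_left tmain.memLp tE2.memLp hψ.memLp]
  have i2 : |ip E2 ψ| ≤ 16 * (K * N F) * N u :=
    (abs_ip_le tE2.memLp hψ.memLp).trans (mul_le_mul nE2 hψN hψ0 (by positivity))
  have i3 : |ip E3 ψ| ≤ 16 * (40 * K * N F) * N u :=
    (abs_ip_le tE3.memLp hψ.memLp).trans (mul_le_mul nE3 hψN hψ0 (by positivity))
  have i4 : n2 Φ * n2 E ≤ N F * (33 * (K * N u)) := mul_le_mul hΦN nE (n2_nonneg _) hNF
  have i5 : n2 Φ * n2 ψ ≤ N F * N u := mul_le_mul hΦN hψN hψ0 hNF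
  have i6 : N F * N u ≤ K * (N F * N u) := le_mul_of_one_le_left (by positivity) hK
  have i7 : 0 ≤ K * (N F * N u) := by positivity
  rw [abs_le] at i2 i3
  nlinarith

/-- The energy estimate in `H⁴` for test functions. -/
theorem sum_ip_energyOp_ge (hK : 1 ≤ K) (hC : CoeffBound K δ) (hu : IsTest u) (hm : IsTest m)
    (hmN : N m ≤ 1 / 4) :
    1 / 4 * N (dy (weight δ * u)) ^ 2 - (12000 * K) ^ 2 * 2 * N u ^ 2 ≤
      ∑ α : MultiIndex 4, ip (D α.1.1 α.1.2 (energyOp δ m u)) (D α.1.1 α.1.2 u) := by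
  have hw := smooth_weight δ
  have hNu := N_nonneg u
  have hNF := N_nonneg (dy (weight δ * u))
  have key : ∀ α : MultiIndex 4, 1 / 2 * n2 (D α.1.1 α.1.2 (dy (weight δ * u))) ^ 2 -
      (800 * K * N (dy (weight δ * u)) * N u + 33 * K * N u ^ 2) ≤
      ip (D α.1.1 α.1.2 (energyOp δ m u)) (D α.1.1 α.1.2 u) := fun α => by
    have h1 := abs_le.1 (abs_ip_transport_le hK hC hu α.2)
    have h2 := ip_diffusion_commuted_ge hK hC hu hm hmN α.2
    have t1 : IsTest (weight δ * Prod.snd * dx (weight δ * u)) :=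
      (hu.weight_mul δ).dx.smooth_mul (smooth_mul hw smooth_snd)
    have t2 : IsTest ((weight δ + weight δ * m) * dy (dy (weight δ * u))) :=
      (hu.weight_mul δ).dy.dy.smooth_mul (smooth_add hw (smooth_mul hw hm.1))
    have e : energyOp δ m u = weight δ * Prod.snd * dx (weight δ * u) +
        (-1 : ℝ) • ((weight δ + weight δ * m) * dy (dy (weight δ * u))) := by
      simp [energyOp, sub_eq_add_neg]
    have e2 : D α.1.1 α.1.2 (energyOp δ m u) =
        D α.1.1 α.1.2 (weight δ * Prod.snd * dx (weight δ * u)) -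
          D α.1.1 α.1.2 ((weight δ + weight δ * m) * dy (dy (weight δ * u))) := by
      rw [e, D_add t1.1 (smooth_smul _ t2.1), D_smul _ t2.1]
      simp [sub_eq_add_neg]
    rw [e2, ip_sub_left (t1.D _ _).memLp (t2.D _ _).memLp (hu.D _ _).memLp]
    linarith
  refine le_trans ?_ (Finset.sum_le_sum fun α _ => key α)
  have hcard : (Finset.univ : Finset (MultiIndex 4)).card = 15 := by decide
  rw [Finset.sum_sub_distrib, ← Finset.mul_sum, ← N_sq, Finset.sum_const, hcard, nsmul_eq_mul]
  -- Fifteen cross terms with constant `800 K` give `12000 K`. Completing the square spends half of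
  -- the dissipation; the factor `2` in the loss also covers the `15 · 33 K` of the transport.
  have h1 := sq_nonneg (1 / 2 * N (dy (weight δ * u)) - 12000 * K * N u)
  have h2 : K * N u ^ 2 ≤ K ^ 2 * N u ^ 2 :=
    mul_le_mul_of_nonneg_right (by nlinarith) (sq_nonneg _)
  have h3 : 0 ≤ K ^ 2 * N u ^ 2 := by positivity
  push_cast
  nlinarith

/-- The energy estimate in `L²` for test functions. -/
theorem ip_energyOp_self_ge (hu : IsTest u) (hm : IsTest m) (hmN : N m ≤ 1 / 4) :
    -n2 u ^ 2 ≤ ip (energyOp δ m u) u := by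
  have hw := smooth_weight δ
  have hf := hu.weight_mul δ
  set f := weight δ * u with hfd
  have t1 : IsTest (weight δ * Prod.snd * dx f) := hf.dx.smooth_mul (smooth_mul hw smooth_snd)
  have t2 : IsTest ((weight δ + weight δ * m) * dy (dy f)) :=
    hf.dy.dy.smooth_mul (smooth_add hw (smooth_mul hw hm.1))
  have e : energyOp δ m u = weight δ * Prod.snd * dx f -
      (weight δ + weight δ * m) * dy (dy f) := rfl
  rw [e, ip_sub_left t1.memLp t2.memLp hu.memLp]
  have h1 := ip_mul_dx_self smooth_snd hf
  -- Moving the outer weight onto `u` leaves `y ∂ₓ` acting on `f`, which is exactly skew since `∂ₓ y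
  -- = 0`. At order zero there is no commutator either, so the diffusion bound is used with `E = 0`.
  have e1 : ip (weight δ * Prod.snd * dx f) u = ip (Prod.snd * dx f) f := by
    rw [mul_assoc, ip_mul_left]
  have e2 : ip (dx Prod.snd * f) f = 0 := by simp [dx_snd, ip]
  have h2 := ip_diffusion_ge (δ := δ) hm hmN hf.dy hu IsTest.zero (by simp [hfd])
  have e3 : n2 (0 : ℝ × ℝ → ℝ) = 0 := by simp [n2]
  rw [e3] at h2
  rw [e1]
  nlinarith [sq_nonneg (n2 (dy f) - 1 / 2 * n2 u), sq_nonneg (n2 u)]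

end Energy

/-! ### Primitives of bounded functions of time, their product rule, and Grönwall's inequality. -/

open Filter Topology

section Primitive

variable {E : Type*} [NormedAddCommGroup E]

/-- Essentially bounded strongly measurable functions of time. -/
structure BddMeas (M : ℝ) (m : ℝ → E) : Prop where
  aesm : AEStronglyMeasurable m volume
  bound : ∀ᵐ t, ‖m t‖ ≤ M

theorem BddMeas.intervalIntegrable {M : ℝ} {m : ℝ → E} (h : BddMeas M m) (a b : ℝ) :
    IntervalIntegrable m volume a b :=
  (intervalIntegrable_const (c := M)).mono_fun h.aesm.restrict
    (ae_restrict_of_ae (h.bound.mono fun _ ht => ht.trans (le_abs_self M)))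

theorem BddMeas.nonneg {M : ℝ} {m : ℝ → E} (h : BddMeas M m) : 0 ≤ M := by
  obtain ⟨t, ht⟩ := h.bound.exists
  exact (norm_nonneg _).trans ht

variable [NormedSpace ℝ E]

theorem BddMeas.norm_integral_le {M : ℝ} {m : ℝ → E} (h : BddMeas M m) (a b : ℝ) :
    ‖∫ s in a..b, m s‖ ≤ M * |b - a| :=
  intervalIntegral.norm_integral_le_of_norm_le_const_ae (h.bound.mono fun _ ht _ => ht)

theorem BddMeas.continuous_primitive {M : ℝ} {m : ℝ → E} (h : BddMeas M m) (V₀ : E) (a : ℝ) :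
    Continuous fun t => V₀ + ∫ s in a..t, m s :=
  continuous_const.add (intervalIntegral.continuous_primitive h.intervalIntegrable a)

theorem BddMeas.primitive_sub {M : ℝ} {m : ℝ → E} (h : BddMeas M m) (V₀ : E) (a s t : ℝ) :
    (V₀ + ∫ r in a..t, m r) - (V₀ + ∫ r in a..s, m r) = ∫ r in s..t, m r := by
  rw [add_sub_add_left_eq_sub, intervalIntegral.integral_interval_sub_left
    (h.intervalIntegrable _ _) (h.intervalIntegrable _ _)]

end Primitive

/-- Quadratically small increments force the derivative to vanish at every point. This proves
identities between primitives without differentiating merely measurable integrands. -/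
theorem eq_of_abs_sub_le_sq {f : ℝ → ℝ} {C : ℝ} (h : ∀ s t, |f t - f s| ≤ C * |t - s| ^ 2)
    (s t : ℝ) : f s = f t := by
  have hd : ∀ x, HasDerivAt f 0 x := fun x => by
    have h1 : (fun t => f t - f x) =O[𝓝 x] fun t => ‖t - x‖ ^ 2 :=
      Asymptotics.IsBigO.of_bound C (Eventually.of_forall fun t => by
        simpa [abs_pow] using h x t)
    have h2' : HasFDerivAt (fun t => f t - f x) (0 : ℝ →L[ℝ] ℝ) x :=
      h1.hasFDerivAt (by norm_num)
    have h2 := h2'.add_const (f x)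
    simp only [sub_add_cancel] at h2
    exact h2.hasDerivAt
  exact is_const_of_deriv_eq_zero (fun x => (hd x).differentiableAt) (fun x => (hd x).deriv) s t

section Product

variable {E : Type*} [NormedAddCommGroup E] [InnerProductSpace ℝ E]

theorem intervalIntegrable_inner {M : ℝ} {m V : ℝ → E} (hm : BddMeas M m) (hV : Continuous V)
    (a b : ℝ) : IntervalIntegrable (fun s => inner ℝ (m s) (V s)) volume a b := by
  refine IntervalIntegrable.mono_fun
    ((continuous_const.mul hV.norm).intervalIntegrable a b : IntervalIntegrable
      (fun s => M * ‖V s‖) volume a b) (hm.aesm.restrict.inner hV.aestronglyMeasurable)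
    (ae_restrict_of_ae (hm.bound.mono fun s hs => ?_))
  refine (norm_inner_le_norm _ _).trans ?_
  have e : ‖M * ‖V s‖‖ = |M| * ‖V s‖ := by rw [norm_mul, norm_norm, Real.norm_eq_abs]
  exact (mul_le_mul_of_nonneg_right (hs.trans (le_abs_self M)) (norm_nonneg _)).trans_eq e.symm

/-- The product rule for primitives of bounded functions with values in a Hilbert space. -/
theorem inner_primitive [CompleteSpace E] {M : ℝ} {m k : ℝ → E} (hm : BddMeas M m)
    (hk : BddMeas M k) (V₀ W₀ : E)
    {V W : ℝ → E} (hV : ∀ t, V t = V₀ + ∫ s in (0 : ℝ)..t, m s)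
    (hW : ∀ t, W t = W₀ + ∫ s in (0 : ℝ)..t, k s) (t : ℝ) :
    inner ℝ (V t) (W t) = inner ℝ V₀ W₀ +
      ∫ s in (0 : ℝ)..t, (inner ℝ (m s) (W s) + inner ℝ (k s) (V s)) := by
  have hM := hm.nonneg
  have cV : Continuous V := by
    rw [funext hV]; exact hm.continuous_primitive _ _
  have cW : Continuous W := by
    rw [funext hW]; exact hk.continuous_primitive _ _
  have dV : ∀ s t, V t - V s = ∫ r in s..t, m r := fun s t => by
    rw [hV, hV, hm.primitive_sub]
  have dW : ∀ s t, W t - W s = ∫ r in s..t, k r := fun s t => by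
    rw [hW, hW, hk.primitive_sub]
  have bV : ∀ s t, ‖V t - V s‖ ≤ M * |t - s| := fun s t => by
    rw [dV]; exact hm.norm_integral_le s t
  have bW : ∀ s t, ‖W t - W s‖ ≤ M * |t - s| := fun s t => by
    rw [dW]; exact hk.norm_integral_le s t
  have i1 := intervalIntegrable_inner hm cW
  have i2 := intervalIntegrable_inner hk cV
  have remainder : ∀ {m V : ℝ → E}, BddMeas M m → Continuous V →
      (∀ s t, ‖V t - V s‖ ≤ M * |t - s|) → ∀ s t : ℝ,
      |(∫ r in s..t, inner ℝ (m r) (V r)) - inner ℝ (∫ r in s..t, m r) (V s)| ≤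
        M ^ 2 * |t - s| ^ 2 := by
    intro m V hm cV bV s t
    have e : inner ℝ (∫ r in s..t, m r) (V s) = ∫ r in s..t, inner ℝ (m r) (V s) := by
      have := (innerSL ℝ (V s)).intervalIntegral_comp_comm (hm.intervalIntegrable s t)
      simp only [innerSL_apply_apply] at this
      simp only [real_inner_comm (V s), this]
    have i3 := intervalIntegrable_inner hm cV s t
    have i4 := intervalIntegrable_inner hm (continuous_const (y := V s)) s t
    rw [e, ← intervalIntegral.integral_sub i3 i4]
    have hb : ∀ᵐ r, r ∈ Set.uIoc s t →
        ‖inner ℝ (m r) (V r) - inner ℝ (m r) (V s)‖ ≤ M * (M * |t - s|) :=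
      hm.bound.mono fun r hr hrs => by
        rw [← inner_sub_right]
        refine (norm_inner_le_norm _ _).trans ?_
        refine mul_le_mul hr ((bV s r).trans (mul_le_mul_of_nonneg_left ?_ hM)) (norm_nonneg _) hM
        have h1 := Set.uIoc_subset_uIcc hrs
        exact Set.abs_sub_left_of_mem_uIcc h1
    have h1 := intervalIntegral.norm_integral_le_of_norm_le_const_ae hb
    rw [Real.norm_eq_abs] at h1
    exact h1.trans_eq (by ring)
  -- The increment of `f` consists of the two errors of freezing a factor at the left endpoint and
  -- of a product of two increments; each is `O(|t - s|²)`, so `f` is constant.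
  set f : ℝ → ℝ := fun t => inner ℝ (V t) (W t) -
    ∫ s in (0 : ℝ)..t, (inner ℝ (m s) (W s) + inner ℝ (k s) (V s)) with hf
  have key : ∀ s t, |f t - f s| ≤ 3 * M ^ 2 * |t - s| ^ 2 := by
    intro s t
    have e1 : (∫ s in (0 : ℝ)..t, (inner ℝ (m s) (W s) + inner ℝ (k s) (V s))) -
        ∫ s in (0 : ℝ)..s, (inner ℝ (m s) (W s) + inner ℝ (k s) (V s)) =
        (∫ r in s..t, inner ℝ (m r) (W r)) + ∫ r in s..t, inner ℝ (k r) (V r) := by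
      rw [intervalIntegral.integral_interval_sub_left ((i1 _ _).add (i2 _ _))
        ((i1 _ _).add (i2 _ _)), intervalIntegral.integral_add (i1 _ _) (i2 _ _)]
    have e2 : inner ℝ (V t) (W t) - inner ℝ (V s) (W s) =
        inner ℝ (V t - V s) (W s) + inner ℝ (W t - W s) (V s) +
          inner ℝ (V t - V s) (W t - W s) := by
      simp only [inner_sub_left, inner_sub_right]
      rw [real_inner_comm (V s) (W t), real_inner_comm (V s) (W s)]
      ring
    have r1 := abs_le.1 (remainder hm cW bW s t)
    have r2 := abs_le.1 (remainder hk cV bV s t)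
    rw [← dV] at r1
    rw [← dW] at r2
    have r3 : |inner ℝ (V t - V s) (W t - W s)| ≤ M ^ 2 * |t - s| ^ 2 := by
      refine (abs_real_inner_le_norm _ _).trans ?_
      calc ‖V t - V s‖ * ‖W t - W s‖ ≤ (M * |t - s|) * (M * |t - s|) :=
            mul_le_mul (bV s t) (bW s t) (norm_nonneg _) (by positivity)
        _ = M ^ 2 * |t - s| ^ 2 := by ring
    have r3 := abs_le.1 r3
    have e3 : f t - f s = (inner ℝ (V t) (W t) - inner ℝ (V s) (W s)) -
        ((∫ s in (0 : ℝ)..t, (inner ℝ (m s) (W s) + inner ℝ (k s) (V s))) -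
        ∫ s in (0 : ℝ)..s, (inner ℝ (m s) (W s) + inner ℝ (k s) (V s))) := by
      simp only [hf]; ring
    rw [e3, e2, e1, abs_le]
    constructor <;> linarith
  have h0 := eq_of_abs_sub_le_sq key t 0
  simp only [hf, intervalIntegral.integral_same, sub_zero] at h0
  rw [hV 0, hW 0] at h0
  simp only [intervalIntegral.integral_same, add_zero] at h0
  linarith

end Product

/-- Grönwall's inequality in integral form. -/
theorem le_exp_of_le_integral {f : ℝ → ℝ} (hf : Continuous f) {a c T : ℝ} (hc : 0 ≤ c)
    (h : ∀ t ∈ Icc 0 T, f t ≤ a + c * ∫ s in (0 : ℝ)..t, f s) :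
    ∀ t ∈ Icc 0 T, f t ≤ a * Real.exp (c * t) := by
  -- With this integrating factor the hypothesis says `G' ≤ 0`.
  set G : ℝ → ℝ := fun t => (a + c * ∫ s in (0 : ℝ)..t, f s) * Real.exp (-(c * t)) with hG
  have hd : ∀ t, HasDerivAt G ((c * f t) * Real.exp (-(c * t)) +
      (a + c * ∫ s in (0 : ℝ)..t, f s) * (Real.exp (-(c * t)) * -c)) t := fun t => by
    have h1 := intervalIntegral.integral_hasDerivAt_right (hf.intervalIntegrable 0 t)
      (hf.stronglyMeasurableAtFilter _ _) hf.continuousAt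
    have h2 : HasDerivAt (fun t => -(c * t)) (-c) t := by
      simpa using ((hasDerivAt_id t).const_mul (-c))
    exact ((h1.const_mul c).const_add a).mul h2.exp
  have hanti : AntitoneOn G (Icc 0 T) := by
    refine antitoneOn_of_deriv_nonpos (convex_Icc 0 T)
      (fun t _ => (hd t).continuousAt.continuousWithinAt)
      (fun t _ => (hd t).differentiableAt.differentiableWithinAt) fun t ht => ?_
    rw [(hd t).deriv]
    have h1 := h t (interior_subset ht)
    have h2 := mul_le_mul_of_nonneg_left h1 hc
    have h3 := Real.exp_pos (-(c * t))
    nlinarith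
  intro t ht
  have h1 := hanti ⟨le_rfl, ht.1.trans ht.2⟩ ht ht.1
  simp only [hG, intervalIntegral.integral_same, mul_zero, add_zero, neg_zero, Real.exp_zero,
    mul_one] at h1
  rw [Real.exp_neg, ← div_eq_mul_inv, div_le_iff₀ (Real.exp_pos _)] at h1
  exact (h t ht).trans h1

/-! ### Weak measurability in a separable Hilbert space. -/

section Measurability

variable {H : Type*} [NormedAddCommGroup H] [InnerProductSpace ℝ H]

/-- Pettis' theorem in a separable Hilbert space. -/
theorem aestronglyMeasurable_of_inner [SecondCountableTopology H] {α : Type*}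
    {mα : MeasurableSpace α} {μ : Measure α} {z : α → H} {S : Set H}
    (hS : (Submodule.span ℝ S).topologicalClosure = ⊤)
    (h : ∀ d ∈ S, AEMeasurable (fun t => inner ℝ d (z t)) μ) : AEStronglyMeasurable z μ := by
  have hspan : ∀ d ∈ Submodule.span ℝ S, AEMeasurable (fun t => inner ℝ d (z t)) μ := by
    intro d hd
    induction hd using Submodule.span_induction with
    | mem x hx => exact h x hx
    | zero => simp
    | add x y _ _ hx hy => simp only [inner_add_left]; exact hx.add hy
    | smul a x _ hx => simp only [real_inner_smul_left]; exact hx.const_mul a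
  have hall : ∀ d : H, AEMeasurable (fun t => inner ℝ d (z t)) μ := by
    intro d
    have hd : d ∈ closure (Submodule.span ℝ S : Set H) := by
      rw [← Submodule.topologicalClosure_coe, hS]; trivial
    obtain ⟨x, hx, hlim⟩ := mem_closure_iff_seq_limit.1 hd
    exact aemeasurable_of_tendsto_metrizable_ae atTop (fun n => hspan _ (hx n))
      (Eventually.of_forall fun t => hlim.inner tendsto_const_nhds)
  -- Projections onto these finite-dimensional spaces have measurable coordinates and converge to
  -- the identity pointwise.
  set U : ℕ → Submodule ℝ H := fun n =>
    Submodule.span ℝ (TopologicalSpace.denseSeq H '' Iio n)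
  have hfin : ∀ n, FiniteDimensional ℝ (U n) := fun n =>
    FiniteDimensional.span_of_finite ℝ ((Set.finite_Iio n).image _)
  have hmono : Monotone U := fun i j hij =>
    Submodule.span_mono (image_mono (Iio_subset_Iio hij))
  have htop : ⊤ ≤ (⨆ n, U n).topologicalClosure := by
    intro x _
    refine closure_mono ?_ (TopologicalSpace.denseRange_denseSeq H x)
    rintro _ ⟨n, rfl⟩
    exact Submodule.mem_iSup_of_mem (n + 1)
      (Submodule.subset_span ⟨n, Nat.lt_succ_self n, rfl⟩)
  refine aestronglyMeasurable_of_tendsto_ae atTop (f := fun n t => (U n).starProjection (z t))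
    (fun n => ?_) (Eventually.of_forall fun t =>
      Submodule.starProjection_tendsto_self U hmono (z t) htop)
  have e : (fun t => (U n).starProjection (z t)) = fun t =>
      ∑ i, (inner ℝ ((stdOrthonormalBasis ℝ (U n) i : U n) : H) (z t)) •
        ((stdOrthonormalBasis ℝ (U n) i : U n) : H) := by
    funext t
    rw [(stdOrthonormalBasis ℝ (U n)).starProjection_eq_sum_rankOne]
    simp
  rw [e]
  exact Finset.aestronglyMeasurable_fun_sum _ fun i _ =>
    (hall _).aestronglyMeasurable.smul_const _

end Measurability

/-! ### Linear evolution equations with bounded operator coefficients. -/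

section LinearODE

variable {X : Type*} [NormedAddCommGroup X] [NormedSpace ℝ X] [CompleteSpace X]

/-- Solvability of linear evolution equations with bounded measurable coefficients. -/
theorem exists_linear_ode {K T : ℝ} (hT : 0 ≤ T) {B : ℝ → X →L[ℝ] X} (hB : BddMeas K B) (u₀ : X) :
    ∃ u : ℝ → X, Continuous u ∧ ∀ t ∈ Icc 0 T, u t = u₀ + ∫ s in (0 : ℝ)..t, B s (u s) := by
  have hK := hB.nonneg
  -- Measured in the sup norm with weight `e^{-lt}`, the Picard map has Lipschitz constant at most
  -- `K / l ≤ 1 / 2` on the whole of `[0, T]`, so no subdivision of time is needed.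
  set l : ℝ := 2 * K + 1 with hl
  have hl0 : 0 < l := by positivity
  set P : ℝ → Icc (0 : ℝ) T := projIcc 0 T hT
  have hP : Continuous P := continuous_projIcc
  have hF : ∀ f : C(Icc (0 : ℝ) T, X), BddMeas (K * ‖f‖) fun s => B s (f (P s)) := fun f =>
    ⟨(ContinuousLinearMap.id ℝ (X →L[ℝ] X)).aestronglyMeasurable_comp₂ hB.aesm
      (f.continuous.comp hP).aestronglyMeasurable, hB.bound.mono fun s hs =>
        ((B s).le_opNorm _).trans (mul_le_mul hs (f.norm_coe_le_norm _) (norm_nonneg _) hK)⟩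
  have cexp : Continuous fun s => Real.exp (l * s) := by fun_prop
  have hI : ∀ f : C(Icc (0 : ℝ) T, X), ∀ a b, IntervalIntegrable
      (fun s => Real.exp (l * s) • B s (f (P s))) volume a b := fun f a b =>
    ((hF f).intervalIntegrable a b).continuousOn_smul cexp.continuousOn
  -- This is the Picard map conjugated by `e^{-lt}`: a fixed point `f` gives the solution `e^{lt}
  -- f`.
  set Ψ : C(Icc (0 : ℝ) T, X) → C(Icc (0 : ℝ) T, X) := fun f =>
    ⟨fun t => Real.exp (-(l * t)) • (u₀ + ∫ s in (0 : ℝ)..t, Real.exp (l * s) • B s (f (P s))), by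
      have h1 := intervalIntegral.continuous_primitive (hI f) 0
      have h2 := h1.comp (continuous_subtype_val (p := (· ∈ Icc (0 : ℝ) T)))
      simp only [Function.comp_def] at h2
      fun_prop⟩ with hΨ
  have hlip : ∀ f g, dist (Ψ f) (Ψ g) ≤ (1 / 2 : NNReal) * dist f g := by
    intro f g
    refine (ContinuousMap.dist_le (by positivity)).2 fun t => ?_
    have ht := t.2.1
    have e1 : Ψ f t - Ψ g t = Real.exp (-(l * t)) •
        ∫ s in (0 : ℝ)..t, Real.exp (l * s) • B s ((f - g) (P s)) := by
      simp only [hΨ, ContinuousMap.coe_mk]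
      rw [← smul_sub, add_sub_add_left_eq_sub, ← intervalIntegral.integral_sub (hI f _ _)
        (hI g _ _)]
      simp only [ContinuousMap.sub_apply, map_sub, smul_sub]
    have e2 : ∫ s in (0 : ℝ)..t, Real.exp (l * s) * (K * ‖f - g‖) =
        (Real.exp (l * t) - 1) / l * (K * ‖f - g‖) := by
      rw [intervalIntegral.integral_mul_const, intervalIntegral.integral_comp_mul_left _ hl0.ne']
      simp [div_eq_inv_mul]
    have h1 : ‖∫ s in (0 : ℝ)..t, Real.exp (l * s) • B s ((f - g) (P s))‖ ≤
        (Real.exp (l * t) - 1) / l * (K * ‖f - g‖) := by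
      rw [← e2]
      refine intervalIntegral.norm_integral_le_of_norm_le ht
        ((hF (f - g)).bound.mono fun s hs _ => ?_) ?_
      · rw [norm_smul, Real.norm_eq_abs, abs_of_pos (Real.exp_pos _)]
        exact mul_le_mul_of_nonneg_left hs (Real.exp_pos _).le
      · exact (cexp.mul continuous_const).intervalIntegrable _ _
    rw [dist_eq_norm, dist_eq_norm, e1, norm_smul, Real.norm_eq_abs, abs_of_pos (Real.exp_pos _)]
    have h2 : K / l ≤ 1 / 2 := by
      rw [div_le_div_iff₀ hl0 (by norm_num)]
      linarith
    have h3 : Real.exp (-(l * t)) * Real.exp (l * t) = 1 := by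
      rw [← Real.exp_add]; simp
    calc Real.exp (-(l * t)) * ‖∫ s in (0 : ℝ)..t, Real.exp (l * s) • B s ((f - g) (P s))‖
        ≤ Real.exp (-(l * t)) * ((Real.exp (l * t) - 1) / l * (K * ‖f - g‖)) :=
          mul_le_mul_of_nonneg_left h1 (Real.exp_pos _).le
      _ = (1 - Real.exp (-(l * t))) * (K / l * ‖f - g‖) := by
          have : Real.exp (-(l * t)) * ((Real.exp (l * t) - 1) / l * (K * ‖f - g‖)) =
            (Real.exp (-(l * t)) * Real.exp (l * t) - Real.exp (-(l * t))) *
              (K / l * ‖f - g‖) := by ring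
          rw [this, h3]
      _ ≤ 1 * (K / l * ‖f - g‖) := by
          refine mul_le_mul_of_nonneg_right ?_ (by positivity)
          linarith [Real.exp_pos (-(l * t))]
      _ ≤ (1 / 2 : NNReal) * ‖f - g‖ := by
          rw [one_mul]
          refine mul_le_mul_of_nonneg_right ?_ (norm_nonneg _)
          simpa using h2
  have hcon : ContractingWith (1 / 2 : NNReal) Ψ :=
    ⟨by rw [← NNReal.coe_lt_coe]; push_cast; norm_num, LipschitzWith.of_dist_le_mul hlip⟩
  set f := hcon.fixedPoint with hf
  have hfix : Ψ f = f := hcon.fixedPoint_isFixedPt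
  refine ⟨fun t => Real.exp (l * t) • f (P t), cexp.smul (f.continuous.comp hP), fun t ht => ?_⟩
  have e : ∀ s ∈ Icc 0 T, ((P s : Icc (0 : ℝ) T) : ℝ) = s := fun s hs => by
    simp only [P, projIcc_of_mem hT hs]
  have h1 : f (P t) = Ψ f (P t) := by rw [hfix]
  simp only
  rw [h1]
  simp only [hΨ, ContinuousMap.coe_mk, e t ht]
  rw [smul_smul, ← Real.exp_add, add_neg_cancel, Real.exp_zero, one_smul]
  congr 1
  refine intervalIntegral.integral_congr fun s _ => ?_
  simp

end LinearODE

/-! ### Weak convergence in Hilbert spaces. -/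

theorem cauchySeq_of_approx {a : ℕ → ℝ}
    (h : ∀ ε > 0, ∃ b : ℕ → ℝ, CauchySeq b ∧ ∀ᶠ n in atTop, |a n - b n| ≤ ε) : CauchySeq a := by
  refine Metric.cauchySeq_iff'.2 fun ε hε => ?_
  obtain ⟨b, hb, hab⟩ := h (ε / 4) (by positivity)
  obtain ⟨N₁, h1⟩ := Metric.cauchySeq_iff.1 hb (ε / 4) (by positivity)
  obtain ⟨N₂, h2⟩ := eventually_atTop.1 hab
  refine ⟨max N₁ N₂, fun n hn => ?_⟩
  have k1 := h1 n (le_of_max_le_left hn) (max N₁ N₂) (le_max_left _ _)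
  have k2 := h2 n (le_of_max_le_right hn)
  have k3 := h2 (max N₁ N₂) (le_max_right _ _)
  rw [Real.dist_eq] at *
  rw [abs_le] at k2 k3
  rw [abs_lt] at *
  constructor <;> linarith

section WeakLimit

variable {H : Type*} [NormedAddCommGroup H] [InnerProductSpace ℝ H]

theorem eq_zero_of_inner_dense {S : Set H} (hS : (Submodule.span ℝ S).topologicalClosure = ⊤)
    {x : H} (h : ∀ d ∈ S, inner ℝ d x = 0) : x = 0 := by
  have h1 : Submodule.span ℝ S ≤ (ℝ ∙ x)ᗮ := Submodule.span_le.2 fun d hd =>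
    Submodule.mem_orthogonal_singleton_iff_inner_left.2 (h d hd)
  have h2 : (Submodule.span ℝ S).topologicalClosure ≤ (ℝ ∙ x)ᗮ :=
    Submodule.topologicalClosure_minimal _ h1 (Submodule.isClosed_orthogonal _)
  rw [hS] at h2
  exact inner_self_eq_zero.1 (Submodule.mem_orthogonal_singleton_iff_inner_left.1
    (h2 (Submodule.mem_top (x := x))))

/-- A bounded family all of whose pairings converge has a weak limit. -/
theorem exists_weak_limit [CompleteSpace H] {ι : Type*} {l : Filter ι} [l.NeBot] {x : ι → H}
    {M : ℝ} (hx : ∀ᶠ n in l, ‖x n‖ ≤ M)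
    (h : ∀ d, ∃ a, Tendsto (fun n => inner ℝ d (x n)) l (𝓝 a)) :
    ∃ y : H, ‖y‖ ≤ M ∧ ∀ d, Tendsto (fun n => inner ℝ d (x n)) l (𝓝 (inner ℝ d y)) := by
  choose a ha using h
  have hM : 0 ≤ M := by
    obtain ⟨n, hn⟩ := hx.exists
    exact (norm_nonneg _).trans hn
  -- The limits of the pairings form a bounded linear functional, represented through the Riesz
  -- isomorphism.
  let L : H →ₗ[ℝ] ℝ :=
    { toFun := a
      map_add' := fun d e => tendsto_nhds_unique (ha (d + e)) (by
        simpa only [inner_add_left] using (ha d).add (ha e))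
      map_smul' := fun c d => tendsto_nhds_unique (ha (c • d)) (by
        simp only [real_inner_smul_left, smul_eq_mul, RingHom.id_apply]
        exact (ha d).const_mul c) }
  have hL : ∀ d, ‖L d‖ ≤ M * ‖d‖ := fun d => by
    refine le_of_tendsto (ha d).norm (hx.mono fun n hn => ?_)
    rw [mul_comm]
    exact (norm_inner_le_norm _ _).trans (mul_le_mul_of_nonneg_left hn (norm_nonneg _))
  set Lc : StrongDual ℝ H := L.mkContinuous M hL with hLc
  refine ⟨(InnerProductSpace.toDual ℝ H).symm Lc, ?_, fun d => ?_⟩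
  · rw [LinearIsometryEquiv.norm_map]
    exact L.mkContinuous_norm_le hM hL
  · have : inner ℝ d ((InnerProductSpace.toDual ℝ H).symm Lc) = a d := by
      rw [real_inner_comm, InnerProductSpace.toDual_symm_apply]
      rfl
    rw [this]
    exact ha d

/-- Boundedness makes the functionals `d ↦ ⟨d, x n⟩` equicontinuous, so the Cauchy property spreads
from `S` by linearity and density. -/
theorem cauchySeq_inner_of_dense {S : Set H}
    (hS : (Submodule.span ℝ S).topologicalClosure = ⊤) {x : ℕ → H} {M : ℝ}
    (hx : ∀ n, ‖x n‖ ≤ M) (h : ∀ d ∈ S, CauchySeq fun n => inner ℝ d (x n)) (d : H) :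
    CauchySeq fun n => (inner ℝ d (x n) : ℝ) := by
  have hspan : ∀ d ∈ Submodule.span ℝ S, CauchySeq fun n => (inner ℝ d (x n) : ℝ) := by
    intro d hd
    induction hd using Submodule.span_induction with
    | mem x hx => exact h x hx
    | zero => simpa using cauchySeq_const (0 : ℝ)
    | add x y _ _ hx hy => simp only [inner_add_left]; exact hx.add hy
    | smul a x _ hx =>
      simp only [real_inner_smul_left]
      exact Real.uniformContinuous_const_mul.comp_cauchySeq hx
  refine cauchySeq_of_approx fun ε hε => ?_
  have hM : 0 ≤ M := (norm_nonneg _).trans (hx 0)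
  have hd : d ∈ closure (Submodule.span ℝ S : Set H) := by
    rw [← Submodule.topologicalClosure_coe, hS]; trivial
  obtain ⟨e, he, hde⟩ := Metric.mem_closure_iff.1 hd (ε / (M + 1)) (by positivity)
  refine ⟨_, hspan e he, Eventually.of_forall fun n => ?_⟩
  rw [← inner_sub_left]
  refine (abs_real_inner_le_norm _ _).trans ?_
  rw [dist_eq_norm] at hde
  calc ‖d - e‖ * ‖x n‖ ≤ ε / (M + 1) * (M + 1) :=
        mul_le_mul hde.le ((hx n).trans (by linarith)) (norm_nonneg _) (by positivity)
    _ = ε := div_mul_cancel₀ _ (by positivity)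

theorem continuousOn_inner_of_dense {S : Set H}
    (hS : (Submodule.span ℝ S).topologicalClosure = ⊤) {v : ℝ → H} {I : Set ℝ} {M : ℝ}
    (hv : ∀ t ∈ I, ‖v t‖ ≤ M) (h : ∀ d ∈ S, ContinuousOn (fun t => inner ℝ d (v t)) I) (d : H) :
    ContinuousOn (fun t => (inner ℝ d (v t) : ℝ)) I := by
  have hspan : ∀ d ∈ Submodule.span ℝ S, ContinuousOn (fun t => (inner ℝ d (v t) : ℝ)) I := by
    intro d hd
    induction hd using Submodule.span_induction with
    | mem x hx => exact h x hx
    | zero => simpa using continuousOn_const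
    | add x y _ _ hx hy => simp only [inner_add_left]; exact hx.add hy
    | smul a x _ hx => simp only [real_inner_smul_left]; exact continuousOn_const.mul hx
  refine continuousOn_of_uniform_approx_of_continuousOn fun W hW => ?_
  obtain ⟨ε, hε, hW⟩ := Metric.mem_uniformity_dist.1 hW
  have hd : d ∈ closure (Submodule.span ℝ S : Set H) := by
    rw [← Submodule.topologicalClosure_coe, hS]; trivial
  obtain ⟨e, he, hde⟩ := Metric.mem_closure_iff.1 hd (ε / (|M| + 1)) (by positivity)
  refine ⟨_, hspan e he, fun t ht => hW ?_⟩
  rw [Real.dist_eq, ← inner_sub_left]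
  refine (abs_real_inner_le_norm _ _).trans_lt ?_
  rw [dist_eq_norm] at hde
  calc ‖d - e‖ * ‖v t‖ ≤ ‖d - e‖ * (|M| + 1) :=
        mul_le_mul_of_nonneg_left ((hv t ht).trans (by linarith [le_abs_self M])) (norm_nonneg _)
    _ < ε / (|M| + 1) * (|M| + 1) := mul_lt_mul_of_pos_right hde (by positivity)
    _ = ε := div_mul_cancel₀ _ (by positivity)

end WeakLimit

/-! ### Galerkin approximation and its weak limit for an abstract evolution equation. -/

section Galerkin

variable {H E Z : Type*} [NormedAddCommGroup H] [InnerProductSpace ℝ H]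
  [NormedAddCommGroup E] [InnerProductSpace ℝ E] [CompleteSpace E]
  [NormedAddCommGroup Z] [NormedSpace ℝ Z] {R : Submodule ℝ H} {Λ : R →ₗ[ℝ] E} {Δ : R →ₗ[ℝ] Z}
  {A : ℝ → H →L[ℝ] E} {K C T : ℝ}

/-- The compression of a bounded measurable family of operators. -/
theorem BddMeas.compress {V : Type*} [NormedAddCommGroup V] [InnerProductSpace ℝ V]
    [CompleteSpace V] (hA : BddMeas K A) (L : V →L[ℝ] E) (I : V →L[ℝ] H) :
    ∃ K', BddMeas K' fun t => -(L.adjoint.comp ((A t).comp I)) := by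
  refine ⟨‖L.adjoint‖ * (K * ‖I‖), AEStronglyMeasurable.neg ?_, hA.bound.mono fun t ht => ?_⟩
  · exact (continuous_const.clm_comp (continuous_id.clm_comp
      continuous_const)).comp_aestronglyMeasurable hA.aesm
  · rw [norm_neg]
    refine (ContinuousLinearMap.opNorm_comp_le _ _).trans
      (mul_le_mul_of_nonneg_left ?_ (norm_nonneg _))
    exact (ContinuousLinearMap.opNorm_comp_le _ _).trans
      (mul_le_mul_of_nonneg_right ht (norm_nonneg _))

set_option maxHeartbeats 1000000 in
/-- The Galerkin approximation in a finite-dimensional subspace, with its energy estimate. -/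
theorem exists_galerkin (hT : 0 ≤ T) (hC : 0 ≤ C) (hA : BddMeas K A)
    (hcoer : ∀ᵐ t, t ∈ Ioo 0 T → ∀ φ : R,
      1 / 4 * ‖Δ φ‖ ^ 2 - C * ‖φ‖ ^ 2 ≤ inner ℝ (A t φ) (Λ φ))
    (V : Submodule ℝ H) [FiniteDimensional ℝ V] (hV : V ≤ R) (ν : H) :
    ∃ u : ℝ → R, Continuous u ∧ (Continuous fun t => Δ (u t)) ∧
      (∀ t ∈ Icc 0 T, ‖u t‖ ≤ Real.exp (C * T) * ‖ν‖) ∧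
      ∫ s in (0 : ℝ)..T, ‖Δ (u s)‖ ^ 2 ≤ 2 * (1 + 2 * C * T * Real.exp (2 * C * T)) * ‖ν‖ ^ 2 ∧
      ∀ t ∈ Icc 0 T, ∀ φ : R, (φ : H) ∈ V →
        inner ℝ (φ : H) (u t : H) = inner ℝ (φ : H) ν -
          ∫ s in (0 : ℝ)..t, inner ℝ (A s (u s)) (Λ φ) := by
  have : CompleteSpace V := FiniteDimensional.complete ℝ V
  set ΛV : V →L[ℝ] E := LinearMap.toContinuousLinearMap (Λ ∘ₗ Submodule.inclusion hV) with hΛV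
  set ΔV : V →L[ℝ] Z := LinearMap.toContinuousLinearMap (Δ ∘ₗ Submodule.inclusion hV) with hΔV
  obtain ⟨K', hB⟩ := hA.compress ΛV V.subtypeL
  -- The adjoint of `Λ` on `V` converts the `E` pairing into the inner product of `H`: `u' = B u`
  -- says `⟨u', φ⟩_H = -⟨A u, Λ φ⟩_E` for all `φ ∈ V`.
  set B : ℝ → V →L[ℝ] V := fun t => -(ΛV.adjoint.comp ((A t).comp V.subtypeL)) with hBdef
  have hBapp : ∀ (t : ℝ) (x y : V), inner ℝ (B t x) y = -inner ℝ (A t x) (ΛV y) := by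
    intro t x y
    have : B t x = -(ΛV.adjoint (A t x)) := rfl
    rw [this, inner_neg_left, ContinuousLinearMap.adjoint_inner_left]
  set u₀ : V := V.orthogonalProjectionOnto ν with hu₀
  obtain ⟨w, cw, hw⟩ := exists_linear_ode hT hB u₀
  set P : ℝ → Icc (0 : ℝ) T := projIcc 0 T hT
  have hP : ∀ s ∈ Icc 0 T, ((P s : Icc (0 : ℝ) T) : ℝ) = s := fun s hs => by
    simp only [P, projIcc_of_mem hT hs]
  have cwP : Continuous fun t => w (P t) := cw.comp (continuous_subtype_val.comp continuous_projIcc)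
  obtain ⟨M, hM⟩ := isCompact_Icc.exists_bound_of_continuousOn (cw.continuousOn (s := Icc 0 T))
  have hM0 : 0 ≤ M := (norm_nonneg _).trans (hM 0 ⟨le_rfl, hT⟩)
  -- The ODE is known only on `[0, T]`. Clamping the time argument gives a velocity bounded on the
  -- whole line, whose primitive `U` agrees with `w` on `[0, T]` and obeys the product rule.
  set m : ℝ → V := fun s => B s (w (P s)) with hm
  have hmB : BddMeas (K' * M) m :=
    ⟨(ContinuousLinearMap.id ℝ (V →L[ℝ] V)).aestronglyMeasurable_comp₂ hB.aesm
      cwP.aestronglyMeasurable, hB.bound.mono fun s hs => ((B s).le_opNorm _).trans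
        (mul_le_mul hs (hM _ (P s).2) (norm_nonneg _) hB.nonneg)⟩
  set U : ℝ → V := fun t => u₀ + ∫ s in (0 : ℝ)..t, m s with hU
  have cU : Continuous U := hmB.continuous_primitive u₀ 0
  have hUw : ∀ t ∈ Icc 0 T, U t = w t := fun t ht => by
    rw [hw t ht, hU]
    simp only
    congr 1
    refine intervalIntegral.integral_congr fun s hs => ?_
    rw [uIcc_of_le ht.1] at hs
    simp only [hm, hP s ⟨hs.1, hs.2.trans ht.2⟩]
  have hmU : ∀ s ∈ Icc 0 T, m s = B s (U s) := fun s hs => by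
    rw [hUw s hs, hm]
    simp only [hP s hs]
  set i := Submodule.inclusion hV with hi
  have hnorm : ∀ x : V, ‖i x‖ = ‖x‖ := fun _ => rfl
  have ci : Continuous i := i.continuous_of_finiteDimensional
  have cΔ : Continuous fun t => Δ (i (U t)) := ΔV.continuous.comp cU
  have cU2 : Continuous fun t => ‖U t‖ ^ 2 := cU.norm.pow 2
  have cΔ2 : Continuous fun t => ‖Δ (i (U t))‖ ^ 2 := cΔ.norm.pow 2
  -- the energy inequality
  have henergy : ∀ t ∈ Icc 0 T, ‖U t‖ ^ 2 + 1 / 2 * ∫ s in (0 : ℝ)..t, ‖Δ (i (U s))‖ ^ 2 ≤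
      ‖ν‖ ^ 2 + 2 * C * ∫ s in (0 : ℝ)..t, ‖U s‖ ^ 2 := by
    intro t ht
    have h1 := inner_primitive hmB hmB u₀ u₀ (fun _ => rfl) (fun _ => rfl) (V := U) (W := U) t
    rw [real_inner_self_eq_norm_sq, real_inner_self_eq_norm_sq] at h1
    have h2 : ∫ s in (0 : ℝ)..t, (inner ℝ (m s) (U s) + inner ℝ (m s) (U s)) ≤
        ∫ s in (0 : ℝ)..t, (2 * C * ‖U s‖ ^ 2 - 1 / 2 * ‖Δ (i (U s))‖ ^ 2) := by
      refine intervalIntegral.integral_mono_ae_restrict ht.1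
        ((intervalIntegrable_inner hmB cU 0 t).add (intervalIntegrable_inner hmB cU 0 t))
        (((cU2.const_mul _).sub (cΔ2.const_mul _)).intervalIntegrable _ _) ?_
      -- Coercivity is assumed only in the open interval; the endpoints are null.
      have h3 : ∀ᵐ s ∂(volume.restrict (Icc 0 t)), s ≠ 0 ∧ s ≠ T :=
        ae_restrict_of_ae ((Measure.ae_ne volume 0).and (Measure.ae_ne volume T))
      filter_upwards [h3, ae_restrict_of_ae hcoer, ae_restrict_mem measurableSet_Icc]
        with s hs0 hs hst
      have hsT : s ∈ Icc 0 T := ⟨hst.1, hst.2.trans ht.2⟩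
      have h4 := hs ⟨lt_of_le_of_ne hst.1 (Ne.symm hs0.1), lt_of_le_of_ne hsT.2 hs0.2⟩ (i (U s))
      have h5 : inner ℝ (m s) (U s) = -inner ℝ (A s (i (U s) : R)) (Λ (i (U s))) := by
        rw [hmU s hsT, hBapp]
        rfl
      simp only [h5]
      rw [hnorm] at h4
      linarith
    have h3 : ∫ s in (0 : ℝ)..t, (2 * C * ‖U s‖ ^ 2 - 1 / 2 * ‖Δ (i (U s))‖ ^ 2) =
        2 * C * (∫ s in (0 : ℝ)..t, ‖U s‖ ^ 2) -
          1 / 2 * ∫ s in (0 : ℝ)..t, ‖Δ (i (U s))‖ ^ 2 := by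
      rw [intervalIntegral.integral_sub ((cU2.const_mul _).intervalIntegrable _ _)
        ((cΔ2.const_mul _).intervalIntegrable _ _), intervalIntegral.integral_const_mul,
        intervalIntegral.integral_const_mul]
    have h4 : ‖u₀‖ ^ 2 ≤ ‖ν‖ ^ 2 :=
      pow_le_pow_left₀ (norm_nonneg _) (V.norm_orthogonalProjectionOnto_apply_le ν) 2
    linarith
  have hΔ0 : ∀ t ∈ Icc 0 T, 0 ≤ ∫ s in (0 : ℝ)..t, ‖Δ (i (U s))‖ ^ 2 := fun t ht =>
    intervalIntegral.integral_nonneg ht.1 fun s _ => sq_nonneg _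
  have hgr : ∀ t ∈ Icc 0 T, ‖U t‖ ^ 2 ≤ ‖ν‖ ^ 2 * Real.exp (2 * C * t) :=
    le_exp_of_le_integral cU2 (by positivity) fun t ht => by
      have := henergy t ht
      have := hΔ0 t ht
      linarith
  have hgr' : ∀ t ∈ Icc 0 T, ‖U t‖ ^ 2 ≤ ‖ν‖ ^ 2 * Real.exp (2 * C * T) := fun t ht =>
    (hgr t ht).trans (mul_le_mul_of_nonneg_left (Real.exp_le_exp.2
      (mul_le_mul_of_nonneg_left ht.2 (by positivity))) (sq_nonneg _))
  refine ⟨fun t => i (U t), ci.comp cU, cΔ, fun t ht => ?_, ?_, fun t ht φ hφ => ?_⟩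
  · rw [hnorm]
    refine abs_le_of_sq_le_sq' ?_ (by positivity) |>.2
    refine (hgr' t ht).trans_eq ?_
    rw [mul_pow, ← Real.exp_nat_mul]
    push_cast
    ring_nf
  · have h1 := henergy T ⟨hT, le_rfl⟩
    have h2 : ∫ s in (0 : ℝ)..T, ‖U s‖ ^ 2 ≤
        ∫ _s in (0 : ℝ)..T, ‖ν‖ ^ 2 * Real.exp (2 * C * T) :=
      intervalIntegral.integral_mono_on hT (cU2.intervalIntegrable _ _)
        (continuous_const.intervalIntegrable _ _) hgr'
    rw [intervalIntegral.integral_const, smul_eq_mul, sub_zero] at h2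
    have h3 := mul_le_mul_of_nonneg_left h2 (by positivity : 0 ≤ 2 * C)
    nlinarith [sq_nonneg ‖U T‖]
  · have h1 : inner ℝ (φ : H) (i (U t) : H) = inner ℝ (⟨φ, hφ⟩ : V) (U t) := rfl
    have h2 : inner ℝ (⟨φ, hφ⟩ : V) u₀ = inner ℝ (φ : H) ν := by
      rw [hu₀, Submodule.inner_orthogonalProjectionOnto_eq_of_mem_left]
    have h3 := (innerSL ℝ (⟨φ, hφ⟩ : V)).intervalIntegral_comp_comm (hmB.intervalIntegrable 0 t)
    simp only [innerSL_apply_apply] at h3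
    rw [h1, hU]
    rw [inner_add_right, h2, ← h3, sub_eq_add_neg, ← intervalIntegral.integral_neg]
    congr 1
    refine intervalIntegral.integral_congr fun s hs => ?_
    rw [uIcc_of_le ht.1] at hs
    simp only
    rw [real_inner_comm, hmU s ⟨hs.1, hs.2.trans ht.2⟩, hBapp]
    rfl

end Galerkin

/-- A sequence of equi-Lipschitz functions that converges at the rational times converges. -/
theorem cauchySeq_of_lipschitz {a : ℕ → ℝ → ℝ} {T L : ℝ} (hT : 0 ≤ T)
    (hL : ∀ᶠ n in atTop, ∀ s ∈ Icc 0 T, ∀ t ∈ Icc 0 T, |a n t - a n s| ≤ L * |t - s|)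
    (hq : ∀ q : ℚ, CauchySeq fun n => a n (projIcc 0 T hT q)) {t : ℝ} (ht : t ∈ Icc 0 T) :
    CauchySeq fun n => a n t := by
  refine cauchySeq_of_approx fun ε hε => ?_
  obtain ⟨q, hq1, hq2⟩ := exists_rat_btwn (sub_lt_self t (by positivity : 0 < ε / (|L| + 1)))
  refine ⟨_, hq q, hL.mono fun n hn => ?_⟩
  refine (hn _ (projIcc 0 T hT q).2 t ht).trans ?_
  have h1 : |t - projIcc 0 T hT q| ≤ |t - q| := by
    have h2 := abs_projIcc_sub_projIcc (c := t) (d := (q : ℝ)) hT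
    rwa [projIcc_of_mem hT ht] at h2
  have h3 : |t - q| ≤ ε / (|L| + 1) := by
    rw [abs_le]; constructor <;> linarith
  calc L * |t - projIcc 0 T hT q| ≤ (|L| + 1) * (ε / (|L| + 1)) :=
        mul_le_mul (by linarith [le_abs_self L]) (h1.trans h3) (abs_nonneg _) (by positivity)
    _ = ε := mul_div_cancel₀ _ (by positivity)

/-- The Galerkin spaces are spanned by a sequence in `R`; separability of the image lets the density
of the whole range be kept along a sequence. -/
theorem exists_dense_sequence {E R : Type*} [NormedAddCommGroup E] [NormedSpace ℝ E]
    [SecondCountableTopology E] [Nonempty R] (f : R → E)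
    (hf : (Submodule.span ℝ (range f)).topologicalClosure = ⊤) :
    ∃ e : ℕ → R, (Submodule.span ℝ (range (f ∘ e))).topologicalClosure = ⊤ := by
  have : Nonempty (range f) := (range_nonempty f).to_subtype
  choose e he using fun n => (TopologicalSpace.denseSeq (range f) n).2
  refine ⟨e, eq_top_iff.2 ?_⟩
  rw [← hf]
  refine Submodule.topologicalClosure_minimal _ (Submodule.span_le.2 ?_)
    (Submodule.isClosed_topologicalClosure _)
  rintro _ ⟨r, rfl⟩
  have h1 : (⟨f r, r, rfl⟩ : range f) ∈ closure (range (TopologicalSpace.denseSeq (range f))) :=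
    TopologicalSpace.denseRange_denseSeq _ _
  have h2 := image_closure_subset_closure_image continuous_subtype_val (mem_image_of_mem
    (Subtype.val : range f → E) h1)
  rw [← range_comp] at h2
  refine closure_mono ?_ h2
  rintro _ ⟨n, rfl⟩
  refine Submodule.subset_span ⟨n, ?_⟩
  simp [he]

section Limit

variable {H E Z : Type*} [NormedAddCommGroup H] [InnerProductSpace ℝ H] [CompleteSpace H]
  [SecondCountableTopology H]
  [NormedAddCommGroup E] [InnerProductSpace ℝ E] [CompleteSpace E]
  [NormedAddCommGroup Z] [NormedSpace ℝ Z] {R : Submodule ℝ H} {Λ : R →ₗ[ℝ] E} {Δ : R →ₗ[ℝ] Z}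
  {A : ℝ → H →L[ℝ] E} {K C T : ℝ} {j : H →L[ℝ] E}

set_option maxHeartbeats 1000000 in
/-- Existence for a linear evolution equation `∂ₜ (j v) + A v = 0` whose energy estimate holds in the
space `H`, as the weak limit of Galerkin approximations. -/
theorem exists_evolution [SecondCountableTopology E] (hT : 0 ≤ T) (hC : 0 ≤ C) (hA : BddMeas K A)
    (hj : Function.Injective j)
    (hΛ : ∀ (u : H) (φ : R), inner ℝ (j u) (Λ φ) = inner ℝ u (φ : H))
    (hdense : (Submodule.span ℝ (range Λ)).topologicalClosure = ⊤)
    (hcoer : ∀ᵐ t, t ∈ Ioo 0 T → ∀ φ : R,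
      1 / 4 * ‖Δ φ‖ ^ 2 - C * ‖φ‖ ^ 2 ≤ inner ℝ (A t φ) (Λ φ)) (ν : H) :
    ∃ v : ℝ → H, AEStronglyMeasurable v volume ∧
      (∀ t, ‖v t‖ ≤ Real.exp (C * T) * ‖ν‖) ∧
      (∀ d : H, ContinuousOn (fun t => inner ℝ d (v t)) (Icc 0 T)) ∧
      (∀ t ∈ Icc 0 T, j (v t) = j ν - ∫ s in (0 : ℝ)..t, A s (v s)) ∧
      ∃ u : ℕ → ℝ → R, (∀ n, Continuous fun t => Δ (u n t)) ∧
        (∀ n, ∫ s in (0 : ℝ)..T, ‖Δ (u n s)‖ ^ 2 ≤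
          2 * (1 + 2 * C * T * Real.exp (2 * C * T)) * ‖ν‖ ^ 2) ∧
        ∀ t ∈ Icc 0 T, ∀ d : H,
          Tendsto (fun n => inner ℝ d (u n t : H)) atTop (𝓝 (inner ℝ d (v t))) := by
  have hK := hA.nonneg
  set M := Real.exp (C * T) * ‖ν‖ with hM
  have hM0 : 0 ≤ M := by positivity
  obtain ⟨e, he⟩ := exists_dense_sequence Λ hdense
  -- the chosen elements also span a dense subspace of `H`
  set S : Set H := range fun i => (e i : H) with hS
  have hSd : (Submodule.span ℝ S).topologicalClosure = ⊤ := by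
    rw [Submodule.topologicalClosure_eq_top_iff, Submodule.eq_bot_iff]
    intro x hx
    -- If `x` is orthogonal to every `e i` in `H`, then by `hΛ` its image `j x` is orthogonal to the
    -- dense family `Λ (e i)` in `E`.
    refine hj ?_
    rw [map_zero]
    refine eq_zero_of_inner_dense he ?_
    rintro _ ⟨i, rfl⟩
    rw [Function.comp_apply, real_inner_comm, hΛ, real_inner_comm]
    exact hx _ (Submodule.subset_span ⟨i, rfl⟩)
  set V : ℕ → Submodule ℝ H := fun n => Submodule.span ℝ ((fun i => (e i : H)) '' Iio n) with hV
  have hVR : ∀ n, V n ≤ R := fun n => Submodule.span_le.2 (by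
    rintro _ ⟨i, _, rfl⟩; exact (e i).2)
  have hfin : ∀ n, FiniteDimensional ℝ (V n) := fun n =>
    FiniteDimensional.span_of_finite ℝ ((Set.finite_Iio n).image _)
  choose u cu cΔ hbd hΔ heq using fun n => exists_galerkin hT hC hA hcoer (V n) (hVR n) ν
  have hmem : ∀ i n, i < n → (e i : H) ∈ V n := fun i n hin =>
    Submodule.subset_span ⟨i, hin, rfl⟩
  -- the projections of the approximations onto a fixed direction are equi-Lipschitz
  have hAu : ∀ n i, ∀ t ∈ Icc 0 T, ∀ᵐ s, s ∈ uIoc 0 t →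
      ‖(inner ℝ (A s (u n s)) (Λ (e i)) : ℝ)‖ ≤ K * M * ‖Λ (e i)‖ := by
    intro n i t ht
    refine hA.bound.mono fun s hs hst => ?_
    rw [uIoc_of_le ht.1] at hst
    refine (norm_inner_le_norm _ _).trans (mul_le_mul_of_nonneg_right ?_ (norm_nonneg _))
    exact ((A s).le_opNorm _).trans (mul_le_mul hs (hbd n s ⟨hst.1.le, hst.2.trans ht.2⟩)
      (norm_nonneg _) hK)
  have cuH : ∀ n, Continuous fun t => (u n t : H) := fun n => continuous_subtype_val.comp (cu n)
  have hAmeas : ∀ w : ℝ → H, AEStronglyMeasurable w volume →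
      AEStronglyMeasurable (fun s => A s (w s)) volume := fun w hw =>
    (ContinuousLinearMap.id ℝ (H →L[ℝ] E)).aestronglyMeasurable_comp₂ hA.aesm hw
  have hAint : ∀ n i, ∀ t ∈ Icc 0 T, IntervalIntegrable
      (fun s => (inner ℝ (A s (u n s)) (Λ (e i)) : ℝ)) volume 0 t := fun n i t ht =>
    (intervalIntegrable_const (c := K * M * ‖Λ (e i)‖)).mono_fun
      ((hAmeas _ (cuH n).aestronglyMeasurable).inner aestronglyMeasurable_const).restrict (by
        rw [EventuallyLE, ae_restrict_iff' measurableSet_uIoc]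
        exact (hAu n i t ht).mono fun s hs hst => (hs hst).trans (le_abs_self _))
  have hlip : ∀ i n, i < n → ∀ s ∈ Icc 0 T, ∀ t ∈ Icc 0 T,
      |inner ℝ (e i : H) (u n t : H) - inner ℝ (e i : H) (u n s : H)| ≤
        (K * M * ‖Λ (e i)‖) * |t - s| := by
    intro i n hin s hs t ht
    rw [heq n t ht _ (hmem i n hin), heq n s hs _ (hmem i n hin), sub_sub_sub_cancel_left,
      intervalIntegral.integral_interval_sub_left (hAint n i s hs) (hAint n i t ht),
      abs_sub_comm t s, ← Real.norm_eq_abs (∫ _ in _.._, _)]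
    refine intervalIntegral.norm_integral_le_of_norm_le_const_ae ?_
    filter_upwards [hA.bound] with r hr hrs
    have hrT : r ∈ Icc 0 T := uIcc_subset_Icc ht hs (uIoc_subset_uIcc hrs)
    refine (norm_inner_le_norm _ _).trans (mul_le_mul_of_nonneg_right ?_ (norm_nonneg _))
    exact ((A r).le_opNorm _).trans (mul_le_mul hr (hbd n r hrT) (norm_nonneg _) hK)
  -- extraction of a subsequence that converges weakly at rational times
  set c : ℕ → ℕ × ℚ → ℝ := fun n p =>
    inner ℝ (e p.1 : H) (u n (projIcc 0 T hT p.2) : H) with hc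
  -- All pairings at all rational times form one point of a compact metrizable product, so a single
  -- extraction replaces a diagonal argument.
  have hcomp : IsCompact (Set.pi univ fun p : ℕ × ℚ => Icc (-(‖(e p.1 : H)‖ * M))
      (‖(e p.1 : H)‖ * M)) := isCompact_univ_pi fun _ => isCompact_Icc
  obtain ⟨c', -, σ, hσ, hlim⟩ := hcomp.tendsto_subseq (x := c) fun n p _ => by
    refine abs_le.1 ((abs_real_inner_le_norm _ _).trans ?_)
    exact mul_le_mul_of_nonneg_left (hbd n _ (projIcc 0 T hT p.2).2) (norm_nonneg _)
  have hcauchy : ∀ t ∈ Icc 0 T, ∀ d : H, CauchySeq fun n => (inner ℝ d (u (σ n) t : H) : ℝ) := by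
    intro t ht
    refine cauchySeq_inner_of_dense hSd (fun n => hbd (σ n) t ht) ?_
    rintro _ ⟨i, rfl⟩
    refine cauchySeq_of_lipschitz (a := fun n t => inner ℝ (e i : H) (u (σ n) t : H))
      (L := K * M * ‖Λ (e i)‖) hT ?_ (fun q => ?_) ht
    · filter_upwards [eventually_gt_atTop i] with n hn
      exact hlip i (σ n) (hn.trans_le (hσ.id_le n))
    · exact ((tendsto_pi_nhds.1 hlim) (i, q)).cauchySeq
  have hex : ∀ t, ∃ y : H, ‖y‖ ≤ M ∧ (t ∈ Icc 0 T → ∀ d : H,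
      Tendsto (fun n => inner ℝ d (u (σ n) t : H)) atTop (𝓝 (inner ℝ d y))) ∧
      (t ∉ Icc 0 T → y = 0) := by
    intro t
    by_cases ht : t ∈ Icc 0 T
    · obtain ⟨y, hy, hy'⟩ := exists_weak_limit (l := atTop) (x := fun n => (u (σ n) t : H))
        (Eventually.of_forall fun n => hbd (σ n) t ht)
        fun d => cauchySeq_tendsto_of_complete (hcauchy t ht d)
      exact ⟨y, hy, fun _ => hy', fun h => absurd ht h⟩
    · exact ⟨0, by simpa using hM0, fun h => absurd h ht, fun _ => rfl⟩
  choose v hvM hvlim hv0 using hex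
  have hvS : ∀ d ∈ S, ContinuousOn (fun t => (inner ℝ d (v t) : ℝ)) (Icc 0 T) := by
    rintro _ ⟨i, rfl⟩
    refine (LipschitzOnWith.of_dist_le_mul (K := Real.toNNReal (K * M * ‖Λ (e i)‖))
      fun t ht s hs => ?_).continuousOn
    rw [Real.coe_toNNReal _ (by positivity), Real.dist_eq, Real.dist_eq]
    refine le_of_tendsto ((hvlim t ht _).sub (hvlim s hs _)).abs ?_
    filter_upwards [eventually_gt_atTop i] with n hn
    exact hlip i (σ n) (hn.trans_le (hσ.id_le n)) s hs t ht
  have hvcont := continuousOn_inner_of_dense hSd (fun t _ => hvM t) hvS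
  have hvmeas : AEStronglyMeasurable v volume := by
    refine aestronglyMeasurable_of_inner hSd fun d _ => ?_
    have e1 : (fun t => (inner ℝ d (v t) : ℝ)) =
        (Icc 0 T).indicator fun t => inner ℝ d (v t) := by
      funext t
      by_cases ht : t ∈ Icc 0 T
      · rw [indicator_of_mem ht]
      · rw [indicator_of_notMem ht, hv0 t ht, inner_zero_right]
    rw [e1]
    exact (aemeasurable_indicator_iff measurableSet_Icc).2
      ((hvcont d).aemeasurable measurableSet_Icc)
  have hAv : BddMeas (K * M) fun s => A s (v s) := ⟨hAmeas v hvmeas, hA.bound.mono fun s hs =>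
    ((A s).le_opNorm _).trans (mul_le_mul hs (hvM s) (norm_nonneg _) hK)⟩
  refine ⟨v, hvmeas, hvM, hvcont, fun t ht => ?_, fun n => u (σ n), fun n => cΔ _, fun n => hΔ _,
    fun t ht => hvlim t ht⟩
  rw [← sub_eq_zero]
  refine eq_zero_of_inner_dense he ?_
  rintro _ ⟨i, rfl⟩
  -- For fixed `s` the integrand is the pairing of `u (σ n) s` with the fixed vector `(A s)* Λ (e
  -- i)`, so weak convergence suffices.
  have h1 : Tendsto (fun n => ∫ s in (0 : ℝ)..t, (inner ℝ (A s (u (σ n) s)) (Λ (e i)) : ℝ)) atTop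
      (𝓝 (∫ s in (0 : ℝ)..t, inner ℝ (A s (v s)) (Λ (e i)))) := by
    refine intervalIntegral.tendsto_integral_filter_of_dominated_convergence
      (fun _ => K * M * ‖Λ (e i)‖) (Eventually.of_forall fun n => (((hAmeas _
        (cuH (σ n)).aestronglyMeasurable).inner aestronglyMeasurable_const).restrict))
      (Eventually.of_forall fun n => hAu (σ n) i t ht) intervalIntegrable_const
      (Eventually.of_forall fun s hs => ?_)
    rw [uIoc_of_le ht.1] at hs
    have h2 := hvlim s ⟨hs.1.le, hs.2.trans ht.2⟩ ((A s).adjoint (Λ (e i)))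
    simpa only [ContinuousLinearMap.adjoint_inner_left, real_inner_comm] using h2
  have h2 : inner ℝ (e i : H) (v t) = inner ℝ (e i : H) ν -
      ∫ s in (0 : ℝ)..t, (inner ℝ (A s (v s)) (Λ (e i)) : ℝ) := by
    refine tendsto_nhds_unique (hvlim t ht _) ((tendsto_const_nhds.sub h1).congr' ?_)
    filter_upwards [eventually_gt_atTop i] with n hn
    exact (heq (σ n) t ht _ (hmem i _ (hn.trans_le (hσ.id_le n)))).symm
  have h3 := (innerSL ℝ (Λ (e i))).intervalIntegral_comp_comm (hAv.intervalIntegrable 0 t)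
  simp only [innerSL_apply_apply] at h3
  rw [Function.comp_apply, inner_sub_right, inner_sub_right, ← h3, real_inner_comm, hΛ,
    real_inner_comm (j ν), hΛ, real_inner_comm, h2, real_inner_comm ν]
  simp only [real_inner_comm (Λ (e i))]
  ring

end Limit

/-! ### Convolution, and density of the range of the elliptic operator. -/

open scoped Convolution

/-- The elliptic operator `∑_{|α| ≤ 4} (-1)^{|α|} ∂^{2α}` associated with the norm of `H⁴`. -/
def Lop (φ : ℝ × ℝ → ℝ) : ℝ × ℝ → ℝ :=
  ∑ α : MultiIndex 4, ((-1) ^ ((α.1.1 : ℕ) + (α.1.2 : ℕ)) : ℝ) •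
    D α.1.1 α.1.2 (D α.1.1 α.1.2 φ)

section Convolve

variable {u ρ : ℝ × ℝ → ℝ}

/-- The convolution of functions on the plane. -/
def conv (u ρ : ℝ × ℝ → ℝ) : ℝ × ℝ → ℝ := fun x => ∫ t, u t * ρ (x - t)

theorem conv_eq (u ρ : ℝ × ℝ → ℝ) : conv u ρ = u ⋆[ContinuousLinearMap.mul ℝ ℝ, volume] ρ := rfl

theorem smooth_conv (hu : LocallyIntegrable u) (hρ : IsTest ρ) : Smooth (conv u ρ) :=
  hρ.2.contDiff_convolution_right (n := ⊤) (ContinuousLinearMap.mul ℝ ℝ) hu hρ.1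

theorem fderiv_conv (hu : LocallyIntegrable u) (hρ : IsTest ρ) (x v : ℝ × ℝ) :
    fderiv ℝ (conv u ρ) x v = conv u (fun y => fderiv ℝ ρ y v) x := by
  have h1 := hρ.2.hasFDerivAt_convolution_right (ContinuousLinearMap.mul ℝ ℝ) hu
    (hρ.1.of_le (by simp)) x
  rw [conv_eq, h1.fderiv, convolution_precompR_apply _ hu (hρ.2.fderiv ℝ)
    (hρ.1.continuous_fderiv (by simp))]
  rfl

theorem dx_conv (hu : LocallyIntegrable u) (hρ : IsTest ρ) :
    dx (conv u ρ) = conv u (dx ρ) := by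
  rw [dx_eq (smooth_conv hu hρ), dx_eq hρ.1]
  exact funext fun x => fderiv_conv hu hρ x _

theorem dy_conv (hu : LocallyIntegrable u) (hρ : IsTest ρ) :
    dy (conv u ρ) = conv u (dy ρ) := by
  rw [dy_eq (smooth_conv hu hρ), dy_eq hρ.1]
  exact funext fun x => fderiv_conv hu hρ x _

theorem D_conv (hu : LocallyIntegrable u) (hρ : IsTest ρ) (a b : ℕ) :
    D a b (conv u ρ) = conv u (D a b ρ) := by
  induction a with
  | zero =>
    induction b with
    | zero => rfl
    | succ b ih =>
      rw [← dy_D (smooth_conv hu hρ), ih, dy_conv hu (hρ.D _ _), dy_D hρ.1]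
  | succ a ih => rw [← dx_D, ih, dx_conv hu (hρ.D _ _), dx_D]

theorem memLp_reflect (hρ : MemLp ρ 2 volume) (x : ℝ × ℝ) :
    MemLp (fun t => ρ (x - t)) 2 volume :=
  hρ.comp_measurePreserving (Measure.measurePreserving_sub_left volume x)

/-- Cauchy–Schwarz on the support of `ρ` bounds `|conv u ρ|²` by `‖ρ‖²` times the convolution of the
integrable functions `u²` and the indicator `χ` of that support. -/
theorem memLp_conv (hu : MemLp u 2 volume) (hρ : IsTest ρ) : MemLp (conv u ρ) 2 volume := by
  have hs := smooth_conv (hu.locallyIntegrable (by norm_num)) hρ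
  set k : Set (ℝ × ℝ) := tsupport ρ with hk
  have kc : IsCompact k := hρ.2.isCompact
  have km : MeasurableSet k := kc.measurableSet
  set χ : ℝ × ℝ → ℝ := k.indicator 1 with hχ
  have hχi : Integrable χ := (integrable_indicator_iff km).2
    (integrableOn_const (kc.measure_lt_top.ne))
  have hci : Integrable ((fun t => u t ^ 2) ⋆[ContinuousLinearMap.mul ℝ ℝ, volume] χ) :=
    hu.integrable_sq.integrable_convolution _ hχi
  rw [memLp_two_iff_integrable_sq hs.continuous.aestronglyMeasurable]
  refine (hci.const_mul (n2 ρ ^ 2)).mono' (hs.continuous.pow 2).aestronglyMeasurable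
    (Eventually.of_forall fun x => ?_)
  set w : ℝ × ℝ → ℝ := fun t => u t * χ (x - t) with hw
  have hχx : ∀ t, χ (x - t) = 0 ∨ χ (x - t) = 1 := fun t => by
    by_cases h : x - t ∈ k
    · right; rw [hχ, indicator_of_mem h]; rfl
    · left; rw [hχ, indicator_of_notMem h]
  have hwm : MemLp w 2 volume := by
    refine hu.of_le (hu.1.mul ?_) (Eventually.of_forall fun t => ?_)
    · exact hχi.1.comp_measurePreserving (Measure.measurePreserving_sub_left volume x)
    · rcases hχx t with h | h <;> simp [hw, h]
  have e1 : conv u ρ x = ∫ t, w t * ρ (x - t) := by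
    simp only [conv]
    congr 1
    funext t
    by_cases h : x - t ∈ k
    · simp [hw, hχ, h]
    · have h0 : ρ (x - t) = 0 := image_eq_zero_of_notMem_tsupport h
      simp [h0]
  have e2 : n2 (fun t => ρ (x - t)) = n2 ρ := by
    rw [n2, n2, ← eLpNorm_comp_measurePreserving (p := 2) (g := ρ) hρ.memLp.1
      (Measure.measurePreserving_sub_left volume x)]
    rfl
  have h1 := abs_integral_mul_le hwm (memLp_reflect hρ.memLp x)
  rw [← e1, e2] at h1
  have e3 : n2 w ^ 2 = ((fun t => u t ^ 2) ⋆[ContinuousLinearMap.mul ℝ ℝ, volume] χ) x := by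
    rw [n2_sq hwm]
    simp only [convolution, ContinuousLinearMap.mul_apply']
    congr 1
    funext t
    rcases hχx t with h | h <;> simp [hw, h]
  rw [← e3, Real.norm_eq_abs, abs_of_nonneg (sq_nonneg _), ← sq_abs, ← mul_pow]
  exact pow_le_pow_left₀ (abs_nonneg _) (h1.trans_eq (mul_comm _ _)) 2

theorem hinf_conv (hu : MemLp u 2 volume) (hρ : IsTest ρ) : Hinf (conv u ρ) :=
  ⟨smooth_conv (hu.locallyIntegrable (by norm_num)) hρ, fun a b => by
    rw [D_conv (hu.locallyIntegrable (by norm_num)) hρ]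
    exact memLp_conv hu (hρ.D a b)⟩

theorem D_reflect (hρ : Smooth ρ) (x : ℝ × ℝ) (a b : ℕ) :
    D a b (fun t => ρ (x - t)) = fun t => (-1) ^ (a + b) * D a b ρ (x - t) := by
  have hdx : ∀ φ : ℝ × ℝ → ℝ, dx (fun t => φ (x - t)) = fun t => -dx φ (x - t) := fun φ => by
    funext t
    exact deriv_comp_const_sub (f := fun s => φ (s, x.2 - t.2)) x.1 t.1
  have hdy : ∀ φ : ℝ × ℝ → ℝ, dy (fun t => φ (x - t)) = fun t => -dy φ (x - t) := fun φ => by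
    funext t
    exact deriv_comp_const_sub (f := fun s => φ (x.1 - t.1, s)) x.2 t.2
  have hr : ∀ φ : ℝ × ℝ → ℝ, Smooth φ → Smooth fun t => φ (x - t) := fun φ hφ =>
    hφ.comp (contDiff_const.sub contDiff_id)
  induction a with
  | zero =>
    induction b with
    | zero => simp [D]
    | succ b ih =>
      have e : (fun t => (-1) ^ (0 + b) * D 0 b ρ (x - t)) =
        ((-1) ^ (0 + b) : ℝ) • fun t => D 0 b ρ (x - t) := rfl
      rw [← dy_D (hr ρ hρ), ih, e, dy_smul _ (hr _ (smooth_D hρ _ _)), hdy, dy_D hρ]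
      funext t
      simp only [Pi.smul_apply, smul_eq_mul]
      ring
  | succ a ih =>
    have e : (fun t => (-1) ^ (a + b) * D a b ρ (x - t)) =
      ((-1) ^ (a + b) : ℝ) • fun t => D a b ρ (x - t) := rfl
    rw [← dx_D, ih, e, dx_smul _ (hr _ (smooth_D hρ _ _)), hdx, dx_D]
    funext t
    simp only [Pi.smul_apply, smul_eq_mul]
    ring

theorem IsTest.reflect (hρ : IsTest ρ) (x : ℝ × ℝ) : IsTest fun t => ρ (x - t) :=
  ⟨hρ.1.comp (contDiff_const.sub contDiff_id),
    hρ.2.comp_homeomorph (Homeomorph.subLeft x)⟩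

/-- Only derivatives of even order occur, so the signs produced by the reflection cancel. -/
theorem Lop_reflect (hρ : Smooth ρ) (x : ℝ × ℝ) :
    Lop (fun t => ρ (x - t)) = fun t => Lop ρ (x - t) := by
  have hr : Smooth fun t => ρ (x - t) := hρ.comp (contDiff_const.sub contDiff_id)
  funext t
  simp only [Lop, Finset.sum_apply, Pi.smul_apply, smul_eq_mul]
  refine Finset.sum_congr rfl fun α _ => ?_
  rw [D_D hr, D_reflect hρ, D_D hρ]
  have : ((-1) ^ ((α.1.1 : ℕ) + α.1.1 + (α.1.2 + α.1.2)) : ℝ) = 1 :=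
    Even.neg_one_pow ⟨α.1.1 + α.1.2, by ring⟩
  simp only [this, one_mul]

theorem conv_sum_smul {ι : Type*} {s : Finset ι} {c : ι → ℝ} {F : ι → ℝ × ℝ → ℝ}
    (hu : MemLp u 2 volume) (hF : ∀ i ∈ s, IsTest (F i)) :
    conv u (∑ i ∈ s, c i • F i) = ∑ i ∈ s, c i • conv u (F i) := by
  funext x
  simp only [conv, Finset.sum_apply, Pi.smul_apply, smul_eq_mul, Finset.mul_sum]
  rw [integral_finsetSum]
  · refine Finset.sum_congr rfl fun i _ => ?_
    rw [← integral_const_mul]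
    congr 1
    funext t
    ring
  · intro i hi
    have := (integrable_mul_of_memLp hu (memLp_reflect (hF i hi).memLp x)).const_mul (c i)
    refine this.congr (Eventually.of_forall fun t => ?_)
    simp only
    ring

/-- A square integrable function orthogonal to the range of `Lop` vanishes. -/
theorem ae_eq_zero_of_Lop (hu : MemLp u 2 volume)
    (h : ∀ φ, IsTest φ → ∫ p, u p * Lop φ p = 0) : u =ᵐ[volume] 0 := by
  have hul : LocallyIntegrable u := hu.locallyIntegrable (by norm_num)
  -- The regularization `U` satisfies `Lop U = 0` and has all derivatives in `L²`, so pairing with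
  -- `U` and integrating by parts gives the squared `H⁴` norm, which therefore vanishes.
  have hzero : ∀ ρ, IsTest ρ → conv u ρ = 0 := by
    intro ρ hρ
    have hU := hinf_conv hu hρ
    set U := conv u ρ with hUd
    have h1 : Lop U = 0 := by
      have : Lop U = conv u (Lop ρ) := by
        simp only [Lop]
        rw [conv_sum_smul hu fun α _ => (hρ.D _ _).D _ _]
        refine Finset.sum_congr rfl fun α _ => ?_
        rw [D_conv hul hρ, D_conv hul (hρ.D _ _)]
      rw [this]
      funext x
      have h2 := h _ (hρ.reflect x)
      rw [Lop_reflect hρ.1] at h2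
      exact h2
    have h2 : ∫ p, U p * Lop U p = ∑ α : MultiIndex 4, n2 (D α.1.1 α.1.2 U) ^ 2 := by
      simp only [Lop, Finset.sum_apply, Pi.smul_apply, smul_eq_mul, Finset.mul_sum]
      rw [integral_finsetSum]
      · refine Finset.sum_congr rfl fun α _ => ?_
        rw [n2_sq (hU.memLp _ _)]
        have h3 := integral_D_mul hU (hU.D α.1.1 α.1.2) α.1.1 α.1.2
        simp only [pow_two]
        rw [h3, ← integral_const_mul]
        congr 1
        funext p
        ring
      · intro α _
        refine ((integrable_mul_of_memLp hU.mem ((hU.D α.1.1 α.1.2).memLp α.1.1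
          α.1.2)).const_mul ((-1) ^ ((α.1.1 : ℕ) + (α.1.2 : ℕ)) : ℝ)).congr
          (Eventually.of_forall fun p => ?_)
        simp only
        ring
    rw [h1] at h2
    simp only [Pi.zero_apply, mul_zero, integral_zero] at h2
    have h3 : n2 U ^ 2 ≤ 0 := by
      have h4 := Finset.single_le_sum (f := fun α : MultiIndex 4 => n2 (D α.1.1 α.1.2 U) ^ 2)
        (s := Finset.univ) (fun _ _ => sq_nonneg _) (Finset.mem_univ (mi 0 0 (by norm_num)))
      rw [← h2] at h4
      exact h4
    have h4 : n2 U = 0 := by nlinarith [n2_nonneg U]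
    have h5 : eLpNorm U 2 volume = 0 :=
      (ENNReal.toReal_eq_zero_iff _).1 h4 |>.resolve_right hU.mem.eLpNorm_ne_top
    rw [eLpNorm_eq_zero_iff hU.mem.1 (by norm_num)] at h5
    exact Continuous.ae_eq_iff_eq volume hU.smooth.continuous continuous_const |>.1 h5
  refine ae_eq_zero_of_integral_contDiff_smul_eq_zero hul fun φ h1 h2 => ?_
  have hφ : IsTest φ := ⟨h1, h2⟩
  -- At the origin, convolution with the reflection of `φ` is the pairing with `φ`.
  have h3 := congrFun (hzero _ (hφ.reflect 0)) 0
  simp only [conv, zero_sub, neg_neg, Pi.zero_apply] at h3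
  simpa only [smul_eq_mul, mul_comm] using h3

end Convolve

/-! ### `H⁴` as a separable Hilbert space, and density of test functions. -/

/-- The space of test functions. -/
def testSpace : Submodule ℝ (ℝ × ℝ → ℝ) where
  carrier := {φ | IsTest φ}
  add_mem' h h' := IsTest.add h h'
  zero_mem' := IsTest.zero
  smul_mem' c _ h := IsTest.const_smul c h

/-- Test functions as elements of `L²`. -/
def toL2 : testSpace →ₗ[ℝ] L2 where
  toFun φ := φ.2.memLp.toLp
  map_add' φ ψ := MemLp.toLp_add φ.2.memLp ψ.2.memLp
  map_smul' c φ := MemLp.toLp_const_smul c φ.2.memLp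

theorem coe_toL2 (φ : testSpace) : toL2 φ =ᵐ[volume] (φ : ℝ × ℝ → ℝ) := φ.2.memLp.coeFn_toLp

theorem norm_toL2 (φ : testSpace) : ‖toL2 φ‖ = n2 φ := (n2_eq_norm_toLp φ.2.memLp).symm

theorem inner_L2 (f g : L2) : inner ℝ f g = ∫ p, f p * g p := by
  rw [L2.inner_def]
  congr 1
  funext p
  simp [mul_comm]

theorem inner_toL2 (f : L2) (φ : testSpace) :
    inner ℝ f (toL2 φ) = ∫ p, f p * (φ : ℝ × ℝ → ℝ) p := by
  rw [inner_L2]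
  exact integral_congr_ae ((coe_toL2 φ).mono fun p hp => congrArg (f p * ·) hp)

theorem inner_toL2_toL2 (φ ψ : testSpace) : inner ℝ (toL2 φ) (toL2 ψ) = ip φ ψ := by
  rw [inner_toL2]
  exact integral_congr_ae ((coe_toL2 φ).mono fun p hp => congrArg (· * (ψ : ℝ × ℝ → ℝ) p) hp)

/-- The partial derivatives as operators on test functions. -/
def DTest (a b : ℕ) : testSpace →ₗ[ℝ] testSpace where
  toFun φ := ⟨D a b φ, φ.2.D a b⟩
  map_add' φ ψ := Subtype.ext (D_add φ.2.1 ψ.2.1 a b)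
  map_smul' c φ := Subtype.ext (D_smul c φ.2.1 a b)

/-- Multiplication by a smooth function as an operator on test functions. -/
def mulTest (c : ℝ × ℝ → ℝ) (hc : Smooth c) : testSpace →ₗ[ℝ] testSpace where
  toFun φ := ⟨c * φ, φ.2.smooth_mul hc⟩
  map_add' φ ψ := Subtype.ext (mul_add c φ ψ)
  map_smul' r φ := Subtype.ext (mul_smul_comm r c (φ : ℝ × ℝ → ℝ))

/-- The operator `Lop` on test functions. -/
def LTest : testSpace →ₗ[ℝ] testSpace :=
  ∑ α : MultiIndex 4, ((-1) ^ ((α.1.1 : ℕ) + (α.1.2 : ℕ)) : ℝ) •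
    (DTest α.1.1 α.1.2 ∘ₗ DTest α.1.1 α.1.2)

theorem coe_LTest (φ : testSpace) : (LTest φ : ℝ × ℝ → ℝ) = Lop φ := by
  simp only [LTest, Lop, LinearMap.sum_apply, LinearMap.smul_apply, LinearMap.comp_apply,
    Submodule.coe_sum, Submodule.coe_smul]
  rfl

/-- In this form a weak derivative is a family of closed linear conditions on the pair, which is
what makes `H⁴` complete. -/
theorem hasWeakDeriv_iff_inner {a b : ℕ} {f h : L2} : HasWeakDeriv a b f h ↔
    ∀ φ : testSpace, inner ℝ h (toL2 φ) = (-1) ^ (a + b) * inner ℝ f (toL2 (DTest a b φ)) := by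
  constructor
  · intro H φ
    rw [inner_toL2, inner_toL2]
    exact H.2.2 φ φ.2
  · intro H
    refine ⟨L2.locallyIntegrable f, L2.locallyIntegrable h, fun φ hφ => ?_⟩
    have := H ⟨φ, hφ⟩
    rw [inner_toL2, inner_toL2] at this
    exact this

theorem HasWeakDeriv.unique {a b : ℕ} {f h h' : ℝ × ℝ → ℝ} (H : HasWeakDeriv a b f h)
    (H' : HasWeakDeriv a b f h') : h =ᵐ[volume] h' := by
  refine ae_eq_of_integral_contDiff_smul_eq H.2.1 H'.2.1 fun φ h1 h2 => ?_
  have h3 := (H.2.2 φ ⟨h1, h2⟩).trans (H'.2.2 φ ⟨h1, h2⟩).symm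
  simpa only [smul_eq_mul, mul_comm] using h3

theorem HasWeakDeriv.weakDeriv_ae_eq {a b : ℕ} {f h : ℝ × ℝ → ℝ} (H : HasWeakDeriv a b f h) :
    weakDeriv a b f =ᵐ[volume] h := by
  have hex : ∃ u, HasWeakDeriv a b f u := ⟨h, H⟩
  rw [weakDeriv, dif_pos hex]
  exact hex.choose_spec.unique H

instance : CompleteSpace H4 := by
  have : IsClosed (sobolev 4 : Set (PiLp 2 fun _ : MultiIndex 4 => L2)) := by
    have e : (sobolev 4 : Set (PiLp 2 fun _ : MultiIndex 4 => L2)) =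
        ⋂ (α : MultiIndex 4) (φ : testSpace), {F | inner ℝ (F α) (toL2 φ) =
          (-1) ^ ((α.1.1 : ℕ) + (α.1.2 : ℕ)) *
            inner ℝ (F (MultiIndex.zero 4)) (toL2 (DTest α.1.1 α.1.2 φ))} := by
      ext F
      simp only [mem_iInter, mem_ofPred_eq]
      exact forall_congr' fun α => hasWeakDeriv_iff_inner
    rw [e]
    refine isClosed_iInter fun α => isClosed_iInter fun φ => isClosed_eq ?_ ?_
    · exact (PiLp.continuous_apply 2 (fun _ : MultiIndex 4 => L2) α).inner continuous_const
    · exact continuous_const.mul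
        ((PiLp.continuous_apply 2 (fun _ : MultiIndex 4 => L2) _).inner continuous_const)
  exact this.completeSpace_coe

instance : Fact ((2 : ℝ≥0∞) ≠ ⊤) := ⟨ENNReal.ofNat_ne_top⟩

instance : SecondCountableTopology H4 := by
  have h2 : SecondCountableTopology (PiLp 2 fun _ : MultiIndex 4 => L2) :=
    PiLp.secondCountableTopology 2 _
  exact TopologicalSpace.Subtype.secondCountableTopology _

namespace H4

/-- The weak derivatives of an element of `H⁴`, as a bounded operator. -/
def comp (α : MultiIndex 4) : H4 →L[ℝ] L2 :=
  (PiLp.proj 2 (fun _ : MultiIndex 4 => L2) α).comp (sobolev 4).subtypeL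

/-- The inclusion of `H⁴` into `L²`. -/
def incl : H4 →L[ℝ] L2 := comp (MultiIndex.zero 4)

theorem fn_eq (u : H4) : u.fn = incl u := rfl

theorem hasWeakDeriv (u : H4) (α : MultiIndex 4) : HasWeakDeriv α.1.1 α.1.2 u.fn (comp α u) :=
  u.2 α

theorem hasWeakDeriv_mi (u : H4) {a b : ℕ} (h : a + b ≤ 4) :
    HasWeakDeriv a b u.fn (comp (mi a b h) u) :=
  u.2 (mi a b h)

theorem inner_eq (u v : H4) : inner ℝ u v = ∑ α, inner ℝ (comp α u) (comp α v) := by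
  rw [Submodule.coe_inner, PiLp.inner_apply]
  rfl

theorem norm_sq_eq (u : H4) : ‖u‖ ^ 2 = ∑ α, ‖comp α u‖ ^ 2 := by
  rw [Submodule.coe_norm, PiLp.norm_sq_eq_of_L2]
  rfl

theorem norm_comp_le (α : MultiIndex 4) (u : H4) : ‖comp α u‖ ≤ ‖u‖ := by
  refine abs_le_of_sq_le_sq' ?_ (norm_nonneg _) |>.2
  rw [norm_sq_eq]
  exact Finset.single_le_sum (f := fun α => ‖comp α u‖ ^ 2) (fun _ _ => sq_nonneg _)
    (Finset.mem_univ α)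

theorem ext_fn {u v : H4} (h : u.fn =ᵐ[volume] v.fn) : u = v := by
  refine Subtype.ext (PiLp.ext fun α => Lp.ext ?_)
  exact (u.hasWeakDeriv α).unique ((v.hasWeakDeriv α).congr h.symm EventuallyEq.rfl)

theorem incl_injective : Function.Injective incl := fun u v h => ext_fn (by
  rw [fn_eq, fn_eq, h])

end H4

/-- Test functions as elements of `H⁴`. -/
def toH4 : testSpace →ₗ[ℝ] H4 where
  toFun φ := ⟨WithLp.toLp 2 fun α => toL2 (DTest α.1.1 α.1.2 φ), fun α => by
    refine hasWeakDeriv_iff_inner.2 fun ψ => ?_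
    have e : toL2 (DTest (MultiIndex.zero 4).1.1 (MultiIndex.zero 4).1.2 φ) = toL2 φ := rfl
    show inner ℝ (toL2 (DTest α.1.1 α.1.2 φ)) (toL2 ψ) = _ *
      inner ℝ (toL2 (DTest (MultiIndex.zero 4).1.1 (MultiIndex.zero 4).1.2 φ)) _
    rw [e, inner_toL2_toL2, inner_toL2_toL2]
    exact integral_D_mul φ.2.hinf ψ.2.hinf _ _⟩
  map_add' φ ψ := by
    refine Subtype.ext (PiLp.ext fun α => ?_)
    show toL2 (DTest α.1.1 α.1.2 (φ + ψ)) = toL2 _ + toL2 _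
    rw [map_add, map_add]
  map_smul' c φ := by
    refine Subtype.ext (PiLp.ext fun α => ?_)
    show toL2 (DTest α.1.1 α.1.2 (c • φ)) = c • toL2 _
    rw [map_smul, map_smul]

theorem comp_toH4 (α : MultiIndex 4) (φ : testSpace) :
    H4.comp α (toH4 φ) = toL2 (DTest α.1.1 α.1.2 φ) := rfl

theorem incl_toH4 (φ : testSpace) : H4.incl (toH4 φ) = toL2 φ := rfl

theorem norm_toH4 (φ : testSpace) : ‖toH4 φ‖ = N φ := by
  rw [N, ← Real.sqrt_sq (norm_nonneg (toH4 φ)), H4.norm_sq_eq]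
  congr 1
  refine Finset.sum_congr rfl fun α _ => ?_
  rw [comp_toH4, norm_toL2]
  rfl

/-- Summing the definitions of the weak derivatives of `u`, each tested with `∂^α φ`. This is the
identity that lets an operator with values only in `L²` be tested in the inner product of `H⁴`. -/
theorem inner_incl_LTest (u : H4) (φ : testSpace) :
    inner ℝ (H4.incl u) (toL2 (LTest φ)) = inner ℝ u (toH4 φ) := by
  rw [H4.inner_eq, LTest, LinearMap.sum_apply, map_sum, inner_sum]
  refine Finset.sum_congr rfl fun α _ => ?_
  rw [LinearMap.smul_apply, map_smul, real_inner_smul_right, comp_toH4]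
  exact (hasWeakDeriv_iff_inner.1 (u.hasWeakDeriv α) (DTest α.1.1 α.1.2 φ)).symm

theorem dense_range_L : (Submodule.span ℝ (range fun φ => toL2 (LTest φ))).topologicalClosure =
    ⊤ := by
  rw [Submodule.topologicalClosure_eq_top_iff, Submodule.eq_bot_iff]
  intro x hx
  refine Lp.ext ((ae_eq_zero_of_Lop (Lp.memLp x) fun φ hφ => ?_).trans
    (Lp.coeFn_zero ℝ 2 volume).symm)
  have h1 : inner ℝ x (toL2 (LTest ⟨φ, hφ⟩)) = 0 := by
    rw [real_inner_comm]
    exact hx _ (Submodule.subset_span ⟨⟨φ, hφ⟩, rfl⟩)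
  rwa [inner_toL2, coe_LTest] at h1

theorem denseRange_of_forall_inner {V F : Type*} [AddCommGroup V] [Module ℝ V]
    [NormedAddCommGroup F] [InnerProductSpace ℝ F] [CompleteSpace F] (f : V →ₗ[ℝ] F)
    (h : ∀ x : F, (∀ v, inner ℝ x (f v) = 0) → x = 0) : DenseRange f := by
  have h' : (LinearMap.range f).topologicalClosure = ⊤ := by
    rw [Submodule.topologicalClosure_eq_top_iff, Submodule.eq_bot_iff]
    intro x hx
    refine h x fun v => ?_
    rw [real_inner_comm]
    exact hx _ ⟨v, rfl⟩
  rw [← Submodule.dense_iff_topologicalClosure_eq_top] at h'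
  simpa only [DenseRange, LinearMap.coe_range] using h'

/-- By duality: an element orthogonal to all test functions in `H⁴` is, in `L²`, orthogonal to the
dense range of `LTest`. -/
theorem denseRange_toH4 : DenseRange toH4 := by
  refine denseRange_of_forall_inner toH4 fun x hx => H4.incl_injective ?_
  rw [map_zero]
  refine eq_zero_of_inner_dense dense_range_L ?_
  rintro _ ⟨φ, rfl⟩
  rw [real_inner_comm, inner_incl_LTest, hx]

/-! ### Multiplication operators on `L²` and `H⁴`. -/

section Multiplication

theorem memLp_bounded_mul {c : ℝ × ℝ → ℝ} {B : ℝ} (hc : Continuous c) (hB : ∀ p, |c p| ≤ B)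
    (f : L2) : MemLp (fun p => c p * f p) 2 volume :=
  (Lp.memLp f).of_le_mul (c := B) (hc.aestronglyMeasurable.mul (Lp.aestronglyMeasurable f))
    (Eventually.of_forall fun p => by
      rw [norm_mul]
      exact mul_le_mul_of_nonneg_right (hB p) (norm_nonneg _))

/-- Multiplication by a bounded continuous function on `L²`. -/
def mulL2 (c : ℝ × ℝ → ℝ) (hc : Continuous c) (B : ℝ) (hB : ∀ p, |c p| ≤ B) : L2 →L[ℝ] L2 :=
  LinearMap.mkContinuous
    { toFun := fun f => (memLp_bounded_mul hc hB f).toLp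
      map_add' := fun f g => by
        rw [← MemLp.toLp_add]
        refine MemLp.toLp_congr _ _ ?_
        filter_upwards [Lp.coeFn_add f g] with p hp
        simp only [Pi.add_apply, hp, mul_add]
      map_smul' := fun r f => by
        rw [← MemLp.toLp_const_smul]
        refine MemLp.toLp_congr _ _ ?_
        filter_upwards [Lp.coeFn_smul r f] with p hp
        simp only [Pi.smul_apply, hp, smul_eq_mul, RingHom.id_apply]
        ring }
    B fun f => by
      have h := n2_mul_le hB (Lp.memLp f)
      rw [n2_eq_norm_toLp (Lp.memLp f), Lp.toLp_coeFn] at h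
      exact (n2_eq_norm_toLp (memLp_bounded_mul hc hB f)).symm.trans_le h

variable {c : ℝ × ℝ → ℝ} {hc : Continuous c} {B : ℝ} {hB : ∀ p, |c p| ≤ B}

theorem coe_mulL2 (f : L2) : mulL2 c hc B hB f =ᵐ[volume] fun p => c p * f p :=
  (memLp_bounded_mul hc hB f).coeFn_toLp

theorem norm_mulL2_le (hB0 : 0 ≤ B) : ‖mulL2 c hc B hB‖ ≤ B :=
  LinearMap.mkContinuous_norm_le _ hB0 _

theorem mulL2_toL2 (hs : Smooth c) (φ : testSpace) :
    mulL2 c hc B hB (toL2 φ) = toL2 (mulTest c hs φ) := by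
  refine Lp.ext ?_
  filter_upwards [coe_mulL2 (hc := hc) (hB := hB) (toL2 φ), coe_toL2 φ,
    coe_toL2 (mulTest c hs φ)] with p h1 h2 h3
  rw [h1, h2, h3]
  rfl

end Multiplication

/-- Multiplication by the weight on `H⁴`. -/
def weightH4 (δ : ℝ) : H4 →L[ℝ] H4 :=
  (toH4 ∘ₗ mulTest (weight δ) (smooth_weight δ)).extendOfNorm toH4

section WeightH4

variable {K δ : ℝ}

theorem norm_weight_toH4_le (hC : CoeffBound K δ) (φ : testSpace) :
    ‖(toH4 ∘ₗ mulTest (weight δ) (smooth_weight δ)) φ‖ ≤ 80 * K * ‖toH4 φ‖ := by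
  rw [LinearMap.comp_apply, norm_toH4, norm_toH4]
  exact N_smooth_mul_le (smooth_weight δ) (fun i j hij => hC.weight i j (by omega)) φ.2

theorem weightH4_toH4 (hC : CoeffBound K δ) (φ : testSpace) :
    weightH4 δ (toH4 φ) = toH4 (mulTest (weight δ) (smooth_weight δ) φ) :=
  LinearMap.extendOfNorm_eq denseRange_toH4 ⟨_, norm_weight_toH4_le hC⟩ φ

theorem norm_weightH4_le (hC : CoeffBound K δ) (u : H4) : ‖weightH4 δ u‖ ≤ 80 * K * ‖u‖ :=
  LinearMap.norm_extendOfNorm_apply_le denseRange_toH4 _ (norm_weight_toH4_le hC) u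

theorem fn_weightH4 (hC : CoeffBound K δ) (u : H4) :
    (weightH4 δ u).fn =ᵐ[volume] fun p => weight δ p * u.fn p := by
  have h : H4.incl (weightH4 δ u) = mulL2 (weight δ) (smooth_weight δ).continuous 1
      (abs_weight_le_one δ) (H4.incl u) := by
    refine denseRange_toH4.induction_on u (isClosed_eq (by fun_prop) (by fun_prop)) fun φ => ?_
    rw [weightH4_toH4 hC, incl_toH4, incl_toH4, mulL2_toL2 (smooth_weight δ)]
  rw [H4.fn_eq, h]
  exact coe_mulL2 _

end WeightH4

section PointwiseProduct

/-- Multiplication of `L²` functions by test functions. -/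
def mulTestL2 : testSpace →ₗ[ℝ] L2 →L[ℝ] L2 where
  toFun φ := mulL2 φ φ.2.1.continuous (2 * N φ) (abs_D_le_N (a := 0) (b := 0) φ.2 (by norm_num))
  map_add' φ ψ := by
    ext1 f
    refine Lp.ext ?_
    rw [_root_.add_apply]
    refine (coe_mulL2 f).trans (EventuallyEq.trans ?_ (Lp.coeFn_add _ _).symm)
    refine EventuallyEq.trans (Eventually.of_forall fun p => ?_)
      ((coe_mulL2 f).add (coe_mulL2 f)).symm
    exact add_mul _ _ _
  map_smul' r φ := by
    ext1 f
    refine Lp.ext ?_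
    rw [_root_.smul_apply]
    refine (coe_mulL2 f).trans (EventuallyEq.trans ?_ (Lp.coeFn_smul _ _).symm)
    refine EventuallyEq.trans (Eventually.of_forall fun p => ?_)
      ((coe_mulL2 f).const_smul _).symm
    exact mul_assoc _ _ _

theorem coe_mulTestL2 (φ : testSpace) (f : L2) :
    mulTestL2 φ f =ᵐ[volume] fun p => (φ : ℝ × ℝ → ℝ) p * f p :=
  coe_mulL2 (hc := φ.2.1.continuous)
    (hB := abs_D_le_N (a := 0) (b := 0) φ.2 (by norm_num)) f

/-- Multiplication of `L²` functions by functions in `H⁴`. -/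
def mulH4 : H4 →L[ℝ] L2 →L[ℝ] L2 := mulTestL2.extendOfNorm toH4

theorem mulH4_toH4 (φ : testSpace) : mulH4 (toH4 φ) = mulTestL2 φ :=
  LinearMap.extendOfNorm_eq denseRange_toH4 ⟨2, fun φ => by
    rw [norm_toH4]
    exact norm_mulL2_le (hc := φ.2.1.continuous)
      (hB := abs_D_le_N (a := 0) (b := 0) φ.2 (by norm_num))
      (mul_nonneg zero_le_two (N_nonneg φ))⟩ φ

/-- Tested against `ψ`, both sides are continuous in `g` once `ψ` is moved onto `f`, so test
functions `g` are enough. -/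
theorem coe_mulH4 (g : H4) (f : L2) : mulH4 g f =ᵐ[volume] fun p => g.fn p * f p := by
  have hloc : LocallyIntegrable (fun p => g.fn p * f p) :=
    (integrable_mul_of_memLp (Lp.memLp (H4.incl g)) (Lp.memLp f)).locallyIntegrable
  refine ae_eq_of_integral_contDiff_smul_eq (L2.locallyIntegrable _) hloc fun ψ h1 h2 => ?_
  let Ψ : testSpace := ⟨ψ, h1, h2⟩
  have key : inner ℝ (mulH4 g f) (toL2 Ψ) = inner ℝ (H4.incl g) (mulTestL2 Ψ f) := by
    refine denseRange_toH4.induction_on g (isClosed_eq (by fun_prop) (by fun_prop)) fun φ => ?_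
    rw [mulH4_toH4, incl_toH4, inner_L2, inner_L2]
    refine integral_congr_ae ?_
    filter_upwards [coe_toL2 Ψ, coe_toL2 φ, coe_mulTestL2 Ψ f,
      coe_mulTestL2 φ f] with p e1 e2 e3 e4
    rw [e1, e2, e3, e4]
    ring
  rw [inner_toL2, inner_L2] at key
  simp only [smul_eq_mul]
  rw [integral_congr_ae (Eventually.of_forall fun p => mul_comm (ψ p) (mulH4 g f p))]
  refine key.trans (integral_congr_ae ?_)
  filter_upwards [coe_mulTestL2 Ψ f] with p e1
  rw [e1, H4.fn_eq]
  ring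

end PointwiseProduct

/-! ### The spatial operator on `H⁴`, and extension of the estimates by density. -/

/-- The spatial operator as a bounded operator from `H⁴` to `L²`. -/
def opL2 (δ : ℝ) (g : H4) : H4 →L[ℝ] L2 :=
  -- Here `δ⁻¹ wy = y ⟨δ(x,y)⟩⁻¹`. The operator bound obtained this way degenerates as `δ → 0`; only
  -- the coercivity has to be uniform.
  δ⁻¹ • mulL2 (wy δ) (smooth_wy δ).continuous 1 (abs_wy_le_one δ) ∘L
      H4.comp (mi 1 0 (by norm_num)) ∘L weightH4 δ -
    (ContinuousLinearMap.id ℝ L2 + mulH4 g) ∘L (ContinuousLinearMap.id ℝ L2 + mulH4 g) ∘L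
      mulL2 (weight δ) (smooth_weight δ).continuous 1 (abs_weight_le_one δ) ∘L
        H4.comp (mi 0 2 (by norm_num)) ∘L weightH4 δ

section Operator

variable {K δ : ℝ}

set_option synthInstance.maxHeartbeats 200000 in
theorem continuous_opL2 (δ : ℝ) : Continuous (opL2 δ) := by
  unfold opL2
  fun_prop

theorem coe_one_add_mulH4 (g : H4) (f : L2) :
    (ContinuousLinearMap.id ℝ L2 + mulH4 g) f =ᵐ[volume] fun p => (1 + g.fn p) * f p := by
  rw [_root_.add_apply, ContinuousLinearMap.id_apply]
  filter_upwards [Lp.coeFn_add f (mulH4 g f), coe_mulH4 g f] with p h1 h2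
  rw [h1, Pi.add_apply, h2]
  ring

theorem coe_opL2 (hδ : δ ≠ 0) (g v : H4) : opL2 δ g v =ᵐ[volume] fun p =>
    weight δ p * p.2 * H4.comp (mi 1 0 (by norm_num)) (weightH4 δ v) p -
      weight δ p * (1 + g.fn p) ^ 2 * H4.comp (mi 0 2 (by norm_num)) (weightH4 δ v) p := by
  set X := H4.comp (mi 1 0 (by norm_num)) (weightH4 δ v)
  set Y := H4.comp (mi 0 2 (by norm_num)) (weightH4 δ v)
  set W := mulL2 (weight δ) (smooth_weight δ).continuous 1 (abs_weight_le_one δ) Y with hW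
  set Z := mulL2 (wy δ) (smooth_wy δ).continuous 1 (abs_wy_le_one δ) X with hZ
  have e : opL2 δ g v = δ⁻¹ • Z - (ContinuousLinearMap.id ℝ L2 + mulH4 g)
    ((ContinuousLinearMap.id ℝ L2 + mulH4 g) W) := rfl
  rw [e]
  filter_upwards [Lp.coeFn_sub (δ⁻¹ • Z) ((ContinuousLinearMap.id ℝ L2 + mulH4 g)
    ((ContinuousLinearMap.id ℝ L2 + mulH4 g) W)), Lp.coeFn_smul δ⁻¹ Z,
    coe_one_add_mulH4 g ((ContinuousLinearMap.id ℝ L2 + mulH4 g) W), coe_one_add_mulH4 g W,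
    coe_mulL2 (hc := (smooth_weight δ).continuous) (hB := abs_weight_le_one δ) Y,
    coe_mulL2 (hc := (smooth_wy δ).continuous) (hB := abs_wy_le_one δ) X]
    with p h1 h2 h3 h4 h5 h6
  rw [h1, Pi.sub_apply, h2, Pi.smul_apply, h3, h4, h5, h6, wy, smul_eq_mul]
  field_simp

theorem spatialOp_ae_eq (hC : CoeffBound K δ) (hδ : δ ≠ 0) (g v : H4) :
    spatialOp δ g.fn v.fn =ᵐ[volume] opL2 δ g v := by
  have h : ∀ {a b : ℕ} (hab : a + b ≤ 4), weakDeriv a b (fun q => weight δ q * v.fn q) =ᵐ[volume]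
      H4.comp (mi a b hab) (weightH4 δ v) := fun hab =>
    (((weightH4 δ v).hasWeakDeriv_mi hab).congr (fn_weightH4 hC v)
      EventuallyEq.rfl).weakDeriv_ae_eq
  filter_upwards [coe_opL2 hδ g v, h (a := 1) (b := 0) (by norm_num),
    h (a := 0) (b := 2) (by norm_num)] with p h1 h2 h3
  rw [h1, spatialOp, h2, h3]

theorem opL2_toH4 (hC : CoeffBound K δ) (hδ : δ ≠ 0) (γ u : testSpace) :
    opL2 δ (toH4 γ) (toH4 u) = toL2 ⟨energyOp δ ((2 : ℝ) • (γ : ℝ × ℝ → ℝ) + γ * γ) u,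
      u.2.energyOp ((γ.2.const_smul 2).add (γ.2.mul γ.2))⟩ := by
  refine Lp.ext ?_
  have h := coe_opL2 hδ (toH4 γ) (toH4 u)
  rw [weightH4_toH4 hC, comp_toH4, comp_toH4] at h
  filter_upwards [h, coe_toL2 γ, coe_toL2 (DTest 1 0 (mulTest (weight δ) (smooth_weight δ) u)),
    coe_toL2 (DTest 0 2 (mulTest (weight δ) (smooth_weight δ) u)),
    coe_toL2 ⟨energyOp δ ((2 : ℝ) • (γ : ℝ × ℝ → ℝ) + γ * γ) u,
      u.2.energyOp ((γ.2.const_smul 2).add (γ.2.mul γ.2))⟩] with p h1 h2 h3 h4 h5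
  rw [h5]
  refine h1.trans ?_
  have h2' : (toH4 γ).fn p = (γ : ℝ × ℝ → ℝ) p := h2
  have h3' : toL2 (DTest (mi (k := 4) 1 0 (by norm_num)).1.1 (mi (k := 4) 1 0 (by norm_num)).1.2
    (mulTest (weight δ) (smooth_weight δ) u)) p = dx (weight δ * u) p := h3
  have h4' : toL2 (DTest (mi (k := 4) 0 2 (by norm_num)).1.1 (mi (k := 4) 0 2 (by norm_num)).1.2
    (mulTest (weight δ) (smooth_weight δ) u)) p = dy (dy (weight δ * u)) p := h4
  rw [h2', h3', h4']
  simp only [energyOp, Pi.sub_apply, Pi.mul_apply, Pi.add_apply, Pi.smul_apply, smul_eq_mul]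
  ring

/-- The function is `m = (1 + γ)² - 1`, and `2/50 + 160/50² < 1/4`. This fixes the admissible size
of `g`. -/
theorem N_two_smul_add_sq_le {γ : testSpace} (h : ‖toH4 γ‖ < 1 / 50) :
    N ((2 : ℝ) • (γ : ℝ × ℝ → ℝ) + γ * γ) ≤ 1 / 4 := by
  have h1 : toH4 ⟨(2 : ℝ) • (γ : ℝ × ℝ → ℝ) + γ * γ, (γ.2.const_smul 2).add (γ.2.mul γ.2)⟩ =
      (2 : ℝ) • toH4 γ + toH4 ⟨γ * γ, γ.2.mul γ.2⟩ := by
    rw [← map_smul, ← map_add]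
    rfl
  have h2 := norm_toH4 ⟨(2 : ℝ) • (γ : ℝ × ℝ → ℝ) + γ * γ, (γ.2.const_smul 2).add (γ.2.mul γ.2)⟩
  rw [h1] at h2
  refine h2.symm.trans_le ((norm_add_le _ _).trans ?_)
  rw [norm_smul, norm_toH4 ⟨γ * γ, γ.2.mul γ.2⟩, Real.norm_two]
  have h3 := N_mul_le γ.2 γ.2
  rw [← norm_toH4] at h3
  have h4 : ‖toH4 γ‖ * ‖toH4 γ‖ ≤ 1 / 50 * (1 / 50) :=
    mul_le_mul h.le h.le (norm_nonneg _) (by norm_num)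
  linarith

/-- Pairing with `LTest u` in `L²` is pairing with `u` in `H⁴`, that is, the sum estimated in
`sum_ip_energyOp_ge`. -/
theorem opL2_coercive_of_test (hK : 1 ≤ K) (hC : CoeffBound K δ) (hδ : δ ≠ 0) {γ : testSpace}
    (hγ : ‖toH4 γ‖ < 1 / 50) (u : testSpace) :
    1 / 4 * ‖toH4 (DTest 0 1 (mulTest (weight δ) (smooth_weight δ) u))‖ ^ 2 -
      (12000 * K) ^ 2 * 2 * ‖toH4 u‖ ^ 2 ≤
      inner ℝ (opL2 δ (toH4 γ) (toH4 u)) (toL2 (LTest u)) := by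
  rw [opL2_toH4 hC hδ, ← incl_toH4, inner_incl_LTest, H4.inner_eq, norm_toH4, norm_toH4]
  refine (sum_ip_energyOp_ge hK hC u.2 ((γ.2.const_smul 2).add (γ.2.mul γ.2))
    (N_two_smul_add_sq_le hγ)).trans_eq (Finset.sum_congr rfl fun α _ => ?_)
  rw [comp_toH4, comp_toH4, inner_toL2_toL2]
  rfl

/-- Failure of the inequality, together with `‖g‖ < 1 / 50`, is an open condition on `g`, so it
would already occur for a test function. The strict bound on `g` serves this. -/
theorem opL2_coercive (hK : 1 ≤ K) (hC : CoeffBound K δ) (hδ : δ ≠ 0) {g : H4}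
    (hg : ‖g‖ < 1 / 50) (u : testSpace) :
    1 / 4 * ‖toH4 (DTest 0 1 (mulTest (weight δ) (smooth_weight δ) u))‖ ^ 2 -
      (12000 * K) ^ 2 * 2 * ‖toH4 u‖ ^ 2 ≤ inner ℝ (opL2 δ g (toH4 u)) (toL2 (LTest u)) := by
  by_contra! hlt
  have hc := continuous_opL2 δ
  obtain ⟨γ, h1, h2⟩ := denseRange_toH4.exists_mem_open
    ((isOpen_lt (continuous_norm (E := H4)) (continuous_const (y := (1 / 50 : ℝ)))).inter
      (isOpen_lt (f := fun g : H4 => inner ℝ (opL2 δ g (toH4 u)) (toL2 (LTest u)))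
        (by fun_prop) continuous_const)) ⟨g, hg, hlt⟩
  exact absurd h2 (not_lt.2 (opL2_coercive_of_test hK hC hδ h1 u))

theorem opL2_inner_incl_ge (hC : CoeffBound K δ) (hδ : δ ≠ 0) {g : H4}
    (hg : ‖g‖ < 1 / 50) (v : H4) : -‖H4.incl v‖ ^ 2 ≤ inner ℝ (opL2 δ g v) (H4.incl v) := by
  refine denseRange_toH4.induction_on v (isClosed_le (by fun_prop) (by fun_prop)) fun u => ?_
  by_contra! hlt
  have hc := continuous_opL2 δ
  obtain ⟨γ, h1, h2⟩ := denseRange_toH4.exists_mem_open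
    ((isOpen_lt (continuous_norm (E := H4)) (continuous_const (y := (1 / 50 : ℝ)))).inter
      (isOpen_lt (f := fun g : H4 => inner ℝ (opL2 δ g (toH4 u)) (H4.incl (toH4 u)))
        (by fun_prop) continuous_const)) ⟨g, hg, hlt⟩
  have h3 : inner ℝ (opL2 δ (toH4 γ) (toH4 u)) (H4.incl (toH4 u)) < -‖H4.incl (toH4 u)‖ ^ 2 := h2
  refine absurd h3 (not_lt.2 ?_)
  rw [opL2_toH4 hC hδ, incl_toH4, norm_toL2, inner_toL2_toL2]
  exact ip_energyOp_self_ge u.2 ((γ.2.const_smul 2).add (γ.2.mul γ.2)) (N_two_smul_add_sq_le h1)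

end Operator

/-! ### Space-time test functions as curves in `L²`. -/

section Slices

variable {ψ : ℝ × (ℝ × ℝ) → ℝ}

/-- The slice `ψ(t, ·)` of a test function on space-time. -/
def slice (h1 : ContDiff ℝ ∞ ψ) (h2 : HasCompactSupport ψ) (t : ℝ) : testSpace :=
  ⟨fun p => ψ (t, p), h1.comp (contDiff_prodMk_right t),
    HasCompactSupport.intro (h2.isCompact.image continuous_snd) fun p hp =>
      image_eq_zero_of_notMem_tsupport fun h => hp ⟨(t, p), h, rfl⟩⟩

theorem norm_toL2_le {f : testSpace} {s : Set (ℝ × ℝ)} (hs : IsCompact s)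
    (hf : Function.support (f : ℝ × ℝ → ℝ) ⊆ s) {r : ℝ}
    (hr : ∀ p, |(f : ℝ × ℝ → ℝ) p| ≤ r) : ‖toL2 f‖ ≤ r * √(volume s).toReal := by
  have hr0 : 0 ≤ r := (abs_nonneg _).trans (hr 0)
  rw [norm_toL2, n2, ← eLpNorm_restrict_eq_of_support_subset hf]
  have h : eLpNorm (f : ℝ × ℝ → ℝ) 2 (volume.restrict s) ≤
      (volume.restrict s) univ ^ (2 : ℝ≥0∞).toReal⁻¹ * ENNReal.ofReal r :=
    eLpNorm_le_of_ae_bound (Eventually.of_forall hr)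
  have hfin : (volume s) ^ (2 : ℝ≥0∞).toReal⁻¹ ≠ ⊤ :=
    ENNReal.rpow_ne_top_of_nonneg (by simp) hs.measure_lt_top.ne
  rw [Measure.restrict_apply_univ] at h
  refine (ENNReal.toReal_mono (ENNReal.mul_ne_top hfin ENNReal.ofReal_ne_top) h).trans_eq ?_
  rw [ENNReal.toReal_mul, ENNReal.toReal_ofReal hr0, ← ENNReal.toReal_rpow, Real.sqrt_eq_rpow,
    mul_comm]
  norm_num

theorem support_slice_subset (h1 : ContDiff ℝ ∞ ψ) (h2 : HasCompactSupport ψ) (t : ℝ) :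
    Function.support (slice h1 h2 t : ℝ × ℝ → ℝ) ⊆ Prod.snd '' tsupport ψ :=
  fun p hp => ⟨(t, p), subset_tsupport _ hp, rfl⟩

theorem exists_lipschitz_slice (h1 : ContDiff ℝ ∞ ψ) (h2 : HasCompactSupport ψ) :
    ∃ L : ℝ, 0 ≤ L ∧ ∀ s t p, |ψ (s, p) - ψ (t, p)| ≤ L * |s - t| := by
  obtain ⟨L, hL⟩ := ContDiff.lipschitzWith_of_hasCompactSupport h2 h1 (by simp)
  refine ⟨L, L.2, fun s t p => ?_⟩
  have := hL.dist_le_mul (s, p) (t, p)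
  simpa [Prod.dist_eq, Real.dist_eq] using this

theorem continuous_slice (h1 : ContDiff ℝ ∞ ψ) (h2 : HasCompactSupport ψ) :
    Continuous fun t => toL2 (slice h1 h2 t) := by
  obtain ⟨L, hL0, hL⟩ := exists_lipschitz_slice h1 h2
  have hK := h2.isCompact.image continuous_snd
  refine (LipschitzWith.of_dist_le_mul (K := NNReal.mk
    (L * √(volume (Prod.snd '' tsupport ψ)).toReal) (by positivity)) fun s t => ?_).continuous
  rw [dist_eq_norm, ← map_sub]
  refine (norm_toL2_le hK ?_ (hL s t)).trans_eq ?_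
  · exact (Function.support_sub _ _).trans
      (union_subset (support_slice_subset h1 h2 s) (support_slice_subset h1 h2 t))
  · rw [Real.dist_eq, NNReal.coe_mk]
    ring

theorem bddMeas_slice (h1 : ContDiff ℝ ∞ ψ) (h2 : HasCompactSupport ψ) :
    ∃ M, BddMeas M fun t => toL2 (slice h1 h2 t) := by
  obtain ⟨C, hC⟩ := h1.continuous.bounded_above_of_compact_support h2
  exact ⟨C * √(volume (Prod.snd '' tsupport ψ)).toReal,
    (continuous_slice h1 h2).aestronglyMeasurable, Eventually.of_forall fun t =>
      norm_toL2_le (h2.isCompact.image continuous_snd) (support_slice_subset h1 h2 t)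
        fun p => hC (t, p)⟩

/-- The time derivative of a function on space-time. -/
def dt (ψ : ℝ × (ℝ × ℝ) → ℝ) (q : ℝ × (ℝ × ℝ)) : ℝ := fderiv ℝ ψ q (1, 0)

theorem contDiff_dt (h1 : ContDiff ℝ ∞ ψ) : ContDiff ℝ ∞ (dt ψ) :=
  (h1.fderiv_right (m := ∞) (by simp)).clm_apply contDiff_const

theorem hasCompactSupport_dt (h2 : HasCompactSupport ψ) : HasCompactSupport (dt ψ) :=
  h2.fderiv_apply (𝕜 := ℝ) _

theorem hasDerivAt_dt (h1 : ContDiff ℝ ∞ ψ) (t : ℝ) (p : ℝ × ℝ) :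
    HasDerivAt (fun s => ψ (s, p)) (dt ψ (t, p)) t := by
  have h : HasFDerivAt ψ (fderiv ℝ ψ (t, p)) (t, p) :=
    (h1.differentiable (by simp) (t, p)).hasFDerivAt
  have h' : HasDerivAt (fun s : ℝ => (s, p)) (1, 0) t :=
    (hasDerivAt_id t).prodMk (hasDerivAt_const _ _)
  exact h.comp_hasDerivAt t h'

/-- The time derivative is Lipschitz in time uniformly in space, so the Taylor remainder is `O(|s -
t|²)` uniformly; it lives in a fixed compact set, hence is as small in `L²`. -/
theorem hasDerivAt_slice (h1 : ContDiff ℝ ∞ ψ) (h2 : HasCompactSupport ψ) (t : ℝ) :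
    HasDerivAt (fun t => toL2 (slice h1 h2 t))
      (toL2 (slice (contDiff_dt h1) (hasCompactSupport_dt h2) t)) t := by
  obtain ⟨L, hL0, hL⟩ := exists_lipschitz_slice (contDiff_dt h1) (hasCompactSupport_dt h2)
  have hK := h2.isCompact.image continuous_snd
  set m := √(volume (Prod.snd '' tsupport ψ)).toReal with hm
  have key : ∀ s p, |ψ (s, p) - ψ (t, p) - (s - t) * dt ψ (t, p)| ≤ L * |s - t| * |s - t| := by
    intro s p
    have hd : ∀ r ∈ uIcc t s, HasDerivWithinAt (fun r => ψ (r, p) - r * dt ψ (t, p))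
        (dt ψ (r, p) - 1 * dt ψ (t, p)) (uIcc t s) r := fun r _ =>
      ((hasDerivAt_dt h1 r p).sub ((hasDerivAt_id r).mul_const _)).hasDerivWithinAt
    have := (convex_uIcc t s).norm_image_sub_le_of_norm_hasDerivWithin_le (C := L * |s - t|) hd
      (fun r hr => by
        rw [one_mul]
        exact (hL r t p).trans (mul_le_mul_of_nonneg_left (abs_sub_left_of_mem_uIcc hr) hL0))
      left_mem_uIcc right_mem_uIcc
    rw [Real.norm_eq_abs, Real.norm_eq_abs] at this
    convert this using 2
    ring
  rw [hasDerivAt_iff_isLittleO]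
  refine Asymptotics.IsBigO.trans_isLittleO (g := fun s => |s - t| * |s - t|) ?_ ?_
  · refine Asymptotics.IsBigO.of_bound (L * m) (Eventually.of_forall fun s => ?_)
    rw [← map_sub, ← map_smul, ← map_sub]
    refine (norm_toL2_le hK ?_ (key s)).trans_eq ?_
    · refine (Function.support_sub _ _).trans (union_subset ((Function.support_sub _ _).trans
        (union_subset (support_slice_subset h1 h2 s) (support_slice_subset h1 h2 t))) ?_)
      refine (Function.support_const_smul_subset (s - t) _).trans
        ((support_slice_subset _ _ t).trans (image_mono ?_))
      exact tsupport_fderiv_apply_subset ℝ _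
    · rw [Real.norm_of_nonneg (by positivity)]
      ring
  · have h0 : Tendsto (fun s : ℝ => |s - t|) (𝓝 t) (𝓝 0) := by
      have : Continuous fun s : ℝ => |s - t| := by fun_prop
      simpa using this.tendsto t
    have := (Asymptotics.isLittleO_one_iff ℝ).2 h0
    simpa using this.mul_isBigO (Asymptotics.isBigO_abs_left.2
      (Asymptotics.isBigO_refl (fun s : ℝ => s - t) (𝓝 t)))

theorem slice_eq_add_integral (h1 : ContDiff ℝ ∞ ψ) (h2 : HasCompactSupport ψ) (t : ℝ) :
    toL2 (slice h1 h2 t) = toL2 (slice h1 h2 0) +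
      ∫ s in (0 : ℝ)..t, toL2 (slice (contDiff_dt h1) (hasCompactSupport_dt h2) s) := by
  rw [intervalIntegral.integral_eq_sub_of_hasDerivAt (fun s _ => hasDerivAt_slice h1 h2 s)
    ((continuous_slice _ _).intervalIntegrable _ _)]
  abel

end Slices

/-! ### The weak formulation and the equation integrated in time. -/

theorem BddMeas.mono {E : Type*} [NormedAddCommGroup E] {M M' : ℝ} {m : ℝ → E}
    (h : BddMeas M m) (hM : M ≤ M') : BddMeas M' m :=
  ⟨h.aesm, h.bound.mono fun _ ht => ht.trans hM⟩

section WeakFormulation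

variable {T K δ : ℝ} {g v w : ℝ → H4} {v₀ : H4}

/-- The spatial operator along a path in `H⁴`, extended by zero outside the time interval. -/
def opPath (T δ : ℝ) (g w : ℝ → H4) : ℝ → L2 :=
  (Ioo 0 T).indicator fun s => opL2 δ (g s) (w s)

theorem exists_norm_opL2_le (δ R : ℝ) : ∃ B, 0 ≤ B ∧ ∀ g : H4, ‖g‖ ≤ R → ‖opL2 δ g‖ ≤ B := by
  set P := δ⁻¹ • mulL2 (wy δ) (smooth_wy δ).continuous 1 (abs_wy_le_one δ) ∘L
      H4.comp (mi 1 0 (by norm_num)) ∘L weightH4 δ with hP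
  set Q := mulL2 (weight δ) (smooth_weight δ).continuous 1 (abs_weight_le_one δ) ∘L
        H4.comp (mi 0 2 (by norm_num)) ∘L weightH4 δ with hQ
  refine ⟨‖P‖ + (1 + ‖mulH4‖ * |R|) * ((1 + ‖mulH4‖ * |R|) * ‖Q‖), by positivity, fun g hg => ?_⟩
  have h1 : ‖ContinuousLinearMap.id ℝ L2 + mulH4 g‖ ≤ 1 + ‖mulH4‖ * |R| :=
    (norm_add_le _ _).trans (add_le_add ContinuousLinearMap.norm_id_le
      ((mulH4.le_opNorm g).trans (mul_le_mul_of_nonneg_left (hg.trans (le_abs_self R))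
        (by positivity))))
  have e : opL2 δ g = P - (ContinuousLinearMap.id ℝ L2 + mulH4 g) ∘L
    ((ContinuousLinearMap.id ℝ L2 + mulH4 g) ∘L Q) := rfl
  rw [e]
  refine (norm_sub_le P _).trans (add_le_add le_rfl ?_)
  refine (ContinuousLinearMap.opNorm_comp_le _ _).trans
    (mul_le_mul h1 ?_ (ContinuousLinearMap.opNorm_nonneg _) (by positivity))
  exact (ContinuousLinearMap.opNorm_comp_le _ _).trans
    (mul_le_mul_of_nonneg_right h1 (ContinuousLinearMap.opNorm_nonneg _))

theorem exists_ae_norm_le {E : Type*} [NormedAddCommGroup E] {w : ℝ → E}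
    (hw : MemLp w ⊤ (timeMeasure T)) : ∃ M, 0 ≤ M ∧ ∀ᵐ s ∂(timeMeasure T), ‖w s‖ ≤ M := by
  refine ⟨(eLpNorm w ⊤ (timeMeasure T)).toReal, ENNReal.toReal_nonneg, ?_⟩
  have h := ae_le_eLpNormEssSup (f := w) (μ := timeMeasure T)
  rw [← eLpNorm_exponent_top] at h
  filter_upwards [h] with s hs
  rw [← toReal_enorm]
  exact ENNReal.toReal_mono hw.2.ne hs

theorem bddMeas_opPath (δ : ℝ) (hg : MemLp g ⊤ (timeMeasure T)) (hw : MemLp w ⊤ (timeMeasure T)) :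
    ∃ M, BddMeas M (opPath T δ g w) := by
  obtain ⟨R, -, hR⟩ := exists_ae_norm_le hg
  obtain ⟨M, hM0, hM⟩ := exists_ae_norm_le hw
  obtain ⟨B, hB0, hB⟩ := exists_norm_opL2_le δ R
  refine ⟨B * M, (aestronglyMeasurable_indicator_iff measurableSet_Ioo).2 ?_, ?_⟩
  · have h1 : AEStronglyMeasurable (fun s => opL2 δ (g s)) (timeMeasure T) :=
      (continuous_opL2 δ).comp_aestronglyMeasurable hg.1
    exact (isBoundedBilinearMap_apply (𝕜 := ℝ) (E := H4)
      (F := L2)).continuous.comp_aestronglyMeasurable (h1.prodMk hw.1)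
  · have h2 := (ae_restrict_iff' measurableSet_Ioo).1 (hR.and hM)
    filter_upwards [h2] with s hs
    by_cases h : s ∈ Ioo 0 T
    · rw [opPath, indicator_of_mem h]
      exact ((opL2 δ (g s)).le_opNorm _).trans
        (mul_le_mul (hB _ (hs h).1) (hs h).2 (norm_nonneg _) hB0)
    · rw [opPath, indicator_of_notMem h, norm_zero]
      positivity

theorem integral_weak_eq (hC : CoeffBound K δ) (hδ : δ ≠ 0) (g v : H4) (χ ψ : testSpace) :
    ∫ p, (-(v.fn p * (ψ : ℝ × ℝ → ℝ) p) + spatialOp δ g.fn v.fn p * (χ : ℝ × ℝ → ℝ) p) =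
      inner ℝ (opL2 δ g v) (toL2 χ) - inner ℝ (H4.incl v) (toL2 ψ) := by
  have h1 := integrable_mul_of_memLp (Lp.memLp (opL2 δ g v)) χ.2.memLp
  have h2 := integrable_mul_of_memLp (Lp.memLp (H4.incl v)) ψ.2.memLp
  rw [inner_toL2, inner_toL2, ← integral_sub h1 h2]
  refine integral_congr_ae ?_
  filter_upwards [spatialOp_ae_eq hC hδ g v] with p hp
  rw [hp, H4.fn_eq]
  ring

/-- The defect of the weak formulation in terms of the integrated equation. -/
theorem weak_defect (hC : CoeffBound K δ) (hδ : δ ≠ 0) (hT : 0 < T)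
    (hg : MemLp g ⊤ (timeMeasure T)) (hw : MemLp w ⊤ (timeMeasure T)) {φ : ℝ × (ℝ × ℝ) → ℝ}
    (h1 : ContDiff ℝ ∞ φ) (h2 : HasCompactSupport φ) (h3 : tsupport φ ⊆ Iio T ×ˢ univ) :
    (∫ t in Ioo 0 T, ∫ p : ℝ × ℝ, (-((w t).fn p * deriv (fun s => φ (s, p)) t)
          + spatialOp δ (g t).fn (w t).fn p * φ (t, p))) =
      (∫ p : ℝ × ℝ, weight δ p * v₀.fn p * φ (0, p)) +
        ∫ t in Ioo 0 T, inner ℝ (H4.incl (weightH4 δ v₀) - (∫ s in (0 : ℝ)..t, opPath T δ g w s) -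
          H4.incl (w t)) (toL2 (slice (contDiff_dt h1) (hasCompactSupport_dt h2) t)) := by
  obtain ⟨M, hM⟩ := bddMeas_opPath δ hg hw
  obtain ⟨M', hM'⟩ := bddMeas_slice (contDiff_dt h1) (hasCompactSupport_dt h2)
  have hneg : BddMeas M fun s => -opPath T δ g w s :=
    ⟨hM.aesm.neg, hM.bound.mono fun s hs => by rwa [norm_neg]⟩
  set Φ : ℝ → L2 := fun t => toL2 (slice h1 h2 t) with hΦ
  set Φ' : ℝ → L2 := fun t => toL2 (slice (contDiff_dt h1) (hasCompactSupport_dt h2) t) with hΦ'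
  set ν := H4.incl (weightH4 δ v₀) with hν
  set V : ℝ → L2 := fun t => ν - ∫ s in (0 : ℝ)..t, opPath T δ g w s with hV
  -- Integration by parts in time between `V`, the value that the integrated equation prescribes for
  -- `w`, and the test curve `Φ`. The boundary term at `0` is the initial datum; the one at `T`
  -- vanishes by the support of `φ`.
  have hprod := inner_primitive (hneg.mono (le_max_left M M'))
    (hM'.mono (le_max_right M M')) ν (Φ 0) (V := V) (W := Φ)
    (fun t => by simp only [hV, intervalIntegral.integral_neg, sub_eq_add_neg])
    (slice_eq_add_integral h1 h2) T
  have hΦT : Φ T = 0 := by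
    have : slice h1 h2 T = 0 := by
      refine Subtype.ext (funext fun p => ?_)
      exact image_eq_zero_of_notMem_tsupport (f := φ) (x := (T, p)) fun h =>
        lt_irrefl T (h3 h).1
    rw [hΦ]
    simp only [this, map_zero]
  have hVc : Continuous V := continuous_const.sub (by
    have := hM.continuous_primitive 0 0
    simpa using this)
  have hΦc : Continuous Φ := continuous_slice h1 h2
  have hΦc' : Continuous Φ' := continuous_slice _ _
  have hrhs : ∫ p : ℝ × ℝ, weight δ p * v₀.fn p * φ (0, p) = inner ℝ ν (Φ 0) := by
    rw [hΦ, inner_toL2]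
    refine integral_congr_ae ?_
    filter_upwards [fn_weightH4 hC v₀] with p hp
    rw [← hp]
    rfl
  have hlhs : ∀ t ∈ Ioo 0 T, ∫ p : ℝ × ℝ, (-((w t).fn p * deriv (fun s => φ (s, p)) t)
      + spatialOp δ (g t).fn (w t).fn p * φ (t, p)) =
      inner ℝ (opPath T δ g w t) (Φ t) - inner ℝ (H4.incl (w t)) (Φ' t) := by
    intro t ht
    rw [opPath, indicator_of_mem ht, ← integral_weak_eq hC hδ]
    simp only [(hasDerivAt_dt h1 t _).deriv]
    rfl
  rw [hΦT, inner_zero_right, intervalIntegral.integral_of_le hT.le,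
    integral_Ioc_eq_integral_Ioo] at hprod
  rw [setIntegral_congr_fun measurableSet_Ioo hlhs, hrhs]
  obtain ⟨R, hR0, hR⟩ := exists_ae_norm_le hw
  have hwm : AEStronglyMeasurable (fun t => H4.incl (w t)) (timeMeasure T) :=
    H4.incl.continuous.comp_aestronglyMeasurable hw.1
  have i1 : IntegrableOn (fun t => inner ℝ (opPath T δ g w t) (Φ t)) (Ioo 0 T) := by
    have := intervalIntegrable_inner hM hΦc 0 T
    exact (integrableOn_Ioc_iff_integrableOn_Ioo).1
      ((intervalIntegrable_iff_integrableOn_Ioc_of_le hT.le).1 this)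
  have i2 : IntegrableOn (fun t => inner ℝ (V t) (Φ' t)) (Ioo 0 T) :=
    ((hVc.inner hΦc').integrableOn_Icc (a := 0) (b := T)).mono_set Ioo_subset_Icc_self
  have i3 : IntegrableOn (fun t => inner ℝ (H4.incl (w t)) (Φ' t)) (Ioo 0 T) := by
    refine Integrable.of_bound (hwm.inner hΦc'.aestronglyMeasurable) (R * M') ?_
    filter_upwards [hR, ae_restrict_of_ae hM'.bound] with t ht ht'
    refine (norm_inner_le_norm _ _).trans (mul_le_mul ?_ ht' (norm_nonneg _) hR0)
    exact (H4.norm_comp_le _ _).trans ht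
  have e1 : ∫ t in Ioo 0 T, inner ℝ (V t - H4.incl (w t)) (Φ' t) =
      (∫ t in Ioo 0 T, inner ℝ (V t) (Φ' t)) - ∫ t in Ioo 0 T, inner ℝ (H4.incl (w t)) (Φ' t) := by
    rw [← integral_sub i2 i3]
    simp only [inner_sub_left]
  have e2 : ∫ t in Ioo 0 T, (inner ℝ (-opPath T δ g w t) (Φ t) + inner ℝ (Φ' t) (V t)) =
      (∫ t in Ioo 0 T, inner ℝ (V t) (Φ' t)) -
        ∫ t in Ioo 0 T, inner ℝ (opPath T δ g w t) (Φ t) := by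
    rw [← integral_sub i2 i1]
    refine integral_congr_ae (Eventually.of_forall fun t => ?_)
    simp only [inner_neg_left]
    rw [real_inner_comm (V t)]
    ring
  rw [integral_sub i1 i3, e1]
  rw [e2] at hprod
  linarith

theorem isWeakSolution_of_integral_eq (hC : CoeffBound K δ) (hδ : δ ≠ 0) (hT : 0 < T)
    (hg : MemLp g ⊤ (timeMeasure T)) (hw : MemLp w ⊤ (timeMeasure T))
    (h : ∀ t ∈ Ioo 0 T, H4.incl (w t) =
      H4.incl (weightH4 δ v₀) - ∫ s in (0 : ℝ)..t, opPath T δ g w s) :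
    IsWeakSolution T δ g v₀ w := by
  refine ⟨hw, fun φ h1 h2 h3 => ?_⟩
  rw [weak_defect hC hδ hT hg hw h1 h2 h3 (v₀ := v₀),
    setIntegral_congr_fun (g := fun _ => (0 : ℝ)) measurableSet_Ioo fun t ht => by
      simp only [← h t ht, sub_self, inner_zero_left]]
  simp

end WeakFormulation

/-! ### From the weak formulation to the integrated equation, and uniqueness. -/

section Uniqueness

variable {T K δ : ℝ} {g v w : ℝ → H4} {v₀ : H4}

/-- Every test function on `(0, T)` is there the derivative of a test function on `[0, T)`. -/
theorem exists_primitive_test (hT : 0 < T) {ζ : ℝ → ℝ} (h1 : ContDiff ℝ ∞ ζ)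
    (h2 : HasCompactSupport ζ) (h3 : tsupport ζ ⊆ Ioo 0 T) :
    ∃ η : ℝ → ℝ, ContDiff ℝ ∞ η ∧ HasCompactSupport η ∧ tsupport η ⊆ Iio T ∧
      ∀ t ∈ Ioo 0 T, HasDerivAt η (ζ t) t := by
  obtain ⟨b, hbT, hb⟩ : ∃ b < T, ∀ t ∈ tsupport ζ, t ≤ b := by
    rcases (tsupport ζ).eq_empty_or_nonempty with he | hne
    · exact ⟨0, hT, by simp [he]⟩
    · obtain ⟨b, hb, hmax⟩ := h2.isCompact.exists_isMaxOn hne continuousOn_id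
      exact ⟨b, (h3 hb).2, fun t ht => hmax ht⟩
  -- Starting the integral at `T` makes the primitive vanish near `T`; its value at `0` is free.
  set F : ℝ → ℝ := fun t => ∫ s in T..t, ζ s with hF
  have hdF : ∀ t, HasDerivAt F (ζ t) t := fun t =>
    intervalIntegral.integral_hasDerivAt_right (h1.continuous.intervalIntegrable _ _)
      (h1.continuous.stronglyMeasurableAtFilter _ _) h1.continuous.continuousAt
  have hFs : ContDiff ℝ ∞ F := by
    rw [contDiff_infty_iff_deriv]
    refine ⟨fun t => (hdF t).differentiableAt, ?_⟩
    rwa [funext fun t => (hdF t).deriv]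
  have hF0 : ∀ t, b < t → F t = 0 := fun t ht => by
    refine intervalIntegral.integral_zero_ae (Eventually.of_forall fun s hs => ?_)
    refine image_eq_zero_of_notMem_tsupport fun h => ?_
    have := hb s h
    rcases le_total T t with h' | h'
    · rw [uIoc_of_le h'] at hs
      exact absurd hs.1 (by linarith)
    · rw [uIoc_of_ge h'] at hs
      exact absurd hs.1 (by linarith)
  -- The primitive may be a nonzero constant for early times. This cutoff equals `1` on `[-T/2,
  -- 3T/2]` and truncates it only outside `[0, T]`.
  let κ : ContDiffBump (T / 2) := ⟨T, 2 * T, hT, by linarith⟩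
  refine ⟨fun t => κ t * F t, κ.contDiff.mul hFs, κ.hasCompactSupport.mul_right, ?_, ?_⟩
  · refine (closure_minimal (fun t ht => ?_) isClosed_Iic).trans (Iic_subset_Iio.2 hbT)
    by_contra hlt
    exact ht (by simp only [hF0 t (not_le.1 hlt), mul_zero])
  · intro t ht
    refine (hdF t).congr_of_eventuallyEq ?_
    filter_upwards [isOpen_Ioo.mem_nhds ht] with s hs
    rw [κ.one_of_mem_closedBall, one_mul]
    rw [Metric.mem_closedBall, Real.dist_eq, abs_le]
    constructor <;> linarith [hs.1, hs.2]

/-- A du Bois-Reymond argument: product test functions `η(t) X(p)` with `η' = ζ` show that the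
defect integrated against `ζ` is orthogonal to every `X` in the range of `LTest`, which is dense in
`L²`. -/
theorem IsWeakSolution.integral_eq (hC : CoeffBound K δ) (hδ : δ ≠ 0) (hT : 0 < T)
    (hg : MemLp g ⊤ (timeMeasure T)) (hw : IsWeakSolution T δ g v₀ w) :
    ∀ᵐ t ∂(timeMeasure T), H4.incl (w t) =
      H4.incl (weightH4 δ v₀) - ∫ s in (0 : ℝ)..t, opPath T δ g w s := by
  obtain ⟨M, hM⟩ := bddMeas_opPath δ hg hw.memLp
  set V : ℝ → L2 := fun t =>
    H4.incl (weightH4 δ v₀) - ∫ s in (0 : ℝ)..t, opPath T δ g w s with hV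
  have hVc : Continuous V := continuous_const.sub (by
    have := hM.continuous_primitive 0 0
    simpa using this)
  have hwi : IntegrableOn (fun t => H4.incl (w t)) (Ioo 0 T) := by
    obtain ⟨R, hR0, hR⟩ := exists_ae_norm_le hw.memLp
    exact Integrable.of_bound (H4.incl.continuous.comp_aestronglyMeasurable hw.memLp.1) R
      (hR.mono fun t ht => (H4.norm_comp_le _ _).trans ht)
  have hDi : IntegrableOn (fun t => V t - H4.incl (w t)) (Ioo 0 T) :=
    ((hVc.integrableOn_Icc (a := 0) (b := T)).mono_set Ioo_subset_Icc_self).sub hwi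
  have key : ∀ᵐ t, t ∈ Ioo 0 T → V t - H4.incl (w t) = 0 := by
    refine isOpen_Ioo.ae_eq_zero_of_integral_contDiff_smul_eq_zero hDi.locallyIntegrableOn
      fun ζ h1 h2 h3 => ?_
    rw [← setIntegral_eq_integral_of_forall_compl_eq_zero (s := Ioo 0 T) fun t ht => by
      rw [image_eq_zero_of_notMem_tsupport fun h => ht (h3 h), zero_smul]]
    obtain ⟨η, e1, e2, e3, e4⟩ := exists_primitive_test hT h1 h2 h3
    obtain ⟨c, hc⟩ := h1.continuous.bounded_above_of_compact_support h2
    have hζi : IntegrableOn (fun t => ζ t • (V t - H4.incl (w t))) (Ioo 0 T) :=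
      Integrable.bdd_smul hDi c h1.continuous.aestronglyMeasurable (Eventually.of_forall hc)
    refine eq_zero_of_inner_dense dense_range_L ?_
    rintro _ ⟨χ, rfl⟩
    set X := LTest χ with hX
    have f1 : ContDiff ℝ ∞ fun q : ℝ × (ℝ × ℝ) => η q.1 * (X : ℝ × ℝ → ℝ) q.2 :=
      (e1.comp contDiff_fst).mul (X.2.1.comp contDiff_snd)
    have f2 : HasCompactSupport fun q : ℝ × (ℝ × ℝ) => η q.1 * (X : ℝ × ℝ → ℝ) q.2 :=
      HasCompactSupport.intro (e2.isCompact.prod X.2.2.isCompact) fun q hq => by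
        by_cases h : q.1 ∈ tsupport η
        · rw [image_eq_zero_of_notMem_tsupport (f := (X : ℝ × ℝ → ℝ)) fun h' => hq ⟨h, h'⟩,
            mul_zero]
        · rw [image_eq_zero_of_notMem_tsupport h, zero_mul]
    have f3 : (tsupport fun q : ℝ × (ℝ × ℝ) => η q.1 * (X : ℝ × ℝ → ℝ) q.2) ⊆ Iio T ×ˢ univ := by
      have : (tsupport fun q : ℝ × (ℝ × ℝ) => η q.1 * (X : ℝ × ℝ → ℝ) q.2) ⊆
          Prod.fst ⁻¹' tsupport η :=
        closure_minimal (fun q hq => subset_tsupport _ (left_ne_zero_of_mul hq))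
          ((isClosed_tsupport η).preimage continuous_fst)
      exact fun q hq => ⟨e3 (this hq), mem_univ _⟩
    have hd := weak_defect (v₀ := v₀) hC hδ hT hg hw.memLp f1 f2 f3
    rw [hw.eqn _ f1 f2 f3, left_eq_add] at hd
    refine (integral_inner hζi _).symm.trans (Eq.trans ?_ hd)
    refine setIntegral_congr_fun measurableSet_Ioo fun t ht => ?_
    have hs : slice (contDiff_dt f1) (hasCompactSupport_dt f2) t = ζ t • X := by
      refine Subtype.ext (funext fun p => ?_)
      exact (hasDerivAt_dt f1 t p).unique ((e4 t ht).mul_const ((X : ℝ × ℝ → ℝ) p))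
    simp only [hs, map_smul, real_inner_smul_right]
    rw [real_inner_comm]
  rw [ae_restrict_iff' measurableSet_Ioo]
  filter_upwards [key] with t ht h
  exact (sub_eq_zero.1 (ht h)).symm

/-- The primitive `X` starts at zero and equals `w - v` almost everywhere; the lower `L²` bound on
the operator gives `(‖X‖²)' ≤ 2 ‖X‖²` in integrated form, so `X = 0`. -/
theorem IsWeakSolution.unique (hC : CoeffBound K δ) (hδ : δ ≠ 0) (hT : 0 < T)
    (hg : MemLp g ⊤ (timeMeasure T)) (hgn : ∀ᵐ t ∂(timeMeasure T), ‖g t‖ < 1 / 50)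
    (hw : IsWeakSolution T δ g v₀ w) (hv : IsWeakSolution T δ g v₀ v) :
    w =ᵐ[timeMeasure T] v := by
  obtain ⟨M, hM⟩ := bddMeas_opPath δ hg hw.memLp
  obtain ⟨M', hM'⟩ := bddMeas_opPath δ hg hv.memLp
  set m : ℝ → L2 := fun s => opPath T δ g v s - opPath T δ g w s with hm
  have hmB : BddMeas (M' + M) m := ⟨hM'.aesm.sub hM.aesm, by
    filter_upwards [hM.bound, hM'.bound] with s h1 h2
    exact (norm_sub_le _ _).trans (add_le_add h2 h1)⟩
  set X : ℝ → L2 := fun t => ∫ s in (0 : ℝ)..t, m s with hX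
  have hXc : Continuous X := by
    have := hmB.continuous_primitive 0 0
    simpa using this
  have hXeq : ∀ᵐ t, t ∈ Ioo 0 T → X t = H4.incl (w t) - H4.incl (v t) := by
    have h1 := (ae_restrict_iff' measurableSet_Ioo).1 (hw.integral_eq hC hδ hT hg)
    have h2 := (ae_restrict_iff' measurableSet_Ioo).1 (hv.integral_eq hC hδ hT hg)
    filter_upwards [h1, h2] with t e1 e2 ht
    rw [e1 ht, e2 ht, hX]
    simp only [hm]
    rw [intervalIntegral.integral_sub (hM'.intervalIntegrable _ _) (hM.intervalIntegrable _ _)]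
    abel
  have hprod := fun t => inner_primitive hmB hmB 0 0 (V := X) (W := X)
    (fun t => (zero_add _).symm) (fun t => (zero_add _).symm) t
  have hle : ∀ t ∈ Icc 0 T, ‖X t‖ ^ 2 ≤ 0 + 2 * ∫ s in (0 : ℝ)..t, ‖X s‖ ^ 2 := by
    intro t ht
    rw [← real_inner_self_eq_norm_sq, hprod t, inner_zero_left]
    have i1 := intervalIntegrable_inner hmB hXc 0 t
    have hsub : Ioo 0 t ⊆ Ioo 0 T := Ioo_subset_Ioo_right ht.2
    rw [← intervalIntegral.integral_const_mul, intervalIntegral.integral_of_le ht.1,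
      intervalIntegral.integral_of_le ht.1, integral_Ioc_eq_integral_Ioo,
      integral_Ioc_eq_integral_Ioo]
    refine add_le_add le_rfl (setIntegral_mono_ae_restrict ?_ ?_ ?_)
    · exact ((intervalIntegrable_iff_integrableOn_Ioo_of_le ht.1).1 i1).add
        ((intervalIntegrable_iff_integrableOn_Ioo_of_le ht.1).1 i1)
    · exact ((by fun_prop : Continuous fun s => 2 * ‖X s‖ ^ 2).integrableOn_Icc).mono_set
        Ioo_subset_Icc_self
    · have h1 := (ae_restrict_iff' measurableSet_Ioo).1 hgn
      refine (ae_restrict_iff' measurableSet_Ioo).2 ?_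
      filter_upwards [h1, hXeq] with s e1 e2 hs
      have hs' := hsub hs
      have e3 : m s = -opL2 δ (g s) (w s - v s) := by
        simp only [hm, opPath, indicator_of_mem hs', map_sub, neg_sub]
      have h2 := opL2_inner_incl_ge hC hδ (e1 hs') (w s - v s)
      rw [e3, e2 hs', ← map_sub, inner_neg_left]
      linarith
  have hzero : ∀ t ∈ Icc 0 T, X t = 0 := fun t ht => by
    have := le_exp_of_le_integral (f := fun t => ‖X t‖ ^ 2) (by fun_prop) zero_le_two hle t ht
    rw [zero_mul] at this
    exact norm_eq_zero.1 (pow_eq_zero_iff two_ne_zero |>.1 (le_antisymm this (sq_nonneg _)))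
  rw [EventuallyEq, ae_restrict_iff' measurableSet_Ioo]
  filter_upwards [hXeq] with t ht h
  refine H4.incl_injective (sub_eq_zero.1 ?_)
  rw [← ht h, hzero t (Ioo_subset_Icc_self h)]

end Uniqueness

/-! ### Existence in `H⁴` and the weighted `y`-derivative of the solution. -/

theorem toH4_injective : Function.Injective toH4 := by
  intro φ ψ h
  have h1 : toL2 φ = toL2 ψ := by rw [← incl_toH4, ← incl_toH4, h]
  refine Subtype.ext ((φ.2.1.continuous.ae_eq_iff_eq volume ψ.2.1.continuous).1 ?_)
  exact (coe_toL2 φ).symm.trans ((EventuallyEq.of_eq (by rw [h1])).trans (coe_toL2 ψ))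

/-- The operator `φ ↦ ∂_y(⟨δ(x,y)⟩⁻¹ φ)` on test functions. -/
def dyWeight (δ : ℝ) : testSpace →ₗ[ℝ] testSpace :=
  DTest 0 1 ∘ₗ mulTest (weight δ) (smooth_weight δ)

/-- The operator `φ ↦ ⟨δ(x,y)⟩⁻¹ ∂_y φ` on test functions. -/
def weightDy (δ : ℝ) : testSpace →ₗ[ℝ] testSpace :=
  mulTest (weight δ) (smooth_weight δ) ∘ₗ DTest 0 1

theorem inner_dyWeight (δ : ℝ) (u φ : testSpace) :
    inner ℝ (toL2 (dyWeight δ u)) (toL2 φ) = -inner ℝ (toL2 u) (toL2 (weightDy δ φ)) := by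
  rw [inner_toL2_toL2, inner_toL2_toL2]
  have h := ip_dy (u.2.weight_mul δ).hinf φ.2.hinf
  rw [ip_mul_left, ip_comm (u : ℝ × ℝ → ℝ), ip_comm] at h
  have h' : ip (dyWeight δ u : ℝ × ℝ → ℝ) φ = ip (dy (weight δ * u)) φ := rfl
  have h'' : ip (u : ℝ × ℝ → ℝ) (weightDy δ φ) = ip (u : ℝ × ℝ → ℝ) (weight δ * dy φ) := rfl
  rw [h', h'']
  linarith

/-- Pairings of `v` and `z` with fixed vectors are stable under weak limits in `H⁴` and measurable
in time; both properties are needed to construct `z`. -/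
theorem hasWeakDeriv_weight_iff {K δ : ℝ} (hC : CoeffBound K δ) (v z : H4) :
    HasWeakDeriv 0 1 (fun q => weight δ q * v.fn q) z.fn ↔
      ∀ φ, inner ℝ (H4.incl z) (toL2 φ) = -inner ℝ (H4.incl v) (toL2 (weightDy δ φ)) := by
  have h : ∀ φ, inner ℝ (H4.incl v) (toL2 (weightDy δ φ)) =
      inner ℝ (H4.incl (weightH4 δ v)) (toL2 (DTest 0 1 φ)) := fun φ => by
    rw [inner_toL2, inner_toL2]
    refine integral_congr_ae ?_
    filter_upwards [fn_weightH4 hC v] with p hp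
    rw [← H4.fn_eq, ← H4.fn_eq, hp]
    have : (weightDy δ φ : ℝ × ℝ → ℝ) p = weight δ p * (DTest 0 1 φ : ℝ × ℝ → ℝ) p := rfl
    rw [this]
    ring
  have h' : HasWeakDeriv 0 1 (fun q => weight δ q * v.fn q) z.fn ↔
      HasWeakDeriv 0 1 (H4.incl (weightH4 δ v)) (H4.incl z) :=
    ⟨fun H => H.congr (fn_weightH4 hC v).symm EventuallyEq.rfl,
      fun H => H.congr (fn_weightH4 hC v) EventuallyEq.rfl⟩
  rw [h', hasWeakDeriv_iff_inner]
  simp only [h, zero_add, pow_one, neg_one_mul]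

section Existence

variable {T K δ : ℝ} {g : ℝ → H4}

/-- The abstract scheme with `j` the inclusion into `L²`, `R` the test functions inside `H⁴`, `Λ`
the elliptic operator and `Δ` the dissipation. Injectivity of `toH4` makes the last two well defined
on `R`. -/
theorem exists_evolution_H4 (hT : 0 < T) (hK : 1 ≤ K) (hC : CoeffBound K δ) (hδ : δ ≠ 0)
    (hg : MemLp g ⊤ (timeMeasure T)) (hgn : ∀ᵐ t ∂(timeMeasure T), ‖g t‖ < 1 / 50) {C : ℝ}
    (hCC : C = (12000 * K) ^ 2 * 2) (ν : H4) :
    ∃ v : ℝ → H4, AEStronglyMeasurable v volume ∧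
      (∀ t, ‖v t‖ ≤ Real.exp (C * T) * ‖ν‖) ∧
      (∀ d : H4, ContinuousOn (fun t => inner ℝ d (v t)) (Icc 0 T)) ∧
      (∀ t ∈ Icc 0 T, H4.incl (v t) = H4.incl ν - ∫ s in (0 : ℝ)..t, opPath T δ g v s) ∧
      ∃ u : ℕ → ℝ → testSpace, (∀ n, Continuous fun t => toH4 (dyWeight δ (u n t))) ∧
        (∀ n, ∫ s in (0 : ℝ)..T, ‖toH4 (dyWeight δ (u n s))‖ ^ 2 ≤
          2 * (1 + 2 * C * T * Real.exp (2 * C * T)) * ‖ν‖ ^ 2) ∧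
        ∀ t ∈ Icc 0 T, ∀ d : H4,
          Tendsto (fun n => inner ℝ d (toH4 (u n t))) atTop (𝓝 (inner ℝ d (v t))) := by
  set e : testSpace ≃ₗ[ℝ] LinearMap.range toH4 := LinearEquiv.ofInjective toH4 toH4_injective
    with he
  have hes : ∀ φ : LinearMap.range toH4, toH4 (e.symm φ) = φ := fun φ => by
    conv_rhs => rw [← e.apply_symm_apply φ]
    rfl
  set A : ℝ → H4 →L[ℝ] L2 := (Ioo 0 T).indicator fun t => opL2 δ (g t) with hA
  obtain ⟨B, hB0, hB⟩ := exists_norm_opL2_le δ (1 / 50)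
  have hAB : BddMeas B A := by
    refine ⟨(aestronglyMeasurable_indicator_iff measurableSet_Ioo).2
      ((continuous_opL2 δ).comp_aestronglyMeasurable hg.1), ?_⟩
    filter_upwards [(ae_restrict_iff' measurableSet_Ioo).1 hgn] with t ht
    by_cases h : t ∈ Ioo 0 T
    · rw [hA, indicator_of_mem h]
      exact hB _ (ht h).le
    · rw [hA, indicator_of_notMem h]
      exact ContinuousLinearMap.opNorm_zero.trans_le hB0
  have hAv : ∀ (v : ℝ → H4) s, A s (v s) = opPath T δ g v s := fun v s => by
    by_cases h : s ∈ Ioo 0 T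
    · rw [hA, opPath, indicator_of_mem h, indicator_of_mem h]
    · rw [hA, opPath, indicator_of_notMem h, indicator_of_notMem h]
      rfl
  obtain ⟨v, h1, h2, h3, h4, u, h5, h6, h7⟩ := exists_evolution (R := LinearMap.range toH4)
    (Λ := toL2 ∘ₗ LTest ∘ₗ e.symm.toLinearMap) (Δ := toH4 ∘ₗ dyWeight δ ∘ₗ e.symm.toLinearMap)
    (A := A) (K := B) (C := C) (T := T) (j := H4.incl) hT.le (by rw [hCC]; positivity) hAB
    H4.incl_injective
    (fun u φ => by
      simp only [LinearMap.comp_apply, LinearEquiv.coe_coe]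
      rw [inner_incl_LTest, hes])
    (by
      rw [← dense_range_L]
      congr 2
      ext x
      constructor
      · rintro ⟨φ, rfl⟩
        exact ⟨e.symm φ, rfl⟩
      · rintro ⟨φ, rfl⟩
        exact ⟨e φ, by simp⟩)
    (by
      filter_upwards [(ae_restrict_iff' measurableSet_Ioo).1 hgn] with t ht h φ
      rw [hA, indicator_of_mem h, hCC]
      have := opL2_coercive hK hC hδ (ht h) (e.symm φ)
      rwa [hes] at this) ν
  refine ⟨v, h1, h2, h3, fun t ht => ?_, fun n t => e.symm (u n t), h5, h6, fun t ht d => ?_⟩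
  · rw [h4 t ht]
    simp only [hAv]
  · simp only [hes]
    exact h7 t ht d

theorem exists_weight_deriv {ι : Type*} {l : Filter ι} [l.NeBot] (hC : CoeffBound K δ)
    {u : ι → testSpace} {v : H4} {M : ℝ} (hM : ∀ᶠ n in l, ‖toH4 (dyWeight δ (u n))‖ ≤ M)
    (hu : ∀ d : H4, Tendsto (fun n => inner ℝ d (toH4 (u n))) l (𝓝 (inner ℝ d v))) :
    ∃ z : H4, ‖z‖ ≤ M ∧ HasWeakDeriv 0 1 (fun q => weight δ q * v.fn q) z.fn := by
  -- Along an ultrafilter every bounded real family converges, so all pairings have limits at once,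
  -- without extracting a subsequence.
  set U : Ultrafilter ι := Ultrafilter.of l with hU
  have hUl : (U : Filter ι) ≤ l := Ultrafilter.of_le l
  obtain ⟨z, hz, hlim⟩ := exists_weak_limit (hM.filter_mono hUl) fun d => by
    have hb : ∀ᶠ n in (U : Filter ι),
        inner ℝ d (toH4 (dyWeight δ (u n))) ∈ Icc (-(‖d‖ * M)) (‖d‖ * M) := by
      filter_upwards [hM.filter_mono hUl] with n hn
      exact abs_le.1 ((abs_real_inner_le_norm _ _).trans
        (mul_le_mul_of_nonneg_left hn (norm_nonneg _)))
    obtain ⟨a, -, ha⟩ := isCompact_Icc.ultrafilter_le_nhds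
      (U.map fun n => inner ℝ d (toH4 (dyWeight δ (u n)))) (le_principal_iff.2 hb)
    exact ⟨a, ha⟩
  refine ⟨z, hz, (hasWeakDeriv_weight_iff hC v z).2 fun φ => ?_⟩
  have hincl : ∀ (x : H4) (f : L2), inner ℝ (H4.incl x) f =
      inner ℝ (ContinuousLinearMap.adjoint H4.incl f) x := fun x f => by
    rw [ContinuousLinearMap.adjoint_inner_left, real_inner_comm]
  refine tendsto_nhds_unique (f := fun n => inner ℝ (H4.incl (toH4 (dyWeight δ (u n)))) (toL2 φ))
    (l := (U : Filter ι)) ?_ ?_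
  · simp only [hincl]
    exact hlim _
  · simp only [incl_toH4, inner_dyWeight]
    simp only [← incl_toH4 (u _), hincl]
    exact ((hu _).mono_left hUl).neg

/-- By Fatou's lemma the lower limit `ℓ s` of the squared dissipation norms is integrable with
integral at most `B`, hence finite almost everywhere; at such times a weak limit of the derivatives
exists and has squared norm at most `ℓ s`. -/
theorem exists_memLp_weight_deriv (hT : 0 < T) (hC : CoeffBound K δ) {v : ℝ → H4}
    (hv : AEStronglyMeasurable v volume) {u : ℕ → ℝ → testSpace} {B : ℝ}
    (hc : ∀ n, Continuous fun t => toH4 (dyWeight δ (u n t)))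
    (hB : ∀ n, ∫ s in (0 : ℝ)..T, ‖toH4 (dyWeight δ (u n s))‖ ^ 2 ≤ B)
    (hu : ∀ t ∈ Icc 0 T, ∀ d : H4,
      Tendsto (fun n => inner ℝ d (toH4 (u n t))) atTop (𝓝 (inner ℝ d (v t)))) :
    ∃ z : ℝ → H4, MemLp z 2 (timeMeasure T) ∧
      (∀ᵐ s ∂(timeMeasure T),
        HasWeakDeriv 0 1 (fun q => weight δ q * (v s).fn q) (z s).fn) ∧
      ∫ s in Ioo 0 T, ‖z s‖ ^ 2 ≤ B := by
  classical
  set Z : ℕ → ℝ → ℝ≥0∞ := fun n s => ENNReal.ofReal (‖toH4 (dyWeight δ (u n s))‖ ^ 2) with hZ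
  have hZm : ∀ n, Measurable (Z n) := fun n =>
    ((hc n).norm.pow 2).measurable.ennreal_ofReal
  have hZi : ∀ n, ∫⁻ s in Ioo 0 T, Z n s ≤ ENNReal.ofReal B := fun n => by
    have h := hB n
    rw [intervalIntegral.integral_of_le hT.le, integral_Ioc_eq_integral_Ioo] at h
    have hi : IntegrableOn (fun s => ‖toH4 (dyWeight δ (u n s))‖ ^ 2) (Ioo 0 T) :=
      ((hc n).norm.pow 2).integrableOn_Icc.mono_set Ioo_subset_Icc_self
    exact (ofReal_integral_eq_lintegral_ofReal hi
      (Eventually.of_forall fun _ => sq_nonneg _)).symm.trans_le (ENNReal.ofReal_le_ofReal h)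
  set ℓ : ℝ → ℝ≥0∞ := fun s => liminf (fun n => Z n s) atTop with hℓ
  have hℓm : Measurable ℓ := Measurable.liminf hZm
  have hℓi : ∫⁻ s in Ioo 0 T, ℓ s ≤ ENNReal.ofReal B :=
    (lintegral_liminf_le hZm).trans (liminf_le_of_frequently_le'
      (Frequently.of_forall hZi))
  have hℓfin : ∀ᵐ s ∂(timeMeasure T), ℓ s < ⊤ :=
    ae_lt_top hℓm (hℓi.trans_lt ENNReal.ofReal_lt_top).ne
  have hex : ∀ s ∈ Ioo 0 T, ∀ r : ℝ, ℓ s < ENNReal.ofReal r →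
      ∃ z : H4, ‖z‖ ^ 2 ≤ r ∧ HasWeakDeriv 0 1 (fun q => weight δ q * (v s).fn q) z.fn := by
    intro s hs r hr
    have hr0 : 0 < r := ENNReal.ofReal_pos.1 (bot_le.trans_lt hr)
    have hfreq : ∃ᶠ n in atTop, Z n s < ENNReal.ofReal r :=
      frequently_lt_of_liminf_lt (by isBoundedDefault) hr
    -- Restricting to the infinitely many indices with dissipation below `r` keeps the weak
    -- convergence of `u n s` and adds the bound.
    have : (atTop ⊓ 𝓟 {n | Z n s < ENNReal.ofReal r}).NeBot :=
      frequently_mem_iff_neBot.1 hfreq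
    obtain ⟨z, hz, hz'⟩ := exists_weight_deriv (l := atTop ⊓ 𝓟 {n | Z n s < ENNReal.ofReal r})
      (u := fun n => u n s) (v := v s) (M := √r) hC
      (by
        refine eventually_inf_principal.2 (Eventually.of_forall fun n hn => ?_)
        exact Real.le_sqrt_of_sq_le ((ENNReal.ofReal_lt_ofReal_iff hr0).1 hn).le)
      (fun d => (hu s (Ioo_subset_Icc_self hs) d).mono_left inf_le_left)
    exact ⟨z, (Real.le_sqrt (norm_nonneg _) hr0.le).1 hz, hz'⟩
  -- Weak derivatives are unique, so the choice is immaterial; the default `0` occurs only on a null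
  -- set of times in `(0, T)`.
  set z : ℝ → H4 := fun s => if h : ∃ z : H4,
    HasWeakDeriv 0 1 (fun q => weight δ q * (v s).fn q) z.fn then h.choose else 0 with hz
  have hzs : ∀ s, (∃ y : H4, HasWeakDeriv 0 1 (fun q => weight δ q * (v s).fn q) y.fn) →
      HasWeakDeriv 0 1 (fun q => weight δ q * (v s).fn q) (z s).fn := fun s hs => by
    rw [hz]
    simp only [dif_pos hs]
    exact hs.choose_spec
  have hzd : ∀ᵐ s ∂(timeMeasure T),
      HasWeakDeriv 0 1 (fun q => weight δ q * (v s).fn q) (z s).fn := by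
    filter_upwards [hℓfin, ae_restrict_mem measurableSet_Ioo] with s hs hsT
    obtain ⟨r, hr⟩ := ENNReal.lt_iff_exists_nnreal_btwn.1 hs
    obtain ⟨y, -, hy⟩ := hex s hsT r (by simpa using hr.1)
    exact hzs s ⟨y, hy⟩
  have hzle : ∀ᵐ s ∂(timeMeasure T), ENNReal.ofReal (‖z s‖ ^ 2) ≤ ℓ s := by
    filter_upwards [hzd, ae_restrict_mem measurableSet_Ioo] with s hs hsT
    refine ENNReal.le_of_forall_nnreal_lt fun r hr => ?_
    by_contra! hlt
    obtain ⟨r', h1, h2⟩ := ENNReal.lt_iff_exists_nnreal_btwn.1 hlt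
    obtain ⟨y, hy, hy'⟩ := hex s hsT r' (by simpa using h1)
    have : z s = y := H4.ext_fn (hs.unique hy')
    rw [← this] at hy
    refine absurd (hr.trans_le (ENNReal.ofReal_le_ofReal hy)) (not_lt.2 ?_)
    simpa using h2.le
  have hzm : AEStronglyMeasurable z (timeMeasure T) := by
    refine aestronglyMeasurable_of_inner (S := range toH4) ?_ ?_
    · rw [← LinearMap.coe_range, Submodule.span_eq, ← Submodule.dense_iff_topologicalClosure_eq_top,
        LinearMap.coe_range]
      exact denseRange_toH4
    -- The pairing of `z s` with `φ` in `H⁴` is a pairing of `v s` with a fixed function in `L²`, so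
    -- measurability comes from `v` in spite of the pointwise choice.
    · rintro _ ⟨φ, rfl⟩
      have h1 : AEStronglyMeasurable (fun s => -inner ℝ (H4.incl (v s))
          (toL2 (weightDy δ (LTest φ)))) (timeMeasure T) :=
        ((H4.incl.continuous.comp_aestronglyMeasurable hv.restrict).inner
          aestronglyMeasurable_const).neg
      refine h1.aemeasurable.congr ?_
      filter_upwards [hzd] with s hs
      rw [← (hasWeakDeriv_weight_iff hC _ _).1 hs, inner_incl_LTest, real_inner_comm]
  have hzi : ∫⁻ s in Ioo 0 T, ENNReal.ofReal (‖z s‖ ^ 2) ≤ ENNReal.ofReal B :=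
    (lintegral_mono_ae hzle).trans hℓi
  have hB0 : 0 ≤ B := le_trans (by
    refine intervalIntegral.integral_nonneg hT.le fun s _ => sq_nonneg _) (hB 0)
  have hint : Integrable (fun s => ‖z s‖ ^ 2) (timeMeasure T) := by
    refine ⟨(hzm.norm.pow 2), ?_⟩
    rw [hasFiniteIntegral_iff_ofReal (Eventually.of_forall fun _ => sq_nonneg _)]
    exact hzi.trans_lt ENNReal.ofReal_lt_top
  refine ⟨z, (memLp_two_iff_integrable_sq_norm hzm).2 hint, hzd, ?_⟩
  rw [integral_eq_lintegral_of_nonneg_ae (Eventually.of_forall fun _ => sq_nonneg _) hint.1]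
  exact ENNReal.toReal_le_of_le_ofReal hB0 hzi

end Existence

end KP

end

/-! ### The main theorem. -/

theorem proposition2p1 :
    ∃ ε₀ : ℝ, 0 < ε₀ ∧ ∃ δ₀ : ℝ, 0 < δ₀ ∧
      ∀ T : ℝ, 0 < T →
        ∃ B₀ : ℝ, 0 < B₀ ∧
          ∀ δ : ℝ, 0 < δ → δ < δ₀ →
          ∀ (g : ℝ → KP.H4) (v₀ : KP.H4),
            MemLp g ∞ (KP.timeMeasure T) →
            eLpNorm g ∞ (KP.timeMeasure T) ≤ ENNReal.ofReal ε₀ →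
            ‖v₀‖ ≤ ε₀ →
            ∃ v : ℝ → KP.H4,
              KP.IsWeakSolution T δ g v₀ v ∧
              (∀ w : ℝ → KP.H4, KP.IsWeakSolution T δ g v₀ w → w =ᵐ[KP.timeMeasure T] v) ∧
              -- `v` is the weakly continuous representative, so that `v t` has a meaning for each `t`
              (∀ f : KP.H4, ContinuousOn (fun t => inner ℝ f (v t)) (Icc 0 T)) ∧
              -- `z = ∂_y (⟨δ(x,y)⟩⁻¹ v)`
              ∃ z : ℝ → KP.H4,
                MemLp z 2 (KP.timeMeasure T) ∧
                (∀ᵐ s ∂(KP.timeMeasure T),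
                  KP.HasWeakDeriv 0 1 (fun q => KP.weight δ q * (v s).fn q) (z s).fn) ∧
                ∀ t : ℝ, 0 < t → t ≤ T →
                  ‖v t‖ ^ 2 + (1 / 4) * ∫ s in Ioo 0 t, ‖z s‖ ^ 2 ≤ B₀ * ‖v₀‖ ^ 2 := by
  obtain ⟨K, hK, hCK⟩ := KP.exists_coeffBound
  refine ⟨1 / 100, by norm_num, 1, one_pos, fun T hT => ?_⟩
  set C : ℝ := (12000 * K) ^ 2 * 2 with hCC
  have hC0 : 0 ≤ C := by positivity
  set E₁ : ℝ := Real.exp (C * T) with hE₁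
  set E₂ : ℝ := 2 * (1 + 2 * C * T * Real.exp (2 * C * T)) with hE₂
  have hE₁0 : 0 < E₁ := Real.exp_pos _
  have hE₂0 : 0 ≤ E₂ := by positivity
  have hK0 : 0 < K := one_pos.trans_le hK
  -- `E₁ ^ 2` bounds the solution, `E₂` the whole dissipation, and `(80 * K) ^ 2` the passage from
  -- `v₀` to the weighted initial datum.
  refine ⟨(E₁ ^ 2 + E₂) * (80 * K) ^ 2, by positivity, fun δ hδ hδ1 g v₀ hg hgn _ => ?_⟩
  have hC := hCK δ hδ.le hδ1.le
  have hgn' : ∀ᵐ t ∂(KP.timeMeasure T), ‖g t‖ < 1 / 50 := by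
    have h := ae_le_eLpNormEssSup (f := g) (μ := KP.timeMeasure T)
    rw [← eLpNorm_exponent_top] at h
    filter_upwards [h] with t ht
    have h1 := ENNReal.toReal_le_of_le_ofReal (by norm_num) (ht.trans hgn)
    rw [toReal_enorm] at h1
    linarith
  obtain ⟨v, hvm, hvb, hvc, hve, u, hu1, hu2, hu3⟩ :=
    KP.exists_evolution_H4 hT hK hC hδ.ne' hg hgn' hCC (KP.weightH4 δ v₀)
  have hsol : KP.IsWeakSolution T δ g v₀ v :=
    KP.isWeakSolution_of_integral_eq hC hδ.ne' hT hg
      (memLp_top_of_bound hvm.restrict _ (Filter.Eventually.of_forall hvb))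
      fun t ht => hve t (Ioo_subset_Icc_self ht)
  obtain ⟨z, hz1, hz2, hz3⟩ := KP.exists_memLp_weight_deriv hT hC hvm hu1 hu2 hu3
  refine ⟨v, hsol, fun w hw => hw.unique hC hδ.ne' hT hg hgn' hsol, hvc, z, hz1, hz2,
    fun t _ htT => ?_⟩
  have h1 : ∫ s in Ioo 0 t, ‖z s‖ ^ 2 ≤ ∫ s in Ioo 0 T, ‖z s‖ ^ 2 :=
    setIntegral_mono_set hz1.integrable_norm_pow' (Filter.Eventually.of_forall fun _ => sq_nonneg _)
      (Ioo_subset_Ioo_right htT).eventuallyLE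
  have h2 : ‖v t‖ ^ 2 ≤ E₁ ^ 2 * ‖KP.weightH4 δ v₀‖ ^ 2 := by
    rw [← mul_pow]
    exact pow_le_pow_left₀ (norm_nonneg _) (hvb t) 2
  have h3 : ‖KP.weightH4 δ v₀‖ ^ 2 ≤ (80 * K) ^ 2 * ‖v₀‖ ^ 2 := by
    rw [← mul_pow]
    exact pow_le_pow_left₀ (norm_nonneg _) (KP.norm_weightH4_le hC v₀) 2
  have h4 := mul_le_mul_of_nonneg_left h3 (add_nonneg (sq_nonneg E₁) hE₂0)
  have h5 : 0 ≤ E₂ * ‖KP.weightH4 δ v₀‖ ^ 2 := by positivity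
  linarith
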